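/- Let $k$ be an algebraically closed field of characteristic zero, let $U$ and $H$ be finite-dimensional semisimple Hopf algebras over $k$, and let $f\colon U\to H$ be a morphism of Hopf algebras. For a finite-dimensional Hopf algebra $A$, let $\mathrm{Rep}(A)$ be the $k$-linear monoidal category of finite-dimensional left $A$-modules, and let $A^{*\mathrm{cop}}$ be the dual algebra $A^*$ (with the convolution product) with the comultiplication opposite to the transpose of the multiplication of $A$, i.e. $\varphi_1(a)\varphi_2(b)=\varphi(ba)$. Let $f_*\colon \mathrm{Rep}(H)\to\mathrm{Rep}(U)$ be the tensor functor given by restriction along $f$, and let $f^{*\mathrm{cop}}\colon H^{*\mathrm{cop}}\to U^{*\mathrm{cop}}$, $\varphi\mapsto\varphi\circ f$. Let $D=D_{f^{*\mathrm{cop}}}(H^{*\mathrm{cop}},U)$ be the generalized quantum double, that is, the coalgebra $H^{*\mathrm{cop}}\otimes U$ with unit $\varepsilon\otimes 1$ and with the twisted product $$x\cdot y=\sigma(x_1,y_1)\,x_2y_2\,\sigma^{-1}(x_3,y_3),\qquad \sigma(\varphi\otimes u,\psi\otimes v)=\varphi(1)\,\psi(f(u))\,\varepsilon(v),$$ where $x_2y_2$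 is the product of the tensor product algebra and $\sigma^{-1}$ is the convolution inverse of $\sigma$. Let $\mathcal Z_{f_*}(\mathrm{Rep}(H))$ be the relative center of $f_*$: its objects are the pairs $(V,\gamma)$ of an object $V$ of $\mathrm{Rep}(U)$ and a natural transformation $\gamma_X\colon V\otimes f_*(X)\to f_*(X)\otimes V$, $X\in\mathrm{Rep}(H)$, such that, up to the structure isomorphisms of $f_*$ and of the monoidal categories, $\gamma_{X\otimes Y}=(\mathrm{id}_{f_*(X)}\otimes\gamma_Y)(\gamma_X\otimes\mathrm{id}_{f_*(Y)})$ and $\gamma_{\mathbf 1}=\mathrm{id}_V$; its morphisms $(V,\gamma)\to(W,\gamma')$ are the morphisms $g\colon V\to W$ of $\mathrm{Rep}(U)$ with $\gamma'_X(g\otimes\mathrm{id})=(\mathrm{id}\otimes g)\gamma_X$ for all $X$; its tensor product is $(V,\gamma)\otimes(W,\gamma')=(V\otimes W,\,(\gamma\otimes\mathrm{id}_W)(\mathrm{id}_V\otimes\gamma'))$. Then $\mathrm{Rep}(D)$ and $\mathcal Z_{f_*}(\mathrm{Rep}(H))$ are fusion categories over $k$, and they are equivalent as fusion categories: there is a $k$-linear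 monoidal equivalence $$\mathrm{Rep}\bigl(D_{f^{*\mathrm{cop}}}(H^{*\mathrm{cop}},U)\bigr)\;\simeq\;\mathcal Z_{f_*}(\mathrm{Rep}(H)).$$ -/

import Mathlib

universe u
noncomputable section
namespace GenDouble
universe v w v₁ v₂ u₁ u₂
open TensorProduct Coalgebra

section Shortcuts
variable {R M N : Type*} [CommSemiring R] [AddCommMonoid M] [AddCommMonoid N] [Module R M] [Module R N]

instance shortcutEquivAdd : AddMonoidHomClass (M ≃ₗ[R] N) M N := inferInstance
instance shortcutEquivZero : ZeroHomClass (M ≃ₗ[R] N) M N := inferInstance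
instance shortcutMapAdd : AddMonoidHomClass (M →ₗ[R] N) M N := inferInstance
instance shortcutMapZero : ZeroHomClass (M →ₗ[R] N) M N := inferInstance
instance shortcutEquivAddHom : AddHomClass (M ≃ₗ[R] N) M N := inferInstance
instance shortcutMapAddHom : AddHomClass (M →ₗ[R] N) M N := inferInstance

end Shortcuts


/-- The Sweedler components of a product. -/
def mulRepr {k : Type u} [Field k] {A : Type v} [Ring A] [Bialgebra k A] {a b : A} {ι κ : Type*} (r : Repr k a ι) (s : Repr k b κ) :
    Repr k (a * b) (ι × κ) where
  index := r.index ×ˢ s.index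
  left p := r.left p.1 * s.left p.2
  right p := r.right p.1 * s.right p.2
  eq := by
    rw [Bialgebra.comul_mul, ← r.eq, ← s.eq, Finset.sum_mul_sum, Finset.sum_product]
    simp

lemma sum_smul_counit {k : Type u} [Field k] {C : Type v} [AddCommGroup C] [Module k C]
    [Coalgebra k C] {h : C} {ι : Type*} (r : Repr k h ι) :
    ∑ i ∈ r.index, counit (R := k) (r.right i) • r.left i = h := by
  have := congr(TensorProduct.rid k C $(sum_tmul_counit_eq r))
  simpa only [map_sum, TensorProduct.rid_tmul, one_smul] using this

section Antipode
variable {k : Type u} [Field k] {A : Type v} [Ring A] [HopfAlgebra k A]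
open HopfAlgebra

lemma sum_coassoc {M : Type*} [AddCommGroup M] [Module k M] (F : A →ₗ[k] A →ₗ[k] A →ₗ[k] M)
    {ι : Type*} {κ μ : ι → Type*} {h : A} (r : Repr k h ι)
    (rl : ∀ i, Repr k (r.left i) (κ i)) (rr : ∀ i, Repr k (r.right i) (μ i)) :
    ∑ i ∈ r.index, ∑ j ∈ (rl i).index, F ((rl i).left j) ((rl i).right j) (r.right i) =
    ∑ i ∈ r.index, ∑ j ∈ (rr i).index, F (r.left i) ((rr i).left j) ((rr i).right j) := by
  have := congr(TensorProduct.lift ((TensorProduct.uncurry (RingHom.id k) A A M) ∘ₗ F)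
    $(sum_tmul_tmul_eq r rl rr))
  simpa [map_sum] using this

/-- `φ ⊗ x ↦ φ(b · -) ⊗ a x` -/
def tw (a b : A) : Module.Dual k A ⊗[k] A →ₗ[k] Module.Dual k A ⊗[k] A :=
  TensorProduct.map (LinearMap.mulLeft k b).dualMap (LinearMap.mulLeft k a)

lemma dualTensorHom_tw (a b : A) (z : Module.Dual k A ⊗[k] A) :
    dualTensorHom k A A (tw a b z) =
      LinearMap.mulLeft k a ∘ₗ dualTensorHom k A A z ∘ₗ LinearMap.mulLeft k b := by
  induction z with
  | zero => simp
  | add x y hx hy => simp [hx, hy, LinearMap.add_comp, LinearMap.comp_add]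
  | tmul φ x => ext c; simp [tw]

/-- `φ ⊗ y ↦ φ ∘ m y` -/
def act (m : A →ₗ[k] A →ₗ[k] A) : Module.Dual k A ⊗[k] A →ₗ[k] Module.Dual k A :=
  TensorProduct.lift (Module.Dual.transpose (R := k) ∘ₗ m).flip

lemma act_tmul (m : A →ₗ[k] A →ₗ[k] A) (φ : Module.Dual k A) (y : A) :
    act m (φ ⊗ₜ y) = φ ∘ₗ m y := by
  ext c; simp [act, Module.Dual.transpose_apply]

/-- `φ ⊗ x ↦ ∑ (φ ∘ m x₂) ⊗ x₁` -/
def galAux (m : A →ₗ[k] A →ₗ[k] A) : Module.Dual k A ⊗[k] A →ₗ[k] Module.Dual k A ⊗[k] A :=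
  (act m).rTensor A ∘ₗ (TensorProduct.assoc k _ A A).symm.toLinearMap ∘ₗ
    ((TensorProduct.comm k A A).toLinearMap ∘ₗ comul).lTensor (Module.Dual k A)

lemma galAux_tmul (m : A →ₗ[k] A →ₗ[k] A) (φ : Module.Dual k A) {x : A} {ι : Type*}
    (r : Repr k x ι) :
    galAux m (φ ⊗ₜ x) = ∑ i ∈ r.index, (φ ∘ₗ m (r.right i)) ⊗ₜ[k] r.left i := by
  simp [galAux, ← r.eq, map_sum, TensorProduct.tmul_sum, act_tmul]

/-- `φ ⊗ x ↦ ∑ φ(T x₂ · -) ⊗ x₁` -/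
def gal (T : A →ₗ[k] A) : Module.Dual k A ⊗[k] A →ₗ[k] Module.Dual k A ⊗[k] A :=
  galAux (LinearMap.mul k A ∘ₗ T)

lemma gal_tmul (T : A →ₗ[k] A) (φ : Module.Dual k A) {x : A} {ι : Type*} (r : Repr k x ι) :
    gal T (φ ⊗ₜ x) =
      ∑ i ∈ r.index, (φ ∘ₗ LinearMap.mulLeft k (T (r.right i))) ⊗ₜ[k] r.left i :=
  galAux_tmul _ φ r

variable [Module.Finite k A]

variable (k A) in
/-- the canonical element of `A^* ⊗ A` -/
def can : Module.Dual k A ⊗[k] A := (dualTensorHomEquiv k A A).symm LinearMap.id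

lemma dualTensorHom_inj {x y : Module.Dual k A ⊗[k] A}
    (h : dualTensorHom k A A x = dualTensorHom k A A y) : x = y :=
  (dualTensorHomEquiv k A A).injective (by simpa using h)

lemma dualTensorHom_can : dualTensorHom k A A (can k A) = LinearMap.id := by
  simp [can]

lemma sum_tw_can (h : A) {ι : Type*} (r : Repr k h ι) :
    ∑ i ∈ r.index, tw (r.left i) (antipode k (r.right i)) (can k A) = counit (R := k) h • can k A := by
  apply dualTensorHom_inj
  ext c
  simp only [map_sum, dualTensorHom_tw, dualTensorHom_can, map_smul]
  simp [← mul_assoc, ← Finset.sum_mul, sum_mul_antipode_eq_smul r]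

lemma sum_antipode_cancel (h : A) {ι : Type*} {κ : ι → Type*} (r : Repr k h ι)
    (rl : ∀ i, Repr k (r.left i) (κ i)) :
    ∑ i ∈ r.index, ∑ j ∈ (rl i).index, (rl i).left j ⊗ₜ[k]
      (antipode k (r.right i) * antipode k (antipode k ((rl i).right j))) = h ⊗ₜ[k] (1 : A) := by
  have h1 := congr((antipode k ∘ₗ LinearMap.mul' k A ∘ₗ (antipode k).rTensor A).lTensor A
    $(sum_tmul_tmul_eq r rl (fun i => ℛ k (r.right i))))
  simp only [map_sum, LinearMap.lTensor_tmul, LinearMap.comp_apply, LinearMap.rTensor_tmul,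
    LinearMap.mul'_apply, antipode_mul_antidistrib] at h1
  rw [h1]
  simp only [← antipode_mul_antidistrib, ← TensorProduct.tmul_sum, ← map_sum,
    sum_antipode_mul_eq_smul, map_smul, antipode_one, TensorProduct.tmul_smul,
    TensorProduct.smul_tmul', ← TensorProduct.sum_tmul, sum_smul_counit]

lemma sum_antipode_cancel' (h : A) {ι : Type*} {κ : ι → Type*} (r : Repr k h ι)
    (rl : ∀ i, Repr k (r.left i) (κ i)) :
    ∑ i ∈ r.index, ∑ j ∈ (rl i).index, (rl i).left j ⊗ₜ[k]
      (antipode k (antipode k (r.right i)) * antipode k ((rl i).right j)) = h ⊗ₜ[k] (1 : A) := by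
  have h1 := congr((antipode k ∘ₗ LinearMap.mul' k A ∘ₗ (antipode k).lTensor A).lTensor A
    $(sum_tmul_tmul_eq r rl (fun i => ℛ k (r.right i))))
  simp only [map_sum, LinearMap.lTensor_tmul, LinearMap.comp_apply,
    LinearMap.mul'_apply, antipode_mul_antidistrib] at h1
  rw [h1]
  simp only [← antipode_mul_antidistrib, ← TensorProduct.tmul_sum, ← map_sum,
    sum_mul_antipode_eq_smul, map_smul, antipode_one, TensorProduct.tmul_smul,
    TensorProduct.smul_tmul', ← TensorProduct.sum_tmul, sum_smul_counit]

lemma sum_gal_tw (h : A) {ι : Type*} (r : Repr k h ι) (z : Module.Dual k A ⊗[k] A) :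
    ∑ i ∈ r.index, gal (antipode k ∘ₗ antipode k) (tw (r.left i) (antipode k (r.right i)) z) =
      (LinearMap.mulLeft k h).lTensor _ (gal (antipode k ∘ₗ antipode k) z) := by
  induction z with
  | zero => simp
  | add x y hx hy => simp only [map_add, Finset.sum_add_distrib, hx, hy]
  | tmul φ x =>
    have rl := fun i => ℛ k (r.left i)
    have rx := ℛ k x
    have e1 : ∀ i, gal (antipode k ∘ₗ antipode k) (tw (r.left i) (antipode k (r.right i)) (φ ⊗ₜ x))
        = ∑ j ∈ (rl i).index, ∑ l ∈ rx.index,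
          (φ ∘ₗ LinearMap.mulLeft k (antipode k (r.right i) * antipode k (antipode k ((rl i).right j)) *
            antipode k (antipode k (rx.right l)))) ⊗ₜ[k] ((rl i).left j * rx.left l) := by
      intro i
      simp only [tw, TensorProduct.map_tmul, LinearMap.mulLeft_apply]
      rw [gal_tmul _ _ (mulRepr (rl i) rx)]
      simp only [mulRepr]
      rw [Finset.sum_product]
      refine Finset.sum_congr rfl fun j _ => Finset.sum_congr rfl fun l _ => ?_
      congr 1
      ext c
      simp [antipode_mul_antidistrib, mul_assoc]
    let F (l) : A →ₗ[k] A →ₗ[k] Module.Dual k A ⊗[k] A := LinearMap.mk₂ k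
      (fun a n => (φ ∘ₗ LinearMap.mulLeft k (n * antipode k (antipode k (rx.right l)))) ⊗ₜ[k]
        (a * rx.left l))
      (by intros; simp [add_mul, TensorProduct.tmul_add])
      (by intros; simp)
      (by intros; rw [← TensorProduct.add_tmul]; congr 1; ext; simp [add_mul, mul_assoc])
      (by intros; rw [TensorProduct.smul_tmul']; congr 1; ext; simp [mul_assoc])
    have h2 := congr(TensorProduct.lift (∑ l ∈ rx.index, F l)
      $(sum_antipode_cancel h r rl))
    simp only [map_sum, TensorProduct.lift.tmul, LinearMap.sum_apply] at h2
    simp only [e1, gal_tmul _ _ rx, map_sum, LinearMap.lTensor_tmul]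
    convert h2 using 1
    all_goals simp [F]

lemma gal_gal (z : Module.Dual k A ⊗[k] A) :
    gal (antipode k) (gal (antipode k ∘ₗ antipode k) z) = z := by
  induction z with
  | zero => simp
  | add x y hx hy => simp only [map_add, hx, hy]
  | tmul φ x =>
    have r := ℛ k x
    have rl := fun i => ℛ k (r.left i)
    have h2 := congr(TensorProduct.comm k _ _ ((Module.Dual.transpose (R := k) (M := A) (M' := A)
        ∘ₗ LinearMap.mul k A).flip φ |>.lTensor A $(sum_antipode_cancel' x r rl)))
    rw [gal_tmul _ _ r, map_sum]
    simp only [gal_tmul _ _ (rl _)]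
    simp only [map_sum, LinearMap.lTensor_tmul, TensorProduct.comm_tmul] at h2
    convert h2 using 4
    · ext; simp [Module.Dual.transpose_apply, mul_assoc]
    · ext; simp [Module.Dual.transpose_apply]

/-- partial trace: a left integral, nonzero -/
lemma exists_integral : ∃ t : A, t ≠ 0 ∧ ∀ h : A, h * t = counit (R := k) h • t := by
  set S2 : A →ₗ[k] A := antipode k ∘ₗ antipode k
  set Y := gal S2 (can k A) with hY
  have hinv : ∀ h : A, (LinearMap.mulLeft k h).lTensor _ Y = counit (R := k) h • Y := by
    intro h
    rw [hY, ← sum_gal_tw h (ℛ k h), ← map_sum, sum_tw_can, map_smul]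
  have hne : Y ≠ 0 := by
    intro h0
    have h1 := gal_gal (can k A)
    rw [← hY, h0, map_zero] at h1
    have h2 := dualTensorHom_can (k := k) (A := A)
    rw [← h1, map_zero] at h2
    have h3 := congr(counit (R := k) ($h2 (1 : A)))
    simp at h3
  have : ∃ c, dualTensorHom k A A Y c ≠ 0 := by
    by_contra! hc
    exact hne (dualTensorHom_inj (by ext c; simp [hc]))
  obtain ⟨c, hc⟩ := this
  refine ⟨_, hc, fun h => ?_⟩
  have h3 : ∀ z : Module.Dual k A ⊗[k] A, dualTensorHom k A A ((LinearMap.mulLeft k h).lTensor _ z) c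
      = h * dualTensorHom k A A z c := by
    intro z
    induction z with
    | zero => simp
    | add x y hx hy => simp [hx, hy, mul_add]
    | tmul φ x => simp
  rw [← h3, hinv]
  simp

lemma sum_antipode_comul {h : A} {ι : Type*} (r : Repr k h ι) :
    ∑ i ∈ r.index, (antipode k (r.left i) ⊗ₜ[k] (1 : A)) * comul (r.right i) = 1 ⊗ₜ[k] h := by
  have rl := fun i => ℛ k (r.left i)
  have rr := fun i => ℛ k (r.right i)
  have h1 := congr((LinearMap.mul' k A ∘ₗ (antipode k).rTensor A).rTensor A
    ((TensorProduct.assoc k A A A).symm $(sum_tmul_tmul_eq r rl rr)))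
  simp only [map_sum, TensorProduct.assoc_symm_tmul, LinearMap.rTensor_tmul, LinearMap.comp_apply,
    LinearMap.mul'_apply] at h1
  simp only [← TensorProduct.sum_tmul, sum_antipode_mul_eq_smul] at h1
  simp only [TensorProduct.smul_tmul, ← TensorProduct.tmul_sum, sum_counit_smul] at h1
  rw [h1]
  refine Finset.sum_congr rfl fun i _ => ?_
  rw [← (rr i).eq, Finset.mul_sum]
  simp

lemma antipode_mul_comul_integral {t : A} (ht : ∀ h : A, h * t = counit (R := k) h • t) (h : A) :
    (antipode k h ⊗ₜ[k] (1 : A)) * comul t = ((1 : A) ⊗ₜ[k] h) * comul t := by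
  have r := ℛ k h
  have h1 : ∀ y : A, comul (R := k) y * comul (R := k) t = counit (R := k) y • comul (R := k) t := by
    intro y
    rw [← Bialgebra.comul_mul, ht, map_smul]
  rw [← sum_antipode_comul r, Finset.sum_mul]
  simp only [mul_assoc, h1]
  conv_lhs => rw [← sum_smul_counit r, map_sum, TensorProduct.sum_tmul, Finset.sum_mul]
  refine Finset.sum_congr rfl fun i _ => ?_
  rw [map_smul, ← TensorProduct.smul_tmul', smul_mul_assoc, mul_smul_comm]

lemma integral_nondegenerate {t : A} (ht0 : t ≠ 0)
    (ht : ∀ h : A, h * t = counit (R := k) h • t) {ψ : Module.Dual k A}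
    (hψ : ψ.lTensor A (comul t) = 0) : ψ = 0 := by
  -- `κ y = (h ↦ ψ (h y))`
  let κ : A →ₗ[k] Module.Dual k A := (LinearMap.llcomp k A A k ψ) ∘ₗ (LinearMap.mul k A).flip
  have hκ : ∀ y h, κ y h = ψ (h * y) := fun y h => rfl
  have h1 : ∀ h : A, (ψ ∘ₗ LinearMap.mulLeft k h).lTensor A (comul t) = 0 := by
    intro h
    have h2 : ∀ z : A ⊗[k] A, (ψ ∘ₗ LinearMap.mulLeft k h).lTensor A z =
        ψ.lTensor A (((1 : A) ⊗ₜ[k] h) * z) := by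
      intro z; induction z with
      | zero => simp
      | add x y hx hy => simp only [map_add, mul_add, hx, hy]
      | tmul x y => simp
    have h3 : ∀ z : A ⊗[k] A, ψ.lTensor A ((antipode k h ⊗ₜ[k] (1 : A)) * z) =
        (LinearMap.mulLeft k (antipode k h)).rTensor k (ψ.lTensor A z) := by
      intro z; induction z with
      | zero => simp
      | add x y hx hy => simp only [map_add, mul_add, hx, hy]
      | tmul x y => simp
    rw [h2, ← antipode_mul_comul_integral ht, h3, hψ, map_zero]
  have h4 : TensorProduct.comm k _ _ (κ.lTensor A (comul t)) = 0 := by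
    apply dualTensorHom_inj
    ext h
    have h5 : ∀ z : A ⊗[k] A, dualTensorHom k A A (TensorProduct.comm k _ _ (κ.lTensor A z)) h =
        TensorProduct.rid k A ((ψ ∘ₗ LinearMap.mulLeft k h).lTensor A z) := by
      intro z; induction z with
      | zero => simp
      | add x y hx hy => simp only [map_add, LinearMap.add_apply, hx, hy]
      | tmul x y => simp [hκ]
    rw [h5, h1]; simp
  have h6 := congr(galAux ((LinearMap.mul k A).flip ∘ₗ antipode k) $h4)
  rw [map_zero] at h6
  have r := ℛ k t
  have rl := fun i => ℛ k (r.left i)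
  have rr := fun i => ℛ k (r.right i)
  rw [← r.eq] at h6
  simp only [map_sum, LinearMap.lTensor_tmul, TensorProduct.comm_tmul, galAux_tmul _ _ (rl _)] at h6
  have h7 := congr(TensorProduct.comm k _ _ (κ.lTensor A
    ((LinearMap.mul' k A ∘ₗ (antipode k).rTensor A).lTensor A $(sum_tmul_tmul_eq r rl rr))))
  simp only [map_sum, LinearMap.lTensor_tmul, LinearMap.comp_apply, LinearMap.rTensor_tmul,
    LinearMap.mul'_apply, TensorProduct.comm_tmul] at h7
  have h8 : ∀ a b : A, κ b ∘ₗ ((LinearMap.mul k A).flip (antipode k a)) = κ (antipode k a * b) := by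
    intro a b; ext h; simp [hκ, mul_assoc]
  simp only [LinearMap.comp_apply, h8, h7] at h6
  simp only [← TensorProduct.sum_tmul, ← map_sum, sum_antipode_mul_eq_smul] at h6
  simp only [map_smul, TensorProduct.smul_tmul, ← TensorProduct.tmul_sum, sum_smul_counit] at h6
  ext h
  have h9 := congr(dualTensorHom k A A $h6 h)
  simpa [hκ, ht0] using h9

/-- Larson–Sweedler: the antipode of a finite-dimensional Hopf algebra is injective. -/
lemma antipode_injective : Function.Injective (antipode k : A →ₗ[k] A) := by
  obtain ⟨t, ht0, ht⟩ := exists_integral (k := k) (A := A)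
  let J : Module.Dual k A →ₗ[k] A := (TensorProduct.rid k A).toLinearMap ∘ₗ
    ((LinearMap.flip (LinearMap.lTensorHom A)) (comul t))
  let J' : Module.Dual k A →ₗ[k] A := (TensorProduct.lid k A).toLinearMap ∘ₗ
    ((LinearMap.flip (LinearMap.rTensorHom A)) (comul t))
  have hJ : ∀ ψ, J ψ = TensorProduct.rid k A (ψ.lTensor A (comul t)) := fun _ => rfl
  have hJ' : ∀ ψ, J' ψ = TensorProduct.lid k A (ψ.rTensor A (comul t)) := fun _ => rfl
  have hJJ' : ∀ ψ α : Module.Dual k A, ψ (J' α) = α (J ψ) := by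
    intro ψ α
    rw [hJ, hJ']
    induction comul (R := k) t with
    | zero => simp
    | add x y hx hy => simp only [map_add, hx, hy]
    | tmul x y => simp [mul_comm]
  have hJi : Function.Injective J := by
    rw [injective_iff_map_eq_zero]
    intro ψ hψ
    exact integral_nondegenerate ht0 ht (by simpa [hJ] using hψ)
  have hdim : Module.finrank k (Module.Dual k A) = Module.finrank k A := Subspace.dual_finrank_eq
  have hJs : Function.Surjective J :=
    (LinearMap.injective_iff_surjective_of_finrank_eq_finrank hdim).1 hJi
  have hJ'i : Function.Injective J' := by
    rw [injective_iff_map_eq_zero]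
    intro α hα
    ext a
    obtain ⟨ψ, rfl⟩ := hJs a
    rw [← hJJ', hα]; simp
  have hJ's : Function.Surjective J' :=
    (LinearMap.injective_iff_surjective_of_finrank_eq_finrank hdim).1 hJ'i
  obtain ⟨α, hα⟩ := hJ's 1
  rw [injective_iff_map_eq_zero]
  intro h hh
  have h1 := antipode_mul_comul_integral ht h
  rw [hh, TensorProduct.zero_tmul, zero_mul] at h1
  have h2 : ∀ z : A ⊗[k] A, TensorProduct.lid k A (α.rTensor A (((1 : A) ⊗ₜ[k] h) * z)) =
      h * TensorProduct.lid k A (α.rTensor A z) := by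
    intro z; induction z with
    | zero => simp
    | add x y hx hy => simp only [map_add, mul_add, hx, hy]
    | tmul x y => simp
  have h3 := h2 (comul t)
  rw [← h1, ← hJ', hα] at h3
  simpa using h3.symm

variable (k A) in
/-- The antipode of a finite-dimensional Hopf algebra, as a linear automorphism. -/
def antipodeEquiv : A ≃ₗ[k] A :=
  LinearEquiv.ofInjectiveEndo (antipode k) antipode_injective

end Antipode

section DualCop
variable (k : Type u) [Field k] (H : Type v) [Ring H]

/-- The co-opposite dual `H^{* cop}` of a finite-dimensional Hopf algebra `H`: as an algebra it is
the dual space `H^*` with the convolution product, and its comultiplication is opposite to the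
transpose of the multiplication of `H`. -/
def DualCop [Algebra k H] : Type (max u v) := WithConv (H →ₗ[k] k)

namespace DualCop

instance [Bialgebra k H] : Ring (DualCop k H) :=
  inferInstanceAs (Ring (WithConv (H →ₗ[k] k)))

instance [Bialgebra k H] : Algebra k (DualCop k H) :=
  inferInstanceAs (Algebra k (WithConv (H →ₗ[k] k)))

variable {k H}

/-- The identity map from `H^{* cop}` to the dual space of `H`. -/
def toDual [Bialgebra k H] : DualCop k H ≃ₗ[k] Module.Dual k H :=
  (WithConv.linearEquiv k (H →ₗ[k] k) : WithConv (H →ₗ[k] k) ≃ₗ[k] (H →ₗ[k] k))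

variable [Bialgebra k H]

@[ext] lemma ext {φ ψ : DualCop k H} (h : ∀ x, toDual φ x = toDual ψ x) : φ = ψ :=
  toDual.injective (LinearMap.ext h)

lemma toDual_one (x : H) : toDual (1 : DualCop k H) x = counit (R := k) x := rfl

lemma toDual_mul (φ ψ : DualCop k H) {x : H} {ι : Type*} (r : Repr k x ι) :
    toDual (φ * ψ) x = ∑ i ∈ r.index, toDual φ (r.left i) * toDual ψ (r.right i) :=
  r.convMul_apply (C := H) (A := k) _ _

variable [Module.Finite k H]

/-- The identification `H^* ⊗ H^* ≅ (H ⊗ H)^*`. -/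
def pairing : DualCop k H ⊗[k] DualCop k H ≃ₗ[k] Module.Dual k (H ⊗[k] H) :=
  (TensorProduct.congr toDual toDual).trans (TensorProduct.dualDistribEquiv k H H)

@[simp] lemma pairing_tmul (φ ψ : DualCop k H) (x y : H) :
    pairing (φ ⊗ₜ ψ) (x ⊗ₜ[k] y) = toDual φ x * toDual ψ y := by
  simp [pairing]


instance : CoalgebraStruct k (DualCop k H) where
  comul := pairing.symm.toLinearMap ∘ₗ
    (LinearMap.mul' k H ∘ₗ (TensorProduct.comm k H H).toLinearMap).dualMap ∘ₗ toDual.toLinearMap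
  counit := Module.Dual.eval k H 1 ∘ₗ toDual.toLinearMap

lemma pairing_comul (φ : DualCop k H) (x y : H) :
    pairing (comul (R := k) φ) (x ⊗ₜ[k] y) = toDual φ (y * x) := by
  simp [comul]

lemma counit_apply (φ : DualCop k H) : counit (R := k) φ = toDual φ 1 := rfl


/-- The identification `H^* ⊗ H^* ⊗ H^* ≅ (H ⊗ H ⊗ H)^*`. -/
def pairing₃ : DualCop k H ⊗[k] (DualCop k H ⊗[k] DualCop k H) ≃ₗ[k]
    Module.Dual k (H ⊗[k] (H ⊗[k] H)) :=
  (TensorProduct.congr toDual pairing).trans (TensorProduct.dualDistribEquiv k H (H ⊗[k] H))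

lemma pairing₃_tmul (φ : DualCop k H) (w : DualCop k H ⊗[k] DualCop k H) (x : H) (y : H ⊗[k] H) :
    pairing₃ (φ ⊗ₜ w) (x ⊗ₜ[k] y) = toDual φ x * pairing w y := by
  simp [pairing₃]

instance : Coalgebra k (DualCop k H) where
  coassoc := by
    ext φ : 1
    apply pairing₃.injective
    ext x y z
    have h1 : ∀ w : DualCop k H ⊗[k] DualCop k H,
        pairing₃ (TensorProduct.assoc k _ _ _ (comul.rTensor _ w)) (x ⊗ₜ[k] (y ⊗ₜ[k] z)) =
          pairing w ((y * x) ⊗ₜ[k] z) := by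
      intro w
      induction w with
      | zero => simp
      | add a b ha hb => simp only [map_add, LinearMap.add_apply, ha, hb]
      | tmul a b =>
        rw [LinearMap.rTensor_tmul, pairing_tmul, ← pairing_comul]
        induction comul (R := k) a with
        | zero => simp
        | add c d hc hd => simp only [map_add, LinearMap.add_apply, TensorProduct.add_tmul, hc, hd,
            add_mul]
        | tmul c d => simp [pairing₃_tmul, mul_assoc]
    have h2 : ∀ w : DualCop k H ⊗[k] DualCop k H,
        pairing₃ (comul.lTensor _ w) (x ⊗ₜ[k] (y ⊗ₜ[k] z)) = pairing w (x ⊗ₜ[k] (z * y)) := by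
      intro w
      induction w with
      | zero => simp
      | add a b ha hb => simp only [map_add, LinearMap.add_apply, ha, hb]
      | tmul a b => simp [pairing₃_tmul, pairing_comul]
    simp only [TensorProduct.AlgebraTensorModule.curry_apply, LinearMap.restrictScalars_self,
      TensorProduct.curry_apply, LinearMap.comp_apply, LinearEquiv.coe_coe]
    rw [h1, h2, pairing_comul, pairing_comul, mul_assoc]
  rTensor_counit_comp_comul := by
    ext φ : 1
    apply (TensorProduct.lid k _).injective
    ext x
    have h : ∀ w : DualCop k H ⊗[k] DualCop k H,
        toDual (TensorProduct.lid k _ (counit.rTensor _ w)) x = pairing w (1 ⊗ₜ[k] x) := by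
      intro w
      induction w with
      | zero => simp
      | add a b ha hb => simp only [map_add, LinearMap.add_apply, ha, hb]
      | tmul a b => simp [counit_apply]
    simp only [LinearMap.comp_apply, h, pairing_comul]
    simp
  lTensor_counit_comp_comul := by
    ext φ : 1
    apply (TensorProduct.rid k _).injective
    ext x
    have h : ∀ w : DualCop k H ⊗[k] DualCop k H,
        toDual (TensorProduct.rid k _ (counit.lTensor _ w)) x = pairing w (x ⊗ₜ[k] 1) := by
      intro w
      induction w with
      | zero => simp
      | add a b ha hb => simp only [map_add, LinearMap.add_apply, ha, hb]
      | tmul a b => simp [counit_apply, mul_comm]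
    simp only [LinearMap.comp_apply, h, pairing_comul]
    simp

lemma pairing_mul (w z : DualCop k H ⊗[k] DualCop k H) {x y : H} {ι κ : Type*} (r : Repr k x ι)
    (s : Repr k y κ) : pairing (w * z) (x ⊗ₜ[k] y) = ∑ i ∈ r.index, ∑ j ∈ s.index,
      pairing w (r.left i ⊗ₜ[k] s.left j) * pairing z (r.right i ⊗ₜ[k] s.right j) := by
  induction w with
  | zero => simp
  | add a b ha hb => simp only [map_add, LinearMap.add_apply, ha, hb, add_mul, Finset.sum_add_distrib]
  | tmul a b =>
    induction z with
    | zero => simp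
    | add c d ha hb => 
      simp only [map_add, LinearMap.add_apply, ha, hb, mul_add, Finset.sum_add_distrib]
    | tmul c d =>
      simp only [Algebra.TensorProduct.tmul_mul_tmul, pairing_tmul, toDual_mul _ _ r,
        toDual_mul _ _ s, Finset.sum_mul_sum]
      exact Finset.sum_congr rfl fun i _ => Finset.sum_congr rfl fun j _ => by ring

instance : Bialgebra k (DualCop k H) := Bialgebra.mk' k (DualCop k H)
  (by rw [counit_apply, toDual_one, Bialgebra.counit_one])
  (by
    intro φ ψ
    rw [counit_apply, toDual_mul φ ψ (x := 1) (ι := Unit) ⟨{()}, fun _ => 1, fun _ => 1, by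
      simp [Algebra.TensorProduct.one_def]⟩]
    simp [counit_apply])
  (by
    apply pairing.injective
    ext x y
    simp [pairing_comul, Algebra.TensorProduct.one_def, toDual_one, mul_comm])
  (by
    intro φ ψ
    apply pairing.injective
    ext x y
    simp only [TensorProduct.AlgebraTensorModule.curry_apply, LinearMap.restrictScalars_self,
      TensorProduct.curry_apply]
    rw [pairing_comul, pairing_mul _ _ (ℛ k x) (ℛ k y), toDual_mul _ _ (mulRepr (ℛ k y) (ℛ k x))]
    simp only [mulRepr, pairing_comul]
    rw [Finset.sum_product, Finset.sum_comm])

end DualCop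

namespace DualCop
variable {k : Type u} [Field k] {H : Type v} [Ring H] [HopfAlgebra k H] [Module.Finite k H]
open HopfAlgebra

lemma sum_toDual (φ : DualCop k H) {ι : Type*} (s : Finset ι) (c : ι → H) :
    toDual φ (∑ i ∈ s, c i) = ∑ i ∈ s, toDual φ (c i) := map_sum _ _ _

lemma sum_mul_antipodeEquiv_symm {x : H} {ι : Type*} (r : Repr k x ι) :
    ∑ i ∈ r.index, r.right i * (antipodeEquiv k H).symm (r.left i) = counit (R := k) x • 1 := by
  apply (antipodeEquiv k H).injective
  have h : ∀ y, antipodeEquiv k H y = antipode k y := fun y => rfl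
  rw [map_sum, map_smul, h 1, antipode_one, ← sum_mul_antipode_eq_smul r]
  refine Finset.sum_congr rfl fun i _ => ?_
  rw [h, antipode_mul_antidistrib, ← h ((antipodeEquiv k H).symm _), LinearEquiv.apply_symm_apply]

lemma sum_antipodeEquiv_symm_mul {x : H} {ι : Type*} (r : Repr k x ι) :
    ∑ i ∈ r.index, (antipodeEquiv k H).symm (r.right i) * r.left i = counit (R := k) x • 1 := by
  apply (antipodeEquiv k H).injective
  have h : ∀ y, antipodeEquiv k H y = antipode k y := fun y => rfl
  rw [map_sum, map_smul, h 1, antipode_one, ← sum_antipode_mul_eq_smul r]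
  refine Finset.sum_congr rfl fun i _ => ?_
  rw [h, antipode_mul_antidistrib, ← h ((antipodeEquiv k H).symm _), LinearEquiv.apply_symm_apply]

/-- The antipode of `H^{* cop}` is the transpose of the inverse of the antipode of `H`. -/
instance : HopfAlgebra k (DualCop k H) where
  antipode := toDual.symm.toLinearMap ∘ₗ (antipodeEquiv k H).symm.toLinearMap.dualMap ∘ₗ
    toDual.toLinearMap
  mul_antipode_rTensor_comul := by
    ext φ x
    have r := ℛ k x
    have h : ∀ w : DualCop k H ⊗[k] DualCop k H,
        toDual (LinearMap.mul' k _ ((toDual.symm.toLinearMap ∘ₗ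
          (antipodeEquiv k H).symm.toLinearMap.dualMap ∘ₗ toDual.toLinearMap).rTensor _ w)) x =
        ∑ i ∈ r.index, pairing w ((antipodeEquiv k H).symm (r.left i) ⊗ₜ[k] r.right i) := by
      intro w
      induction w with
      | zero => simp
      | add a b ha hb => simp only [map_add, LinearMap.add_apply, ha, hb, Finset.sum_add_distrib]
      | tmul a b => simp [toDual_mul _ _ r]
    simp only [LinearMap.comp_apply, h, pairing_comul]
    rw [← sum_toDual, sum_mul_antipodeEquiv_symm]
    simp [Algebra.algebraMap_eq_smul_one, toDual_one, counit_apply, mul_comm]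
  mul_antipode_lTensor_comul := by
    ext φ x
    have r := ℛ k x
    have h : ∀ w : DualCop k H ⊗[k] DualCop k H,
        toDual (LinearMap.mul' k _ ((toDual.symm.toLinearMap ∘ₗ
          (antipodeEquiv k H).symm.toLinearMap.dualMap ∘ₗ toDual.toLinearMap).lTensor _ w)) x =
        ∑ i ∈ r.index, pairing w (r.left i ⊗ₜ[k] (antipodeEquiv k H).symm (r.right i)) := by
      intro w
      induction w with
      | zero => simp
      | add a b ha hb => simp only [map_add, LinearMap.add_apply, ha, hb, Finset.sum_add_distrib]
      | tmul a b => simp [toDual_mul _ _ r]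
    simp only [LinearMap.comp_apply, h, pairing_comul]
    rw [← sum_toDual, sum_antipodeEquiv_symm_mul]
    simp [Algebra.algebraMap_eq_smul_one, toDual_one, counit_apply, mul_comm]

end DualCop

/-- The transpose `f^{* cop} : H^{* cop} → U^{* cop}`, `φ ↦ φ ∘ f`, of a morphism `f : U → H` of
finite-dimensional Hopf algebras. -/
def dualCopMap {k : Type u} [Field k] {U : Type v} {H : Type w} [Ring U] [Ring H] [HopfAlgebra k U]
    [HopfAlgebra k H] [Module.Finite k U] [Module.Finite k H] (f : U →ₐc[k] H) :
    DualCop k H →ₐc[k] DualCop k U :=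
  BialgHom.ofAlgHom
    (AlgHom.ofLinearMap (DualCop.toDual.symm.toLinearMap ∘ₗ (f : U →ₗ[k] H).dualMap ∘ₗ
        DualCop.toDual.toLinearMap)
      (by ext x; simp [DualCop.toDual_one])
      (by
        intro φ ψ; ext x
        simp [DualCop.toDual_mul _ _ (ℛ k x), DualCop.toDual_mul _ _ ((ℛ k x).induced f)]))
    (by ext φ; simp [DualCop.counit_apply])
    (by
      ext φ
      apply DualCop.pairing.injective
      ext x y
      have h : ∀ w : DualCop k H ⊗[k] DualCop k H,
          DualCop.pairing (TensorProduct.map (DualCop.toDual.symm.toLinearMap ∘ₗ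
            (f : U →ₗ[k] H).dualMap ∘ₗ DualCop.toDual.toLinearMap)
            (DualCop.toDual.symm.toLinearMap ∘ₗ
            (f : U →ₗ[k] H).dualMap ∘ₗ DualCop.toDual.toLinearMap) w) (x ⊗ₜ[k] y) =
          DualCop.pairing w (f x ⊗ₜ[k] f y) := by
        intro w
        induction w with
        | zero => simp
        | add a b ha hb => simp only [map_add, LinearMap.add_apply, ha, hb]
        | tmul a b => simp
      refine (h (comul φ)).trans ?_
      rw [DualCop.pairing_comul]
      exact ((DualCop.pairing_comul _ x y).trans (congrArg (DualCop.toDual φ) (map_mul f y x))).symm)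

lemma dualCopMap_apply {k : Type u} [Field k] {U : Type v} {H : Type w} [Ring U] [Ring H]
    [HopfAlgebra k U] [HopfAlgebra k H] [Module.Finite k U] [Module.Finite k H] (f : U →ₐc[k] H)
    (φ : DualCop k H) (x : U) :
    DualCop.toDual (dualCopMap f φ) x = DualCop.toDual φ (f x) := rfl

end DualCop

section Twist
open WithConv
variable (k : Type u) [Field k] (A : Type v) [Ring A] [Bialgebra k A]

/-- A normalized convolution-invertible 2-cocycle `σ : A ⊗ A → k` on a bialgebra `A`. -/
structure TwoCocycle where
  /-- the cocycle -/
  toFun : A ⊗[k] A →ₗ[k] k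
  /-- its convolution inverse -/
  inv : A ⊗[k] A →ₗ[k] k
  mul_inv : toConv toFun * toConv inv = 1
  inv_mul : toConv inv * toConv toFun = 1
  /-- `σ(x₁, y₁) σ(x₂ y₂, z) = σ(y₁, z₁) σ(x, y₂ z₂)` -/
  cocycle : ∀ x y z : A,
    ∑ i ∈ (ℛ k x).index, ∑ j ∈ (ℛ k y).index, toFun ((ℛ k x).left i ⊗ₜ (ℛ k y).left j) *
      toFun (((ℛ k x).right i * (ℛ k y).right j) ⊗ₜ z) =
    ∑ i ∈ (ℛ k y).index, ∑ j ∈ (ℛ k z).index, toFun ((ℛ k y).left i ⊗ₜ (ℛ k z).left j) *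
      toFun (x ⊗ₜ ((ℛ k y).right i * (ℛ k z).right j))
  one_left : ∀ x : A, toFun (1 ⊗ₜ x) = counit x
  one_right : ∀ x : A, toFun (x ⊗ₜ 1) = counit x

variable {k A}

section conv
variable {C D E : Type*} [AddCommGroup C] [Module k C] [Coalgebra k C]
  [AddCommGroup D] [Module k D] [Coalgebra k D] [AddCommGroup E] [Module k E] [Coalgebra k E]
  {B B' : Type*} [Ring B] [Algebra k B] [Ring B'] [Algebra k B']

variable (B) in
/-- A functional regarded as a map to an algebra. -/
def sc (s : C →ₗ[k] k) : WithConv (C →ₗ[k] B) := toConv (Algebra.linearMap k B ∘ₗ s)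

lemma sc_mul (s s' : C →ₗ[k] k) : sc B s * sc B s' = sc B (toConv s * toConv s').ofConv := by
  apply WithConv.ext
  ext c
  simp [sc, (ℛ k c).convMul_apply]

lemma sc_one : sc B (1 : WithConv (C →ₗ[k] k)).ofConv = 1 := by
  apply WithConv.ext
  ext c
  simp [sc]

lemma comp_sc_mul (T : B →ₗ[k] B') (s : C →ₗ[k] k) (F : WithConv (C →ₗ[k] B)) :
    toConv (T ∘ₗ (sc B s * F).ofConv) = sc B' s * toConv (T ∘ₗ F.ofConv) := by
  apply WithConv.ext
  ext c
  simp [sc, (ℛ k c).convMul_apply, ← Algebra.smul_def]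

lemma comp_mul_sc (T : B →ₗ[k] B') (s : C →ₗ[k] k) (F : WithConv (C →ₗ[k] B)) :
    toConv (T ∘ₗ (F * sc B s).ofConv) = toConv (T ∘ₗ F.ofConv) * sc B' s := by
  apply WithConv.ext
  ext c
  simp [sc, (ℛ k c).convMul_apply, ← Algebra.commutes, ← Algebra.smul_def]

/-- Pull back along a coalgebra morphism. -/
def pull (h : D →ₗc[k] C) (F : WithConv (C →ₗ[k] B)) : WithConv (D →ₗ[k] B) :=
  toConv (F.ofConv ∘ₗ h.toLinearMap)

lemma pull_mul (h : D →ₗc[k] C) (F G : WithConv (C →ₗ[k] B)) :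
    pull h (F * G) = pull h F * pull h G :=
  WithConv.ext (LinearMap.convMul_comp_coalgHom_distrib F G h)

lemma pull_one (h : D →ₗc[k] C) : pull h (1 : WithConv (C →ₗ[k] B)) = 1 := by
  apply WithConv.ext
  ext c
  simp [pull]

lemma pull_sc (h : D →ₗc[k] C) (s : C →ₗ[k] k) : pull h (sc B s) = sc B (s ∘ₗ h.toLinearMap) := rfl

lemma sandwich {R : Type*} [Ring R] {a b x y z : R} (h : b * a = 1) :
    (a * x * b) * (a * y * b) * (a * z * b) = a * x * y * z * b := by
  have h' : ∀ w, b * (a * w) = w := fun w => by rw [← mul_assoc, h, one_mul]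
  simp only [mul_assoc, h']

lemma pull_congr {B : Type*} [Ring B] [Algebra k B] (s s' : C →ₗ[k] k) (M : WithConv (C →ₗ[k] B))
    (G₁ G₂ L R : D →ₗc[k] C) (a a' d d' : D →ₗ[k] k) (hs : toConv s * toConv s' = 1)
    (hs' : toConv s' * toConv s = 1) (ha : toConv a' * toConv a = 1)
    (hd : toConv d * toConv d' = 1) (hd' : toConv d' * toConv d = 1)
    (h₁ : ∀ F : WithConv (C →ₗ[k] B), pull G₁ F = sc B a * pull L F * sc B a')
    (h₂ : ∀ F : WithConv (C →ₗ[k] B), pull G₂ F = sc B d * pull R F * sc B d')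
    (hM : pull L M = pull R M)
    (hc : toConv a * toConv (s ∘ₗ L.toLinearMap) = toConv d * toConv (s ∘ₗ R.toLinearMap)) :
    pull G₁ (sc B s * M * sc B s') = pull G₂ (sc B s * M * sc B s') := by
  have ha := (sc_mul (B := B) a' a).trans (by rw [ha, sc_one])
  have hd := (sc_mul (B := B) d d').trans (by rw [hd, sc_one])
  have hd' := (sc_mul (B := B) d' d).trans (by rw [hd', sc_one])
  have hs := (sc_mul (B := B) s s').trans (by rw [hs, sc_one])
  have hs' := (sc_mul (B := B) s' s).trans (by rw [hs', sc_one])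
  have hL := congr(pull L $hs')
  have hR := congr(pull R $hs)
  rw [pull_mul, pull_one] at hL hR
  have hc : sc B a * pull L (sc B s) = sc B d * pull R (sc B s) := by
    rw [pull_sc, pull_sc, sc_mul, sc_mul, hc]
  have hc' : pull L (sc B s') * sc B a' = pull R (sc B s') * sc B d' := by
    refine left_inv_eq_right_inv (a := sc B a * pull L (sc B s)) ?_ ?_
    · rw [mul_assoc, ← mul_assoc (sc B a'), ha, one_mul, hL]
    · rw [hc, mul_assoc, ← mul_assoc (pull R (sc B s)), hR, one_mul, hd]
  rw [pull_mul, pull_mul, pull_mul, pull_mul, h₁, h₁, h₁, h₂, h₂, h₂, sandwich ha, sandwich hd', hc, hM,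
    mul_assoc, mul_assoc, hc', ← mul_assoc, ← mul_assoc]

end conv

namespace TwoCocycle
variable (c : TwoCocycle k A)

lemma sc_mul_inv {B : Type*} [Ring B] [Algebra k B] : sc B c.toFun * sc B c.inv = 1 := by
  rw [sc_mul, c.mul_inv, sc_one]

lemma sc_inv_mul {B : Type*} [Ring B] [Algebra k B] : sc B c.inv * sc B c.toFun = 1 := by
  rw [sc_mul, c.inv_mul, sc_one]

/-- The twisted product `x ⊗ y ↦ σ(x₁, y₁) x₂ y₂ σ⁻¹(x₃, y₃)`. -/
def twistMul : A ⊗[k] A →ₗ[k] A :=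
  (toConv (Algebra.linearMap k A ∘ₗ c.toFun) * toConv (LinearMap.mul' k A) *
    toConv (Algebra.linearMap k A ∘ₗ c.inv)).ofConv

lemma toConv_twistMul : toConv c.twistMul = sc A c.toFun * toConv (LinearMap.mul' k A) * sc A c.inv :=
  rfl

lemma comp_twistMul {B : Type*} [Ring B] [Algebra k B] (T : A →ₗ[k] B) :
    toConv (T ∘ₗ c.twistMul) = sc B c.toFun * toConv (T ∘ₗ LinearMap.mul' k A) * sc B c.inv := by
  have := comp_mul_sc T c.inv (sc A c.toFun * toConv (LinearMap.mul' k A))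
  rw [comp_sc_mul] at this
  exact this

lemma incl_mul {C : Type*} [AddCommGroup C] [Module k C] [Coalgebra k C] (F G : C →ₗ[k] A) :
    toConv ((Algebra.TensorProduct.includeLeft : A →ₐ[k] A ⊗[k] A).toLinearMap ∘ₗ F) *
      toConv ((Algebra.TensorProduct.includeRight : A →ₐ[k] A ⊗[k] A).toLinearMap ∘ₗ G) =
    toConv (TensorProduct.map F G ∘ₗ comul) := by
  apply WithConv.ext
  ext x
  simp [← (ℛ k x).eq]

/-- The twisted product is a morphism of coalgebras. -/
def twistMulHom : A ⊗[k] A →ₗc[k] A where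
  toLinearMap := c.twistMul
  counit_comp := by
    have h := c.comp_twistMul (counit (R := k) (A := A))
    have h1 : toConv (counit (R := k) (A := A) ∘ₗ LinearMap.mul' k A) =
        (1 : WithConv (A ⊗[k] A →ₗ[k] k)) := by
      apply WithConv.ext
      ext x y
      simp [mul_comm]
    rw [h1, mul_one, sc_mul_inv] at h
    exact congr(($h).ofConv)
  map_comp_comul := by
    apply WithConv.toConv_injective
    rw [← incl_mul, c.comp_twistMul, c.comp_twistMul, c.comp_twistMul]
    have h1 : toConv (comul ∘ₗ LinearMap.mul' k A) =
        toConv (TensorProduct.map (LinearMap.mul' k A) (LinearMap.mul' k A) ∘ₗ comul) := by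
      congr 1
      exact (Bialgebra.mulCoalgHom k A).map_comp_comul.symm
    rw [h1, ← incl_mul]
    have h2 := c.sc_inv_mul (B := A ⊗[k] A)
    simp only [mul_assoc]
    rw [← mul_assoc (sc (A ⊗[k] A) c.inv), h2, one_mul]

variable (k A) in
/-- `(x, y, z) ↦ σ(x, y) ε(z)` -/
def s12 (s : A ⊗[k] A →ₗ[k] k) : (A ⊗[k] A) ⊗[k] A →ₗ[k] k :=
  LinearMap.mul' k k ∘ₗ TensorProduct.map s counit

variable (k A) in
/-- `(x, y, z) ↦ ε(x) σ(y, z)` -/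
def s23 (s : A ⊗[k] A →ₗ[k] k) : A ⊗[k] (A ⊗[k] A) →ₗ[k] k :=
  LinearMap.mul' k k ∘ₗ TensorProduct.map counit s

lemma s12_mul (s s' : A ⊗[k] A →ₗ[k] k) (h : toConv s * toConv s' = 1)
    {B : Type*} [Ring B] [Algebra k B] : sc B (s12 k A s) * sc B (s12 k A s') = 1 := by
  let P : (A ⊗[k] A) ⊗[k] A →ₗc[k] A ⊗[k] A := (Coalgebra.TensorProduct.rid k k _).toCoalgHom.comp
    (Coalgebra.TensorProduct.map (CoalgHom.id k _) (Coalgebra.counitCoalgHom k A))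
  have hP : ∀ s : A ⊗[k] A →ₗ[k] k, sc B (s12 k A s) = pull P (sc B s) := by
    intro s
    apply WithConv.ext
    ext x y z
    simp [sc, s12, pull, P, mul_comm]
  rw [hP, hP, ← pull_mul, sc_mul, h, sc_one, pull_one]

lemma s23_mul (s s' : A ⊗[k] A →ₗ[k] k) (h : toConv s * toConv s' = 1)
    {B : Type*} [Ring B] [Algebra k B] : sc B (s23 k A s) * sc B (s23 k A s') = 1 := by
  let P : A ⊗[k] (A ⊗[k] A) →ₗc[k] A ⊗[k] A := (Coalgebra.TensorProduct.lid k _).toCoalgHom.comp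
    (Coalgebra.TensorProduct.map (Coalgebra.counitCoalgHom k A) (CoalgHom.id k _))
  have hP : ∀ s : A ⊗[k] A →ₗ[k] k, sc B (s23 k A s) = pull P (sc B s) := by
    intro s
    apply WithConv.ext
    ext x y z
    simp [sc, s23, pull, P]
  rw [hP, hP, ← pull_mul, sc_mul, h, sc_one, pull_one]

lemma map_id_left : toConv (TensorProduct.map c.twistMul (LinearMap.id : A →ₗ[k] A)) =
    sc _ (s12 k A c.toFun) * toConv (TensorProduct.map (LinearMap.mul' k A) LinearMap.id) *
      sc _ (s12 k A c.inv) := by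
  have h : ∀ s : A ⊗[k] A →ₗ[k] k, sc (A ⊗[k] A) (s12 k A s) =
      toConv (TensorProduct.map (sc A s).ofConv (1 : WithConv (A →ₗ[k] A)).ofConv) := by
    intro s
    apply WithConv.ext
    ext x y z
    simp [sc, s12, Algebra.algebraMap_eq_smul_one, TensorProduct.smul_tmul', TensorProduct.tmul_smul,
      smul_smul, Algebra.TensorProduct.one_def, mul_comm]
  rw [h, h]
  have h2 := TensorProduct.map_convMul_map (R := k) (f := sc A c.toFun) (g := (1 : WithConv (A →ₗ[k] A)))
    (h := toConv (LinearMap.mul' k A)) (k := toConv (LinearMap.id : A →ₗ[k] A))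
  have h3 := TensorProduct.map_convMul_map (R := k) (f := sc A c.toFun * toConv (LinearMap.mul' k A))
    (g := (1 : WithConv (A →ₗ[k] A)) * toConv (LinearMap.id : A →ₗ[k] A))
    (h := sc A c.inv) (k := (1 : WithConv (A →ₗ[k] A)))
  rw [ofConv_toConv, ofConv_toConv] at h2
  rw [h2, h3, one_mul, mul_one]
  rfl

lemma map_id_right : toConv (TensorProduct.map (LinearMap.id : A →ₗ[k] A) c.twistMul) =
    sc _ (s23 k A c.toFun) * toConv (TensorProduct.map LinearMap.id (LinearMap.mul' k A)) *
      sc _ (s23 k A c.inv) := by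
  have h : ∀ s : A ⊗[k] A →ₗ[k] k, sc (A ⊗[k] A) (s23 k A s) =
      toConv (TensorProduct.map (1 : WithConv (A →ₗ[k] A)).ofConv (sc A s).ofConv) := by
    intro s
    apply WithConv.ext
    ext x y z
    simp [sc, s23, Algebra.algebraMap_eq_smul_one, TensorProduct.smul_tmul', TensorProduct.tmul_smul,
      smul_smul, Algebra.TensorProduct.one_def, mul_comm]
  rw [h, h]
  have h2 := TensorProduct.map_convMul_map (R := k) (f := (1 : WithConv (A →ₗ[k] A))) (g := sc A c.toFun)
    (h := toConv (LinearMap.id : A →ₗ[k] A)) (k := toConv (LinearMap.mul' k A))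
  have h3 := TensorProduct.map_convMul_map (R := k)
    (f := (1 : WithConv (A →ₗ[k] A)) * toConv (LinearMap.id : A →ₗ[k] A))
    (g := sc A c.toFun * toConv (LinearMap.mul' k A))
    (h := (1 : WithConv (A →ₗ[k] A))) (k := sc A c.inv)
  rw [ofConv_toConv, ofConv_toConv] at h2
  rw [h2, h3, one_mul, mul_one]
  rfl

variable (k A) in
/-- Multiplication of the first two of three factors, as a coalgebra morphism. -/
def mulLeftHom : (A ⊗[k] A) ⊗[k] A →ₗc[k] A ⊗[k] A :=
  Coalgebra.TensorProduct.map (Bialgebra.mulCoalgHom k A) (CoalgHom.id k A)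

variable (k A) in
/-- Multiplication of the last two of three factors, as a coalgebra morphism. -/
def mulRightHom : A ⊗[k] (A ⊗[k] A) →ₗc[k] A ⊗[k] A :=
  Coalgebra.TensorProduct.map (CoalgHom.id k A) (Bialgebra.mulCoalgHom k A)

lemma cocycle_conv : toConv (s12 k A c.toFun) * toConv (c.toFun ∘ₗ (mulLeftHom k A).toLinearMap) =
    toConv (s23 k A c.toFun ∘ₗ (Coalgebra.TensorProduct.assoc k k A A A).toLinearMap) *
    toConv (c.toFun ∘ₗ (mulRightHom k A).toLinearMap ∘ₗ
      (Coalgebra.TensorProduct.assoc k k A A A).toLinearMap) := by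
  apply WithConv.ext
  ext x y z
  have h := c.cocycle x y z
  have h1 := (((ℛ k x).tmul (ℛ k y)).tmul (ℛ k z)).convMul_apply
    (toConv (s12 k A c.toFun)) (toConv (c.toFun ∘ₗ (mulLeftHom k A).toLinearMap))
  have h2 := (((ℛ k x).tmul (ℛ k y)).tmul (ℛ k z)).convMul_apply
    (toConv (s23 k A c.toFun ∘ₗ (Coalgebra.TensorProduct.assoc k k A A A).toLinearMap))
    (toConv (c.toFun ∘ₗ (mulRightHom k A).toLinearMap ∘ₗ
      (Coalgebra.TensorProduct.assoc k k A A A).toLinearMap))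
  refine (h1.trans ?_).trans h2.symm
  clear h1 h2
  have ez : ∀ w : A, c.toFun (w ⊗ₜ z) = ∑ i ∈ (ℛ k z).index,
      counit (R := k) ((ℛ k z).left i) * c.toFun (w ⊗ₜ (ℛ k z).right i) := by
    intro w
    conv_lhs => rw [← sum_counit_smul (ℛ k z)]
    simp [TensorProduct.tmul_sum, map_sum]
  have ex : ∀ w : A, c.toFun (x ⊗ₜ w) = ∑ i ∈ (ℛ k x).index,
      counit (R := k) ((ℛ k x).left i) * c.toFun ((ℛ k x).right i ⊗ₜ w) := by
    intro w
    conv_lhs => rw [← sum_counit_smul (ℛ k x)]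
    simp [TensorProduct.sum_tmul, map_sum, ← TensorProduct.smul_tmul']
  simp only [ez, ex, Finset.mul_sum] at h
  refine Eq.trans ?_ (h.trans ?_)
  · simp [Finset.sum_product, s12, mulLeftHom]
    simp only [mul_assoc]
  · simp [Finset.sum_product, s23, mulRightHom]
    symm
    rw [Finset.sum_comm]
    refine Finset.sum_congr rfl fun a _ => ?_
    rw [Finset.sum_comm]
    refine Finset.sum_congr rfl fun b _ => ?_
    refine Finset.sum_congr rfl fun d _ => ?_
    ring

lemma twistMul_assoc (x y z : A) :
    c.twistMul (c.twistMul (x ⊗ₜ y) ⊗ₜ z) = c.twistMul (x ⊗ₜ c.twistMul (y ⊗ₜ z)) := by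
  let as := (Coalgebra.TensorProduct.assoc k k A A A).toCoalgHom
  have d : ∀ s s' : A ⊗[k] A →ₗ[k] k, toConv s * toConv s' = 1 →
      toConv (s23 k A s ∘ₗ as.toLinearMap) * toConv (s23 k A s' ∘ₗ as.toLinearMap) = 1 := by
    intro s s' h
    have h1 := congr(pull as $(s23_mul s s' h (B := k)))
    rwa [pull_mul, pull_one] at h1
  have key := pull_congr c.toFun c.inv (toConv (LinearMap.mul' k A))
    (Coalgebra.TensorProduct.map c.twistMulHom (CoalgHom.id k A))
    ((Coalgebra.TensorProduct.map (CoalgHom.id k A) c.twistMulHom).comp as)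
    (mulLeftHom k A) ((mulRightHom k A).comp as) (s12 k A c.toFun) (s12 k A c.inv)
    (s23 k A c.toFun ∘ₗ as.toLinearMap) (s23 k A c.inv ∘ₗ as.toLinearMap)
    c.mul_inv c.inv_mul (s12_mul c.inv c.toFun c.inv_mul (B := k)) (d _ _ c.mul_inv) (d _ _ c.inv_mul)
    (fun F => by
      refine Eq.trans (b := toConv (F.ofConv ∘ₗ (toConv (TensorProduct.map c.twistMul
        (LinearMap.id : A →ₗ[k] A))).ofConv)) rfl ?_
      rw [map_id_left, comp_mul_sc, comp_sc_mul]
      rfl)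
    (fun F => by
      refine Eq.trans (b := pull as (toConv (F.ofConv ∘ₗ (toConv (TensorProduct.map
        (LinearMap.id : A →ₗ[k] A) c.twistMul)).ofConv))) rfl ?_
      rw [map_id_right, comp_mul_sc, comp_sc_mul, pull_mul, pull_mul]
      rfl)
    (by
      apply WithConv.ext
      ext x y z
      simp [pull, mulLeftHom, mulRightHom, as, mul_assoc])
    c.cocycle_conv
  exact congr(($key).ofConv ((x ⊗ₜ y) ⊗ₜ z))

end TwoCocycle
end Twist

section Twist
open WithConv
variable {k : Type u} [Field k] {A : Type v} [Ring A] [Bialgebra k A]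
namespace TwoCocycle
variable (c : TwoCocycle k A)

variable (k A) in
/-- `x ↦ 1 ⊗ x` -/
def oneTmul : A →ₗc[k] A ⊗[k] A where
  toLinearMap := TensorProduct.mk k A A 1
  counit_comp := by ext x; simp
  map_comp_comul := by
    ext x
    simp only [LinearMap.comp_apply, TensorProduct.mk_apply]
    rw [← (ℛ k x).eq]
    simp [TensorProduct.comul_tmul, ← (ℛ k x).eq, TensorProduct.tmul_sum, Algebra.TensorProduct.one_def]

variable (k A) in
/-- `x ↦ x ⊗ 1` -/
def tmulOne : A →ₗc[k] A ⊗[k] A where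
  toLinearMap := (TensorProduct.mk k A A).flip 1
  counit_comp := by ext x; simp
  map_comp_comul := by
    ext x
    simp only [LinearMap.comp_apply, TensorProduct.mk_apply, LinearMap.flip_apply]
    rw [← (ℛ k x).eq]
    simp [TensorProduct.comul_tmul, ← (ℛ k x).eq, TensorProduct.sum_tmul, Algebra.TensorProduct.one_def]

lemma pull_twistMul (h : A →ₗc[k] A ⊗[k] A) (hc : c.toFun ∘ₗ h.toLinearMap = counit)
    (hm : LinearMap.mul' k A ∘ₗ h.toLinearMap = LinearMap.id) (x : A) : c.twistMul (h x) = x := by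
  have h1 : pull h (sc A c.toFun) = 1 := by
    rw [pull_sc, hc]; rfl
  have h2 : pull h (sc A c.inv) = 1 := by
    have h3 : pull h (sc A c.toFun) * pull h (sc A c.inv) = 1 := by
      rw [← pull_mul, c.sc_mul_inv, pull_one]
    rwa [h1, one_mul] at h3
  have h3 : pull h (toConv c.twistMul) = toConv LinearMap.id := by
    rw [c.toConv_twistMul, pull_mul, pull_mul, h1, h2, one_mul, mul_one, ← hm]
    rfl
  exact congr(($h3).ofConv x)

lemma twistMul_one_tmul (x : A) : c.twistMul (1 ⊗ₜ x) = x :=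
  c.pull_twistMul (oneTmul k A) (by ext x; exact c.one_left x) (by ext x; exact one_mul x) x

lemma twistMul_tmul_one (x : A) : c.twistMul (x ⊗ₜ 1) = x :=
  c.pull_twistMul (tmulOne k A) (by ext x; exact c.one_right x) (by ext x; exact mul_one x) x

end TwoCocycle

/-- The twist `A_σ` of a bialgebra `A` by a 2-cocycle `σ`: it is `A` as a coalgebra, with the
product `x · y = ∑ σ(x₁, y₁) x₂ y₂ σ⁻¹(x₃, y₃)` and the same unit. -/
def CocycleTwist (_c : TwoCocycle k A) : Type v := A

namespace CocycleTwist
variable (c : TwoCocycle k A)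

instance : AddCommGroup (CocycleTwist c) := inferInstanceAs (AddCommGroup A)
instance : Module k (CocycleTwist c) := inferInstanceAs (Module k A)
instance : Coalgebra k (CocycleTwist c) := inferInstanceAs (Coalgebra k A)

/-- The identity map from `A` to its twist. -/
def of : A ≃ₗ[k] CocycleTwist c := LinearEquiv.refl k A

instance : Mul (CocycleTwist c) where
  mul x y := of c (c.twistMul ((of c).symm x ⊗ₜ (of c).symm y))

instance : One (CocycleTwist c) where
  one := of c 1

lemma of_mul (x y : A) : of c x * of c y = of c (c.twistMul (x ⊗ₜ y)) := rfl

lemma of_one : of c 1 = 1 := rfl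

instance : Ring (CocycleTwist c) where
  __ := (inferInstance : AddCommGroup (CocycleTwist c))
  left_distrib x y z := by
    change c.twistMul _ = (c.twistMul _ + c.twistMul _ : A)
    rw [← map_add, ← TensorProduct.tmul_add]
    rfl
  right_distrib x y z := by
    change c.twistMul _ = (c.twistMul _ + c.twistMul _ : A)
    rw [← map_add, ← TensorProduct.add_tmul]
    rfl
  zero_mul x := by
    change c.twistMul ((0 : A) ⊗ₜ _) = (0 : A)
    rw [TensorProduct.zero_tmul, map_zero]
  mul_zero x := by
    change c.twistMul (_ ⊗ₜ (0 : A)) = (0 : A)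
    rw [TensorProduct.tmul_zero, map_zero]
  mul_assoc x y z := c.twistMul_assoc x y z
  one_mul x := c.twistMul_one_tmul x
  mul_one x := c.twistMul_tmul_one x

instance : Algebra k (CocycleTwist c) := Algebra.ofModule
  (fun r x y => by
    change c.twistMul _ = (r • c.twistMul _ : A)
    rw [← map_smul]; rfl)
  (fun r x y => by
    change c.twistMul _ = (r • c.twistMul _ : A)
    rw [← map_smul, ← TensorProduct.tmul_smul]; rfl)

/-- The identity map from `A ⊗ A` to the tensor square of the twist. -/
def ofTensor : A ⊗[k] A →ₗ[k] CocycleTwist c ⊗[k] CocycleTwist c :=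
  TensorProduct.map (of c).toLinearMap (of c).toLinearMap

lemma comul_of (x : A) : comul (R := k) (of c x) = ofTensor c (comul x) :=
  (LinearMap.congr_fun (TensorProduct.map_id (R := k) (M := A) (N := A)) (comul (R := k) x)).symm

lemma counit_of (x : A) : counit (R := k) (of c x) = counit (R := k) x := rfl

lemma ofTensor_mul (w z : A ⊗[k] A) : ofTensor c (TensorProduct.map c.twistMul c.twistMul
    (TensorProduct.AlgebraTensorModule.tensorTensorTensorComm k k k k A A A A (w ⊗ₜ z))) =
    ofTensor c w * ofTensor c z := by
  induction w with
  | zero => simp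
  | add a b ha hb => simp only [TensorProduct.add_tmul, map_add, ha, hb, add_mul]
  | tmul a b =>
    induction z with
    | zero => simp
    | add a b ha hb => simp only [TensorProduct.tmul_add, map_add, ha, hb, mul_add]
    | tmul a' b' => simp [ofTensor, of_mul]

instance : Bialgebra k (CocycleTwist c) := Bialgebra.mk' k (CocycleTwist c)
  (Bialgebra.counit_one (R := k) (A := A))
  (fun {x y} => by
    obtain ⟨a, rfl⟩ := (of c).surjective x
    obtain ⟨b, rfl⟩ := (of c).surjective y
    have h := congr($(c.twistMulHom.counit_comp) (a ⊗ₜ b))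
    rw [of_mul, counit_of, counit_of, counit_of]
    refine h.trans ?_
    simp [mul_comm])
  (by
    rw [← of_one, comul_of, Bialgebra.comul_one]
    rfl)
  (fun {x y} => by
    obtain ⟨a, rfl⟩ := (of c).surjective x
    obtain ⟨b, rfl⟩ := (of c).surjective y
    have h := congr($(c.twistMulHom.map_comp_comul) (a ⊗ₜ b))
    rw [of_mul, comul_of, comul_of, comul_of, ← ofTensor_mul]
    exact congrArg (ofTensor c) h.symm)

end CocycleTwist
end Twist

section Double
open WithConv HopfAlgebra

/-- A skew pairing `λ : U ⊗ H → k` between bialgebras. -/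
structure SkewPairing (k : Type u) [Field k] (U : Type v) (H : Type w) [Ring U] [Bialgebra k U]
    [Ring H] [Bialgebra k H] where
  /-- the bilinear form -/
  toFun : U →ₗ[k] H →ₗ[k] k
  /-- `λ(u, a b) = λ(u₂, a) λ(u₁, b)` -/
  apply_mul : ∀ (u : U) (a b : H), toFun u (a * b) =
    ∑ i ∈ (ℛ k u).index, toFun ((ℛ k u).right i) a * toFun ((ℛ k u).left i) b
  /-- `λ(u v, a) = λ(u, a₁) λ(v, a₂)` -/
  mul_apply : ∀ (u v : U) (a : H), toFun (u * v) a =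
    ∑ i ∈ (ℛ k a).index, toFun u ((ℛ k a).left i) * toFun v ((ℛ k a).right i)
  apply_one : ∀ u : U, toFun u 1 = counit u
  one_apply : ∀ a : H, toFun 1 a = counit a

lemma sum_repr_eq {k : Type u} [Field k] {C : Type v} [AddCommGroup C] [Module k C] [Coalgebra k C]
    {x : C} {ι κ : Type*} (r : Repr k x ι) (s : Repr k x κ) (F G : C →ₗ[k] k) :
    ∑ i ∈ r.index, F (r.left i) * G (r.right i) = ∑ i ∈ s.index, F (s.left i) * G (s.right i) := by
  have h1 := congr(LinearMap.mul' k k (TensorProduct.map F G $(r.eq)))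
  have h2 := congr(LinearMap.mul' k k (TensorProduct.map F G $(s.eq)))
  simp only [map_sum, TensorProduct.map_tmul, LinearMap.mul'_apply] at h1 h2
  rw [h1, h2]

namespace SkewPairing
variable {k : Type u} [Field k] {U : Type v} {H : Type w} [Ring U] [Ring H] [Bialgebra k H]

section Bialg
variable [Bialgebra k U] (l : SkewPairing k U H)

lemma apply_mul_repr {u : U} {ι : Type*} (r : Repr k u ι) (a b : H) :
    l.toFun u (a * b) = ∑ i ∈ r.index, l.toFun (r.right i) a * l.toFun (r.left i) b := by
  have h := sum_repr_eq (ℛ k u) r (l.toFun.flip b) (l.toFun.flip a)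
  simp only [LinearMap.flip_apply] at h
  rw [l.apply_mul]
  simpa only [mul_comm] using h

lemma mul_apply_repr (u v : U) {a : H} {ι : Type*} (r : Repr k a ι) :
    l.toFun (u * v) a = ∑ i ∈ r.index, l.toFun u (r.left i) * l.toFun v (r.right i) := by
  rw [l.mul_apply]
  exact sum_repr_eq (ℛ k a) r (l.toFun u) (l.toFun v)

variable (k U H) in
/-- `ε ⊗ id : U ⊗ H → H` -/
def toRight : U ⊗[k] H →ₐc[k] H :=
  (Bialgebra.TensorProduct.lid k H : k ⊗[k] H →ₐc[k] H).comp
    (Bialgebra.TensorProduct.map (Bialgebra.counitBialgHom k U) (BialgHom.id k H))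

variable (k U H) in
/-- `id ⊗ ε : U ⊗ H → U` -/
def toLeft : U ⊗[k] H →ₐc[k] U :=
  (Bialgebra.TensorProduct.rid k k U : U ⊗[k] k →ₐc[k] U).comp
    (Bialgebra.TensorProduct.map (BialgHom.id k U) (Bialgebra.counitBialgHom k H))

lemma toRight_tmul (u : U) (a : H) : toRight k U H (u ⊗ₜ a) = counit (R := k) u • a := by
  simp [toRight]

lemma toLeft_tmul (u : U) (a : H) : toLeft k U H (u ⊗ₜ a) = counit (R := k) a • u := by
  simp [toLeft]

lemma sum_toLeft_toRight {y : U ⊗[k] H} {ι : Type*} (r : Repr k y ι) :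
    ∑ i ∈ r.index, toLeft k U H (r.left i) ⊗ₜ[k] toRight k U H (r.right i) =
    ∑ i ∈ r.index, toLeft k U H (r.right i) ⊗ₜ[k] toRight k U H (r.left i) := by
  have h : TensorProduct.map (toLeft k U H : U ⊗[k] H →ₗ[k] U) (toRight k U H : U ⊗[k] H →ₗ[k] H) ∘ₗ
      comul = (TensorProduct.comm k H U).toLinearMap ∘ₗ
      TensorProduct.map (toRight k U H : U ⊗[k] H →ₗ[k] H) (toLeft k U H : U ⊗[k] H →ₗ[k] U) ∘ₗ comul := by
    ext v b
    have h1 := ((ℛ k v).tmul (ℛ k b)).eq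
    simp only [TensorProduct.AlgebraTensorModule.curry_apply, LinearMap.restrictScalars_self,
      TensorProduct.curry_apply, LinearMap.comp_apply, ← h1, map_sum]
    simp [toRight_tmul, toLeft_tmul, Finset.sum_product, TensorProduct.smul_tmul', TensorProduct.tmul_smul]
    have e1 : ∑ i ∈ (ℛ k v).index, ∑ j ∈ (ℛ k b).index, ((counit (R := k) ((ℛ k v).right i) •
        counit (R := k) ((ℛ k b).left j) • (ℛ k v).left i) ⊗ₜ[k] (ℛ k b).right j) = v ⊗ₜ[k] b := by
      conv_rhs => rw [← sum_smul_counit (ℛ k v), ← sum_counit_smul (ℛ k b), TensorProduct.sum_tmul]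
      simp only [TensorProduct.tmul_sum, TensorProduct.smul_tmul', TensorProduct.tmul_smul]
      refine Finset.sum_congr rfl fun i _ => Finset.sum_congr rfl fun j _ => ?_
      rw [smul_comm]
    have e2 : ∑ i ∈ (ℛ k v).index, ∑ j ∈ (ℛ k b).index, ((counit (R := k) ((ℛ k b).right j) •
        counit (R := k) ((ℛ k v).left i) • (ℛ k v).right i) ⊗ₜ[k] (ℛ k b).left j) = v ⊗ₜ[k] b := by
      conv_rhs => rw [← sum_counit_smul (ℛ k v), ← sum_smul_counit (ℛ k b), TensorProduct.sum_tmul]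
      simp only [TensorProduct.tmul_sum, TensorProduct.smul_tmul', TensorProduct.tmul_smul]
    rw [e1, e2]
  have h2 := congr($h y)
  simpa [← r.eq] using h2

/-- `(u ⊗ a, v ⊗ b) ↦ ε(u) λ(v, a) ε(b)` -/
def form (B : U →ₗ[k] H →ₗ[k] k) : (U ⊗[k] H) ⊗[k] (U ⊗[k] H) →ₗ[k] k :=
  TensorProduct.lift (B.flip.compl₁₂ (toRight k U H : U ⊗[k] H →ₗ[k] H) (toLeft k U H : U ⊗[k] H →ₗ[k] U))

lemma form_tmul (B : U →ₗ[k] H →ₗ[k] k) (u v : U) (a b : H) :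
    form B ((u ⊗ₜ a) ⊗ₜ (v ⊗ₜ b)) = counit u * B v a * counit b := by
  simp [form, toRight_tmul, toLeft_tmul]
  ring

lemma form_apply (B : U →ₗ[k] H →ₗ[k] k) (x y : U ⊗[k] H) :
    form B (x ⊗ₜ y) = B (toLeft k U H y) (toRight k U H x) := by
  simp [form]

lemma form_mul (B B' : U →ₗ[k] H →ₗ[k] k)
    (h : ∀ v a, ∑ j ∈ (ℛ k v).index, ∑ i ∈ (ℛ k a).index,
      B ((ℛ k v).left j) ((ℛ k a).left i) * B' ((ℛ k v).right j) ((ℛ k a).right i) =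
        counit (R := k) v * counit (R := k) a) :
    toConv (form B) * toConv (form B') = (1 : WithConv ((U ⊗[k] H) ⊗[k] (U ⊗[k] H) →ₗ[k] k)) := by
  let P : (U ⊗[k] H) ⊗[k] (U ⊗[k] H) →ₗc[k] H ⊗[k] U :=
    Coalgebra.TensorProduct.map (toRight k U H : U ⊗[k] H →ₗc[k] H) (toLeft k U H : U ⊗[k] H →ₗc[k] U)
  have e : ∀ B : U →ₗ[k] H →ₗ[k] k, toConv (form B) = pull P (toConv (TensorProduct.lift B.flip)) := by
    intro B
    apply WithConv.ext
    ext u a v b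
    rfl
  have h2 : toConv (TensorProduct.lift B.flip) * toConv (TensorProduct.lift B'.flip) = 1 := by
    apply WithConv.ext
    ext a v
    have h1 := ((ℛ k a).tmul (ℛ k v)).convMul_apply
      (toConv (TensorProduct.lift B.flip)) (toConv (TensorProduct.lift B'.flip))
    refine h1.trans ?_
    simp [Finset.sum_product]
    rw [Finset.sum_comm, h, mul_comm]
  rw [e, e, ← pull_mul, h2, pull_one]

end Bialg

variable [HopfAlgebra k U] (l : SkewPairing k U H)

/-- The 2-cocycle `σ(u ⊗ a, v ⊗ b) = ε(u) λ(v, a) ε(b)` on `U ⊗ H` defined by a skew pairing; its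
convolution inverse is `(u ⊗ a, v ⊗ b) ↦ ε(u) λ(S v, a) ε(b)`. -/
def twoCocycle : TwoCocycle k (U ⊗[k] H) where
  toFun := form l.toFun
  inv := form (l.toFun ∘ₗ antipode k)
  mul_inv := form_mul _ _ fun v a => by
    simp only [LinearMap.comp_apply, ← l.mul_apply]
    rw [← LinearMap.sum_apply, ← map_sum, sum_mul_antipode_eq_smul]
    simp [l.one_apply]
  inv_mul := form_mul _ _ fun v a => by
    simp only [LinearMap.comp_apply, ← l.mul_apply]
    rw [← LinearMap.sum_apply, ← map_sum, sum_antipode_mul_eq_smul]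
    simp [l.one_apply]
  cocycle x y z := by
    simp only [form_apply, map_mul]
    simp only [l.apply_mul_repr ((ℛ k z).induced (toLeft k U H)),
      l.mul_apply_repr _ _ ((ℛ k x).induced (toRight k U H)), Finset.mul_sum]
    have h : ∀ i l', ∑ j ∈ (ℛ k y).index,
        l.toFun (toLeft k U H ((ℛ k y).left j)) (toRight k U H ((ℛ k x).left i)) *
          l.toFun (toLeft k U H ((ℛ k z).left l')) (toRight k U H ((ℛ k y).right j)) =
        ∑ j ∈ (ℛ k y).index,
        l.toFun (toLeft k U H ((ℛ k y).right j)) (toRight k U H ((ℛ k x).left i)) *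
          l.toFun (toLeft k U H ((ℛ k z).left l')) (toRight k U H ((ℛ k y).left j)) := by
      intro i l'
      have h2 := congr(LinearMap.mul' k k (TensorProduct.map
        (l.toFun.flip (toRight k U H ((ℛ k x).left i)))
        (l.toFun (toLeft k U H ((ℛ k z).left l'))) $(sum_toLeft_toRight (ℛ k y))))
      simpa using h2
    simp only [Repr.induced, Function.comp_apply]
    have e : ∀ i l', ∑ j ∈ (ℛ k y).index,
        l.toFun (toLeft k U H ((ℛ k y).left j)) (toRight k U H ((ℛ k x).left i)) *
          (l.toFun (toLeft k U H ((ℛ k z).right l')) (toRight k U H ((ℛ k x).right i)) *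
          l.toFun (toLeft k U H ((ℛ k z).left l')) (toRight k U H ((ℛ k y).right j))) =
        ∑ j ∈ (ℛ k y).index,
        l.toFun (toLeft k U H ((ℛ k z).left l')) (toRight k U H ((ℛ k y).left j)) *
          (l.toFun (toLeft k U H ((ℛ k y).right j)) (toRight k U H ((ℛ k x).left i)) *
          l.toFun (toLeft k U H ((ℛ k z).right l')) (toRight k U H ((ℛ k x).right i))) := by
      intro i l'
      have h3 := congr($(h i l') *
        l.toFun (toLeft k U H ((ℛ k z).right l')) (toRight k U H ((ℛ k x).right i)))
      rw [Finset.sum_mul, Finset.sum_mul] at h3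
      refine Eq.trans (Finset.sum_congr rfl fun j _ => ?_) (h3.trans
        (Finset.sum_congr rfl fun j _ => ?_)) <;> ring
    have e' : ∀ i, _ := fun i => Finset.sum_congr rfl fun l' (_ : l' ∈ (ℛ k z).index) => e i l'
    symm
    rw [Finset.sum_congr rfl fun j _ => Finset.sum_comm, Finset.sum_comm]
    refine Finset.sum_congr rfl fun i _ => ?_
    rw [Finset.sum_comm, ← e' i, Finset.sum_comm]
  one_left x := by
    rw [form_apply, map_one, l.apply_one]
    exact LinearMap.congr_fun (toLeft k U H).toCoalgHom.counit_comp x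
  one_right x := by
    rw [form_apply, map_one, l.one_apply]
    exact LinearMap.congr_fun (toRight k U H).toCoalgHom.counit_comp x

end SkewPairing

/-- The generalized quantum double `D_λ(U, H)` of a skew pairing `λ : U ⊗ H → k`: the twist of the
tensor product bialgebra `U ⊗ H` by the 2-cocycle `σ(u ⊗ a, v ⊗ b) = ε(u) λ(v, a) ε(b)`. Only its
bialgebra structure is recorded, since it determines the antipode. -/
abbrev SkewPairing.Double {k : Type u} [Field k] {U : Type v} {H : Type w} [Ring U] [HopfAlgebra k U]
    [Ring H] [Bialgebra k H] (l : SkewPairing k U H) : Type (max v w) :=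
  CocycleTwist l.twoCocycle

/-- The skew pairing `λ_f(u, a) = f(u)(a)` attached to a morphism of Hopf algebras
`f : U → H^{* cop}`. -/
def skewPairing {k : Type u} [Field k] {U : Type v} {H : Type w} [Ring U] [HopfAlgebra k U]
    [Ring H] [HopfAlgebra k H] [Module.Finite k H] (f : U →ₐc[k] DualCop k H) :
    SkewPairing k U H where
  toFun := DualCop.toDual.toLinearMap ∘ₗ (f : U →ₗ[k] DualCop k H)
  apply_mul u a b := by
    have h := DualCop.pairing_comul (f u) b a
    have h2 := ((ℛ k u).induced f).eq
    rw [← h2] at h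
    simpa [mul_comm] using h.symm
  mul_apply u v a := by
    simp [DualCop.toDual_mul _ _ (ℛ k a)]
  apply_one u := by
    simp only [LinearMap.comp_apply]
    exact LinearMap.congr_fun f.toCoalgHom.counit_comp u
  one_apply a := by
    simp [DualCop.toDual_one]

/-- The generalized quantum double `D_f(U, H)` of a morphism of Hopf algebras `f : U → H^{* cop}`: it is
`D_λ(U, H)` for the skew pairing `λ(u, a) = f(u)(a)`. -/
abbrev GeneralizedDouble {k : Type u} [Field k] {U : Type v} {H : Type w} [Ring U] [HopfAlgebra k U]
    [Ring H] [HopfAlgebra k H] [Module.Finite k H] (f : U →ₐc[k] DualCop k H) : Type (max v w) :=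
  (skewPairing f).Double

end Double

section TensorAct
variable {k : Type u} [Field k] {A : Type v} [Ring A] [Bialgebra k A]
  {V V' W W' X : Type*} [AddCommGroup V] [Module k V] [AddCommGroup V'] [Module k V']
  [AddCommGroup W] [Module k W] [AddCommGroup W'] [Module k W'] [AddCommGroup X] [Module k X]

/-- The action `a (x ⊗ y) = a₁ x ⊗ a₂ y` on a tensor product. -/
def tensorAct (ρ : A →ₐ[k] Module.End k V) (ρ' : A →ₐ[k] Module.End k W) :
    A →ₐ[k] Module.End k (V ⊗[k] W) :=
  ((Module.endTensorEndAlgHom (R := k) (S := k) (A := k) (M := V) (N := W)).comp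
    (Algebra.TensorProduct.map ρ ρ')).comp (Bialgebra.comulAlgHom k A)

variable (k A) in
/-- The trivial action on `k`, through the counit. -/
def unitAct : A →ₐ[k] Module.End k k :=
  (Algebra.lsmul k k k).comp (Bialgebra.counitAlgHom k A)

lemma unitAct_apply (a : A) (x : k) : unitAct k A a x = counit (R := k) a * x := rfl

variable (ρ : A →ₐ[k] Module.End k V) (ρ' : A →ₐ[k] Module.End k W)

lemma tensorAct_tmul {a : A} {ι : Type*} (r : Repr k a ι) (x : V) (y : W) :
    tensorAct ρ ρ' a (x ⊗ₜ[k] y) = ∑ i ∈ r.index, ρ (r.left i) x ⊗ₜ[k] ρ' (r.right i) y := by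
  have h : tensorAct ρ ρ' a = Module.endTensorEndAlgHom (R := k) (S := k) (A := k) (M := V) (N := W)
    (Algebra.TensorProduct.map ρ ρ' (comul a)) := rfl
  rw [h, ← r.eq]
  simp only [map_sum, Algebra.TensorProduct.map_tmul, LinearMap.sum_apply]
  rfl

lemma map_tensorAct {σ : A →ₐ[k] Module.End k V'} {σ' : A →ₐ[k] Module.End k W'}
    {f : V →ₗ[k] V'} {g : W →ₗ[k] W'} (hf : ∀ a, f ∘ₗ ρ a = σ a ∘ₗ f)
    (hg : ∀ a, g ∘ₗ ρ' a = σ' a ∘ₗ g) (a : A) :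
    TensorProduct.map f g ∘ₗ tensorAct ρ ρ' a = tensorAct σ σ' a ∘ₗ TensorProduct.map f g := by
  have hf' := fun b x => LinearMap.congr_fun (hf b) x
  have hg' := fun b x => LinearMap.congr_fun (hg b) x
  simp only [LinearMap.comp_apply] at hf' hg'
  ext x y
  simp [tensorAct_tmul _ _ (ℛ k a), hf', hg']

lemma assoc_tensorAct (ρ'' : A →ₐ[k] Module.End k X) (a : A) :
    (TensorProduct.assoc k V W X).toLinearMap ∘ₗ tensorAct (tensorAct ρ ρ') ρ'' a =
      tensorAct ρ (tensorAct ρ' ρ'') a ∘ₗ (TensorProduct.assoc k V W X).toLinearMap := by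
  have r := ℛ k a
  have rl := fun i => ℛ k (r.left i)
  have rr := fun i => ℛ k (r.right i)
  ext x y z
  have h := congr(TensorProduct.map (ρ.toLinearMap.flip x)
    (TensorProduct.map (ρ'.toLinearMap.flip y) (ρ''.toLinearMap.flip z))
    $(sum_tmul_tmul_eq r rl rr))
  simp only [map_sum, TensorProduct.map_tmul, LinearMap.flip_apply, AlgHom.toLinearMap_apply] at h
  simp [tensorAct_tmul _ _ r, tensorAct_tmul _ _ (rl _), tensorAct_tmul _ _ (rr _),
    TensorProduct.sum_tmul, TensorProduct.tmul_sum, h]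

lemma lid_tensorAct (a : A) :
    (TensorProduct.lid k V).toLinearMap ∘ₗ tensorAct (unitAct k A) ρ a =
      ρ a ∘ₗ (TensorProduct.lid k V).toLinearMap := by
  ext x
  have h := congr(ρ $(sum_counit_smul (ℛ k a)) x)
  simp only [map_sum, map_smul, LinearMap.sum_apply, LinearMap.smul_apply] at h
  simp [tensorAct_tmul _ _ (ℛ k a), unitAct_apply, h]

lemma rid_tensorAct (a : A) :
    (TensorProduct.rid k V).toLinearMap ∘ₗ tensorAct ρ (unitAct k A) a =
      ρ a ∘ₗ (TensorProduct.rid k V).toLinearMap := by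
  ext x
  have h := congr(ρ $(sum_smul_counit (ℛ k a)) x)
  simp only [map_sum, map_smul, LinearMap.sum_apply, LinearMap.smul_apply] at h
  simp [tensorAct_tmul _ _ (ℛ k a), unitAct_apply, h]

end TensorAct

section RepCat
open CategoryTheory MonoidalCategory

/-- A finite-dimensional left module over a `k`-algebra `A`, given as a finite-dimensional vector
space `V` with an algebra morphism `A → End(V)`. -/
structure RepCat (k : Type u) [Field k] (A : Type u) [Ring A] [Algebra k A] where
  /-- the underlying vector space -/
  V : Type u
  [addCommGroup : AddCommGroup V]
  [module : Module k V]
  [finite : Module.Finite k V]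
  /-- the action -/
  ρ : A →ₐ[k] Module.End k V

namespace RepCat
attribute [instance] addCommGroup module finite

variable {k : Type u} [Field k] {A : Type u} [Ring A]

section Algebra
variable [Algebra k A]

/-- The space of `A`-linear maps. -/
def homs (X Y : RepCat k A) : Submodule k (X.V →ₗ[k] Y.V) where
  carrier := {f | ∀ a, f ∘ₗ X.ρ a = Y.ρ a ∘ₗ f}
  add_mem' hf hg a := by rw [LinearMap.add_comp, LinearMap.comp_add, hf a, hg a]
  zero_mem' a := by rw [LinearMap.zero_comp, LinearMap.comp_zero]
  smul_mem' c f hf a := by rw [LinearMap.smul_comp, LinearMap.comp_smul, hf a]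

instance : Category (RepCat k A) where
  Hom X Y := homs X Y
  id X := ⟨LinearMap.id, fun _ => rfl⟩
  comp f g := ⟨g.1 ∘ₗ f.1, fun a => by
    rw [LinearMap.comp_assoc, f.2 a, ← LinearMap.comp_assoc, g.2 a, LinearMap.comp_assoc]⟩

/-- The linear map underlying a morphism of modules. -/
def toLin {X Y : RepCat k A} (f : X ⟶ Y) : X.V →ₗ[k] Y.V := f.1

lemma toLin_injective {X Y : RepCat k A} {f g : X ⟶ Y} (h : toLin f = toLin g) : f = g := Subtype.ext h

lemma toLin_comm {X Y : RepCat k A} (f : X ⟶ Y) (a : A) : toLin f ∘ₗ X.ρ a = Y.ρ a ∘ₗ toLin f := f.2 a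

/-- A linear map commuting with the actions is a morphism. -/
def ofLin {X Y : RepCat k A} (f : X.V →ₗ[k] Y.V) (h : ∀ a, f ∘ₗ X.ρ a = Y.ρ a ∘ₗ f) : X ⟶ Y := ⟨f, h⟩

lemma toLin_id (X : RepCat k A) : toLin (𝟙 X) = LinearMap.id := rfl
lemma toLin_comp {X Y Z : RepCat k A} (f : X ⟶ Y) (g : Y ⟶ Z) :
    toLin (f ≫ g) = toLin g ∘ₗ toLin f := rfl
lemma toLin_ofLin {X Y : RepCat k A} (f : X.V →ₗ[k] Y.V) (h : ∀ a, f ∘ₗ X.ρ a = Y.ρ a ∘ₗ f) :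
    toLin (ofLin f h) = f := rfl

instance : Preadditive (RepCat k A) where
  homGroup X Y := inferInstanceAs (AddCommGroup (homs X Y))
  add_comp _ _ _ f f' g := Subtype.ext (LinearMap.comp_add f.1 f'.1 g.1)
  comp_add _ _ _ f g g' := Subtype.ext (LinearMap.add_comp f.1 g'.1 g.1)

instance : Linear k (RepCat k A) where
  homModule X Y := inferInstanceAs (Module k (homs X Y))
  smul_comp _ _ _ r f g := Subtype.ext (LinearMap.comp_smul g.1 r f.1)
  comp_smul _ _ _ f r g := Subtype.ext (LinearMap.smul_comp r g.1 f.1)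

lemma toLin_add {X Y : RepCat k A} (f g : X ⟶ Y) : toLin (f + g) = toLin f + toLin g := rfl
lemma toLin_zero {X Y : RepCat k A} : toLin (0 : X ⟶ Y) = 0 := rfl
lemma toLin_smul {X Y : RepCat k A} (r : k) (f : X ⟶ Y) : toLin (r • f) = r • toLin f := rfl

/-- An equivariant linear isomorphism is an isomorphism of modules. -/
def isoMk {X Y : RepCat k A} (e : X.V ≃ₗ[k] Y.V)
    (h : ∀ a, e.toLinearMap ∘ₗ X.ρ a = Y.ρ a ∘ₗ e.toLinearMap) : X ≅ Y where
  hom := ofLin e.toLinearMap h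
  inv := ofLin e.symm.toLinearMap (fun a => by
    ext y
    have := congr($(h a) (e.symm y))
    apply e.injective
    simpa using this.symm)
  hom_inv_id := toLin_injective (by ext; simp [toLin_comp, toLin_ofLin, toLin_id])
  inv_hom_id := toLin_injective (by ext; simp [toLin_comp, toLin_ofLin, toLin_id])

end Algebra

section Bialgebra
variable [Bialgebra k A]

instance : MonoidalCategoryStruct (RepCat k A) where
  tensorObj X Y := { V := X.V ⊗[k] Y.V, ρ := tensorAct X.ρ Y.ρ }
  tensorUnit := { V := k, ρ := unitAct k A }
  tensorHom f g := ofLin (TensorProduct.map (toLin f) (toLin g))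
    (map_tensorAct _ _ (toLin_comm f) (toLin_comm g))
  whiskerLeft X _ _ f := ofLin (TensorProduct.map LinearMap.id (toLin f))
    (map_tensorAct _ _ (toLin_comm (𝟙 X)) (toLin_comm f))
  whiskerRight f Y := ofLin (TensorProduct.map (toLin f) LinearMap.id)
    (map_tensorAct _ _ (toLin_comm f) (toLin_comm (𝟙 Y)))
  associator X Y Z := isoMk (TensorProduct.assoc k X.V Y.V Z.V) (assoc_tensorAct X.ρ Y.ρ Z.ρ)
  leftUnitor X := isoMk (TensorProduct.lid k X.V) (lid_tensorAct X.ρ)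
  rightUnitor X := isoMk (TensorProduct.rid k X.V) (rid_tensorAct X.ρ)

instance : MonoidalCategory (RepCat k A) where
  tensorHom_def _ _ := toLin_injective (TensorProduct.ext' fun _ _ => rfl)
  id_tensorHom_id _ _ := toLin_injective (TensorProduct.ext' fun _ _ => rfl)
  tensorHom_comp_tensorHom _ _ _ _ := toLin_injective (TensorProduct.ext' fun _ _ => rfl)
  whiskerLeft_id _ _ := toLin_injective (TensorProduct.ext' fun _ _ => rfl)
  id_whiskerRight _ _ := toLin_injective (TensorProduct.ext' fun _ _ => rfl)
  associator_naturality _ _ _ := toLin_injective (TensorProduct.ext_threefold fun _ _ _ => rfl)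
  leftUnitor_naturality {X _} f := toLin_injective
    (TensorProduct.ext' fun (c : k) (x : X.V) => ((toLin f).map_smul c x).symm)
  rightUnitor_naturality {X _} f := toLin_injective
    (TensorProduct.ext' fun (x : X.V) (c : k) => ((toLin f).map_smul c x).symm)
  pentagon _ _ _ _ := toLin_injective (TensorProduct.ext_fourfold fun _ _ _ _ => rfl)
  triangle _ _ := toLin_injective (TensorProduct.ext_threefold fun x c y =>
    TensorProduct.smul_tmul (R := k) c x y |>.symm)

instance : MonoidalPreadditive (RepCat k A) where
  whiskerLeft_zero := toLin_injective (TensorProduct.map_zero_right _)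
  zero_whiskerRight := toLin_injective (TensorProduct.map_zero_left _)
  whiskerLeft_add f g := toLin_injective (TensorProduct.map_add_right _ (toLin f) (toLin g))
  add_whiskerRight f g := toLin_injective (TensorProduct.map_add_left (toLin f) (toLin g) _)

instance : MonoidalLinear k (RepCat k A) where
  whiskerLeft_smul _ _ _ r f := toLin_injective (TensorProduct.map_smul_right r _ (toLin f))
  smul_whiskerRight r _ _ f _ := toLin_injective (TensorProduct.map_smul_left r (toLin f) _)

end Bialgebra

section Restriction
variable {B : Type u} [Ring B]

/-- The restriction functor `f_* : Rep(B) → Rep(A)` along a morphism of bialgebras `f : A → B`. -/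
def res [Bialgebra k A] [Bialgebra k B] (f : A →ₐc[k] B) : RepCat k B ⥤ RepCat k A where
  obj X := { V := X.V, ρ := X.ρ.comp (f : A →ₐ[k] B) }
  map {X Y} g := ofLin (toLin (X := X) (Y := Y) g) fun a => toLin_comm (X := X) (Y := Y) g (f a)

lemma res_tensorAct [Bialgebra k A] [Bialgebra k B] (f : A →ₐc[k] B) (X Y : RepCat k B) (a : A) :
    tensorAct (X.ρ.comp (f : A →ₐ[k] B)) (Y.ρ.comp (f : A →ₐ[k] B)) a = tensorAct X.ρ Y.ρ (f a) := by
  ext x y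
  simp [tensorAct_tmul _ _ (ℛ k a), tensorAct_tmul _ _ ((ℛ k a).induced f)]

/-- The restriction functor along a morphism of bialgebras is a (strict) tensor functor. -/
instance [Bialgebra k A] [Bialgebra k B] (f : A →ₐc[k] B) : (res (k := k) f).Monoidal :=
  Functor.CoreMonoidal.toMonoidal
    { εIso := isoMk (LinearEquiv.refl k k) (fun a => by
        ext
        exact congrArg (· * (1 : k)) (LinearMap.congr_fun f.toCoalgHom.counit_comp a).symm)
      μIso := fun X Y => isoMk (LinearEquiv.refl k (X.V ⊗[k] Y.V)) (fun a => res_tensorAct f X Y a)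
      μIso_hom_natural_left := fun f Z => toLin_injective (TensorProduct.ext' fun _ _ => rfl)
      μIso_hom_natural_right := fun f Z => toLin_injective (TensorProduct.ext' fun _ _ => rfl)
      associativity := fun X Y Z => toLin_injective (TensorProduct.ext_threefold fun _ _ _ => rfl)
      left_unitality := fun X => toLin_injective (TensorProduct.ext' fun _ _ => rfl)
      right_unitality := fun X => toLin_injective (TensorProduct.ext' fun _ _ => rfl) }

end Restriction
end RepCat
end RepCat

section Center
open CategoryTheory MonoidalCategory Functor.LaxMonoidal
variable {D : Type u₁} [Category.{v₁} D] [MonoidalCategory D]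
  {C : Type u₂} [Category.{v₂} C] [MonoidalCategory C]

/-- An object `(V, γ)` of the relative center `Z_F(C)` of a monoidal functor `F : D → C`: an object
`V` of `C` with a natural transformation `γ_X : V ⊗ F(X) → F(X) ⊗ V`, `X ∈ D`, compatible with the
monoidal structure of `F`, that is, with `F(X ⊗ Y) = F(X) ⊗ F(Y)` and `F(1) = 1`. -/
structure RelativeCenter (F : D ⥤ C) [F.Monoidal] where
  /-- the underlying object -/
  V : C
  /-- the half braiding -/
  γ : ∀ X : D, V ⊗ F.obj X ⟶ F.obj X ⊗ V
  naturality : ∀ {X Y : D} (f : X ⟶ Y), V ◁ F.map f ≫ γ Y = γ X ≫ F.map f ▷ V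
  tensor : ∀ X Y : D, V ◁ μ F X Y ≫ γ (X ⊗ Y) =
    (α_ V (F.obj X) (F.obj Y)).inv ≫ γ X ▷ F.obj Y ≫ (α_ (F.obj X) V (F.obj Y)).hom ≫
      F.obj X ◁ γ Y ≫ (α_ (F.obj X) (F.obj Y) V).inv ≫ μ F X Y ▷ V
  unit : V ◁ ε F ≫ γ (𝟙_ D) = (ρ_ V).hom ≫ (λ_ V).inv ≫ ε F ▷ V

namespace RelativeCenter
variable {F : D ⥤ C} [F.Monoidal]

/-- A morphism of the relative center is a morphism of `C` that is compatible with the half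
braidings. -/
@[ext]
structure Hom (P Q : RelativeCenter F) where
  /-- the underlying morphism -/
  f : P.V ⟶ Q.V
  comm : ∀ X : D, f ▷ F.obj X ≫ Q.γ X = P.γ X ≫ F.obj X ◁ f

instance : Category (RelativeCenter F) where
  Hom := Hom
  id P := ⟨𝟙 P.V, fun X => by simp⟩
  comp f g := ⟨f.f ≫ g.f, fun X => by
    rw [comp_whiskerRight, Category.assoc, g.comm, ← Category.assoc, f.comm, Category.assoc,
      MonoidalCategory.whiskerLeft_comp]⟩

lemma hom_ext {P Q : RelativeCenter F} {f g : P ⟶ Q} (h : f.f = g.f) : f = g :=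
  Hom.ext h

lemma id_f (P : RelativeCenter F) : Hom.f (𝟙 P) = 𝟙 P.V := rfl
lemma comp_f {P Q R : RelativeCenter F} (f : P ⟶ Q) (g : Q ⟶ R) : (f ≫ g).f = f.f ≫ g.f := rfl

lemma hom_comm {P Q : RelativeCenter F} (f : P ⟶ Q) (X : D) :
    f.f ▷ F.obj X ≫ Q.γ X = P.γ X ≫ F.obj X ◁ f.f := f.comm X

/-- An isomorphism compatible with the half braidings is an isomorphism of the relative center. -/
def isoMk {P Q : RelativeCenter F} (e : P.V ≅ Q.V)
    (h : ∀ X : D, e.hom ▷ F.obj X ≫ Q.γ X = P.γ X ≫ F.obj X ◁ e.hom) : P ≅ Q where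
  hom := ⟨e.hom, h⟩
  inv := ⟨e.inv, fun X => by
    rw [← cancel_epi (e.hom ▷ F.obj X), ← comp_whiskerRight_assoc, e.hom_inv_id, ← Category.assoc, h,
      Category.assoc, ← MonoidalCategory.whiskerLeft_comp, e.hom_inv_id]
    simp⟩
  hom_inv_id := hom_ext e.hom_inv_id
  inv_hom_id := hom_ext e.inv_hom_id

/-- The tensor product `(V, γ) ⊗ (W, γ') = (V ⊗ W, (γ ⊗ id_W) (id_V ⊗ γ'))`. -/
def tensorObj (P Q : RelativeCenter F) : RelativeCenter F where
  V := P.V ⊗ Q.V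
  γ X := (α_ P.V Q.V (F.obj X)).hom ≫ P.V ◁ Q.γ X ≫ (α_ P.V (F.obj X) Q.V).inv ≫ P.γ X ▷ Q.V ≫
    (α_ (F.obj X) P.V Q.V).hom
  naturality {X Y} f := by
    calc
      _ = 𝟙 _ ⊗≫ (P.V ◁ (Q.V ◁ F.map f ≫ Q.γ Y)) ⊗≫ P.γ Y ▷ Q.V ⊗≫ 𝟙 _ := by monoidal
      _ = 𝟙 _ ⊗≫ P.V ◁ Q.γ X ⊗≫ (P.V ◁ F.map f ≫ P.γ Y) ▷ Q.V ⊗≫ 𝟙 _ := by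
        rw [Q.naturality]; monoidal
      _ = _ := by rw [P.naturality]; monoidal
  tensor X Y := by
    calc
      _ = 𝟙 _ ⊗≫ P.V ◁ (Q.V ◁ μ F X Y ≫ Q.γ (X ⊗ Y)) ⊗≫ P.γ (X ⊗ Y) ▷ Q.V ⊗≫ 𝟙 _ := by monoidal
      _ = 𝟙 _ ⊗≫ P.V ◁ Q.γ X ▷ F.obj Y ⊗≫ P.V ◁ F.obj X ◁ Q.γ Y ⊗≫
            (P.V ◁ μ F X Y ≫ P.γ (X ⊗ Y)) ▷ Q.V ⊗≫ 𝟙 _ := by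
        rw [Q.tensor]; monoidal
      _ = 𝟙 _ ⊗≫ P.V ◁ Q.γ X ▷ F.obj Y ⊗≫ ((P.V ⊗ F.obj X) ◁ Q.γ Y ≫
            P.γ X ▷ (F.obj Y ⊗ Q.V)) ⊗≫ F.obj X ◁ P.γ Y ▷ Q.V ⊗≫ μ F X Y ▷ P.V ▷ Q.V ⊗≫ 𝟙 _ := by
        rw [P.tensor]; monoidal
      _ = _ := by rw [whisker_exchange]; monoidal
  unit := by
    calc
      _ = 𝟙 _ ⊗≫ P.V ◁ (Q.V ◁ ε F ≫ Q.γ (𝟙_ D)) ⊗≫ P.γ (𝟙_ D) ▷ Q.V ⊗≫ 𝟙 _ := by monoidal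
      _ = 𝟙 _ ⊗≫ (P.V ◁ ε F ≫ P.γ (𝟙_ D)) ▷ Q.V ⊗≫ 𝟙 _ := by rw [Q.unit]; monoidal
      _ = _ := by rw [P.unit]; monoidal

lemma whiskerLeft_comm (P : RelativeCenter F) {Q R : RelativeCenter F} (f : Q ⟶ R) (X : D) :
    (P.V ◁ f.f) ▷ F.obj X ≫ (tensorObj P R).γ X = (tensorObj P Q).γ X ≫ F.obj X ◁ P.V ◁ f.f := by
  dsimp only [tensorObj]
  calc
    _ = 𝟙 _ ⊗≫ P.V ◁ (f.f ▷ F.obj X ≫ R.γ X) ⊗≫ P.γ X ▷ R.V ⊗≫ 𝟙 _ := by monoidal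
    _ = 𝟙 _ ⊗≫ P.V ◁ Q.γ X ⊗≫ ((P.V ⊗ F.obj X) ◁ f.f ≫ P.γ X ▷ R.V) ⊗≫ 𝟙 _ := by
      rw [f.comm]; monoidal
    _ = _ := by rw [whisker_exchange]; monoidal

lemma whiskerRight_comm {Q R : RelativeCenter F} (f : Q ⟶ R) (P : RelativeCenter F) (X : D) :
    (f.f ▷ P.V) ▷ F.obj X ≫ (tensorObj R P).γ X = (tensorObj Q P).γ X ≫ F.obj X ◁ f.f ▷ P.V := by
  dsimp only [tensorObj]
  calc
    _ = 𝟙 _ ⊗≫ (f.f ▷ (P.V ⊗ F.obj X) ≫ R.V ◁ P.γ X) ⊗≫ R.γ X ▷ P.V ⊗≫ 𝟙 _ := by monoidal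
    _ = 𝟙 _ ⊗≫ Q.V ◁ P.γ X ⊗≫ (f.f ▷ F.obj X ≫ R.γ X) ▷ P.V ⊗≫ 𝟙 _ := by
      rw [← whisker_exchange]; monoidal
    _ = _ := by rw [f.comm]; monoidal

instance : MonoidalCategoryStruct (RelativeCenter F) where
  tensorObj := tensorObj
  tensorUnit :=
    { V := 𝟙_ C
      γ := fun X => (λ_ (F.obj X)).hom ≫ (ρ_ (F.obj X)).inv
      naturality := fun f => by simp
      tensor := fun X Y => by monoidal
      unit := by monoidal }
  whiskerLeft P _ _ f := ⟨P.V ◁ f.f, whiskerLeft_comm P f⟩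
  whiskerRight f P := ⟨f.f ▷ P.V, whiskerRight_comm f P⟩
  tensorHom {P₁ Q₁ P₂ Q₂} f g := ⟨f.f ⊗ₘ g.f, fun X => by
    rw [MonoidalCategory.tensorHom_def]
    exact hom_comm ((⟨f.f ▷ P₂.V, whiskerRight_comm f P₂⟩ : tensorObj P₁ P₂ ⟶ tensorObj Q₁ P₂) ≫
      (⟨Q₁.V ◁ g.f, whiskerLeft_comm Q₁ g⟩ : tensorObj Q₁ P₂ ⟶ tensorObj Q₁ Q₂)) X⟩
  associator P Q R := isoMk (α_ P.V Q.V R.V) fun X => by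
    dsimp only [tensorObj]
    monoidal
  leftUnitor P := isoMk (λ_ P.V) fun X => by
    dsimp only [tensorObj]
    monoidal
  rightUnitor P := isoMk (ρ_ P.V) fun X => by
    dsimp only [tensorObj]
    monoidal

variable (F) in
/-- The forgetful functor `Z_F(C) → C`. -/
def forget : RelativeCenter F ⥤ C where
  obj P := P.V
  map f := f.f

instance : (forget F).Faithful where
  map_injective h := hom_ext h

instance : MonoidalCategory (RelativeCenter F) := Monoidal.induced (forget F)
  { μIso := fun P Q => Iso.refl (P.V ⊗ Q.V)
    εIso := Iso.refl (𝟙_ C)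
    whiskerLeft_eq := fun P Q R f => ((Category.id_comp _).trans (Category.comp_id _)).symm
    whiskerRight_eq := fun f P => ((Category.id_comp _).trans (Category.comp_id _)).symm
    tensorHom_eq := fun f g => ((Category.id_comp _).trans (Category.comp_id _)).symm
    associator_eq := fun P Q R => by
      change (α_ P.V Q.V R.V).hom = (𝟙 ((P.V ⊗ Q.V) ⊗ R.V) ≫ (𝟙 (P.V ⊗ Q.V) ⊗ₘ 𝟙 R.V)) ≫
        (α_ P.V Q.V R.V).hom ≫ (𝟙 P.V ⊗ₘ 𝟙 (Q.V ⊗ R.V)) ≫ 𝟙 (P.V ⊗ (Q.V ⊗ R.V))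
      simp
    leftUnitor_eq := fun P => by
      change (λ_ P.V).hom = (𝟙 (𝟙_ C ⊗ P.V) ≫ (𝟙 (𝟙_ C) ⊗ₘ 𝟙 P.V)) ≫ (λ_ P.V).hom
      simp
    rightUnitor_eq := fun P => by
      change (ρ_ P.V).hom = (𝟙 (P.V ⊗ 𝟙_ C) ≫ (𝟙 P.V ⊗ₘ 𝟙 (𝟙_ C))) ≫ (ρ_ P.V).hom
      simp }

section Linear
variable [Preadditive C] [MonoidalPreadditive C]

/-- The additive group of morphisms of `C` that are compatible with the half braidings. -/
def homs (P Q : RelativeCenter F) : AddSubgroup (P.V ⟶ Q.V) where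
  carrier := {f | ∀ X : D, f ▷ F.obj X ≫ Q.γ X = P.γ X ≫ F.obj X ◁ f}
  add_mem' hf hg X := by
    rw [MonoidalPreadditive.add_whiskerRight, MonoidalPreadditive.whiskerLeft_add,
      Preadditive.add_comp, Preadditive.comp_add, hf X, hg X]
  zero_mem' X := by simp
  neg_mem' {f} hf X := by
    have h1 : (-f) ▷ F.obj X = -(f ▷ F.obj X) := (tensorRight (F.obj X)).map_neg
    have h2 : F.obj X ◁ (-f) = -(F.obj X ◁ f) := (tensorLeft (F.obj X)).map_neg
    rw [h1, h2, Preadditive.neg_comp, Preadditive.comp_neg, hf X]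

/-- Morphisms of the relative center as compatible morphisms of `C`. -/
def homEquiv (P Q : RelativeCenter F) : (P ⟶ Q) ≃ homs P Q where
  toFun f := ⟨f.f, f.comm⟩
  invFun f := ⟨f.1, f.2⟩

instance : Preadditive (RelativeCenter F) where
  homGroup P Q := (homEquiv P Q).addCommGroup
  add_comp _ _ _ f f' g := hom_ext (Preadditive.add_comp _ _ _ f.f f'.f g.f)
  comp_add _ _ _ f g g' := hom_ext (Preadditive.comp_add _ _ _ f.f g.f g'.f)

lemma add_f {P Q : RelativeCenter F} (f g : P ⟶ Q) : (f + g).f = f.f + g.f := rfl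
lemma zero_f {P Q : RelativeCenter F} : (0 : P ⟶ Q).f = 0 := rfl

instance : MonoidalPreadditive (RelativeCenter F) where
  whiskerLeft_zero := hom_ext MonoidalPreadditive.whiskerLeft_zero
  zero_whiskerRight := hom_ext MonoidalPreadditive.zero_whiskerRight
  whiskerLeft_add _ _ := hom_ext (MonoidalPreadditive.whiskerLeft_add _ _)
  add_whiskerRight _ _ := hom_ext (MonoidalPreadditive.add_whiskerRight _ _)

variable (k : Type w) [Field k] [Linear k C] [MonoidalLinear k C]

instance (P Q : RelativeCenter F) : SMul k (P ⟶ Q) where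
  smul r f := ⟨r • f.f, fun X => by
    rw [MonoidalLinear.smul_whiskerRight, MonoidalLinear.whiskerLeft_smul, Linear.smul_comp,
      Linear.comp_smul, f.comm]⟩

instance : Linear k (RelativeCenter F) where
  homModule _ _ :=
    { smul := fun r f => r • f
      one_smul := fun f => hom_ext (one_smul k f.f)
      mul_smul := fun r s f => hom_ext (mul_smul r s f.f)
      smul_zero := fun r => hom_ext (smul_zero r)
      smul_add := fun r f g => hom_ext (smul_add r f.f g.f)
      add_smul := fun r s f => hom_ext (add_smul r s f.f)
      zero_smul := fun f => hom_ext (zero_smul k f.f) }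
  smul_comp _ _ _ r f g := hom_ext (Linear.smul_comp _ _ _ r f.f g.f)
  comp_smul _ _ _ f r g := hom_ext (Linear.comp_smul _ _ _ f.f r g.f)

lemma smul_f {P Q : RelativeCenter F} (r : k) (f : P ⟶ Q) : (r • f).f = r • f.f := rfl

instance : MonoidalLinear k (RelativeCenter F) where
  whiskerLeft_smul _ _ _ r f := hom_ext (MonoidalLinear.whiskerLeft_smul _ r f.f)
  smul_whiskerRight r _ _ f _ := hom_ext (MonoidalLinear.smul_whiskerRight r f.f _)

end Linear
end RelativeCenter
end Center

section Fusion
open CategoryTheory MonoidalCategory Limits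

/-- A fusion category over a field `k` (which is meant to be algebraically closed): a `k`-linear
abelian rigid monoidal category with bilinear tensor product and finite-dimensional spaces of
morphisms that is semisimple with finitely many simple objects, and whose unit object is simple. -/
structure IsFusionCategory (k : Type u) [Field k] (C : Type v) [Category.{w} C] [Preadditive C]
    [Linear k C] [MonoidalCategory C] : Prop where
  monoidalPreadditive : MonoidalPreadditive C
  monoidalLinear : MonoidalLinear k C
  hasFiniteProducts : HasFiniteProducts C
  hasKernels : HasKernels C
  hasCokernels : HasCokernels C
  isNormalMonoCategory : IsNormalMonoCategory C
  isNormalEpiCategory : IsNormalEpiCategory C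
  rigid : Nonempty (RigidCategory C)
  finite_hom : ∀ X Y : C, Module.Finite k (X ⟶ Y)
  simple_unit : Simple (𝟙_ C)
  /-- there are finitely many simple objects up to isomorphism -/
  finite_simple : ∃ (n : ℕ) (S : Fin n → C), ∀ X : C, Simple X → ∃ i, Nonempty (X ≅ S i)
  /-- every object is a finite direct sum of simple objects -/
  semisimple : ∀ X : C, ∃ (n : ℕ) (S : Fin n → C) (b : Bicone S),
    (∀ i, Simple (S i)) ∧ Nonempty b.IsBilimit ∧ Nonempty (X ≅ b.pt)

end Fusion

end GenDouble
end

open CategoryTheory GenDouble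

/-!
Write `D` for the generalized double. As a vector space it is `H^* ⊗ U`, and the two factors are
subalgebras, so an algebra morphism from `D` is a pair of algebra morphisms `α` on `H^{* cop}` and
`β` on `U` that satisfy the commutation rule of the double (`SkewPairing.lift`). Put `a = α ∘ S⁻¹`
and let `c = ∑ hᵢ ⊗ a(hⁱ)` for dual bases `hᵢ` of `H` and `hⁱ` of `H^*`. The commutation rule then
reads `c (f(u₂) ⊗ β(u₁)) = (f(u₁) ⊗ β(u₂)) c` (`crossed_iff_canonTensor`), which says precisely that
the maps
`γ_Y : V ⊗ Y → Y ⊗ V`, `v ⊗ y ↦ ∑ hᵢ y ⊗ a(hⁱ) v`, are `U`-linear. The hexagon for `γ` amounts to `a`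
being antimultiplicative and the unit axiom to `a(1) = 1`. This gives a functor from representations
of `D` to the relative center, `RelativeCenter.repFunctor`, which is the identity on the underlying
vector spaces; it is monoidal since `S⁻¹` reverses the comultiplication of `H^{* cop}`. Conversely, by
naturality with respect to the maps `H → Y`, `h ↦ h y`, a half braiding is determined by its
component at the regular representation of `H`, and it has the form above (`RelativeCenter.γLin_eq`).
So the functor is an equivalence.

For the fusion structure it then suffices to treat the representations of `D`
(`IsFusionCategory.of_equivalence`). The representations of a finite-dimensional semisimple Hopf
algebra form a fusion category (`RepCat.isFusionCategory`): the duals come from the antipode and its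
inverse, and every simple object is a summand of the regular representation. It remains to see that
`D` is semisimple. If `ρ` is an integral of `H^*` and `Λ` one of `U`, then `ρ ⊗ Λ` is an integral of
`D` (`mul_integral_eq`), with counit `ρ(1) ε(Λ)`, so by Maschke's theorem one needs `ρ(1) ≠ 0`: this
is the theorem of Larson and Radford that `H` is cosemisimple (`exists_dual_integral`). Here
`ρ(1)` is the trace of `S²`, and `S⁴` is conjugation by a group-like element, so that `S²` is an
algebra automorphism of finite order. On each matrix block of `H` that it preserves it is
conjugation by a matrix `g` which may be normalized to have roots of unity as eigenvalues, with trace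
`tr(g) tr(g⁻¹) = |tr(g)|² ≥ 0`; the block of the trivial representation contributes `1`, so the trace
does not vanish (`trace_ne_zero_of_finite_order`).
-/

noncomputable section
namespace GenDouble
universe v w v₁ v₂ u₁ u₂
open TensorProduct Coalgebra

/-! ### Traces of automorphisms of finite order -/

section TracePositivity
open Module

lemma trace_eq_sum_of_diagonal {k V ι : Type*} [Field k] [AddCommGroup V] [Module k V] [Fintype ι]
    (b : Basis ι k V) (f : V →ₗ[k] V) (c : ι → k) (h : ∀ i, f (b i) = c i • b i) :
    LinearMap.trace k V f = ∑ i, c i := by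
  classical
  rw [LinearMap.trace_eq_matrix_trace k b, Matrix.trace]
  refine Finset.sum_congr rfl fun i _ => ?_
  simp [LinearMap.toMatrix_apply, h]

/-- `x` is an algebraic number whose image under the embedding `σ` has nonnegative real part. -/
def HasNonnegRe {k : Type*} [Field k] [CharZero k] (σ : algebraicClosure ℚ k →+* ℂ) (x : k) : Prop :=
  ∃ y : algebraicClosure ℚ k, (y : k) = x ∧ 0 ≤ (σ y).re

variable {k : Type v₁} [Field k] [CharZero k]

lemma HasNonnegRe.add {σ : algebraicClosure ℚ k →+* ℂ} {x y : k} (hx : HasNonnegRe σ x)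
    (hy : HasNonnegRe σ y) : HasNonnegRe σ (x + y) := by
  obtain ⟨a, rfl, ha⟩ := hx
  obtain ⟨b, rfl, hb⟩ := hy
  exact ⟨a + b, by simp, by rw [map_add, Complex.add_re]; exact add_nonneg ha hb⟩

lemma HasNonnegRe.sum {σ : algebraicClosure ℚ k →+* ℂ} {ι : Type*} (s : Finset ι) {x : ι → k}
    (hx : ∀ i, HasNonnegRe σ (x i)) : HasNonnegRe σ (∑ i ∈ s, x i) := by
  classical
  induction s using Finset.induction_on with
  | empty => exact ⟨0, by simp, by simp⟩
  | insert a s ha ih => rw [Finset.sum_insert ha]; exact (hx a).add ih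

lemma HasNonnegRe.natCast_add_ne_zero {σ : algebraicClosure ℚ k →+* ℂ} {x : k}
    (hx : HasNonnegRe σ x) {n : ℕ} (hn : n ≠ 0) : (n : k) + x ≠ 0 := by
  obtain ⟨y, rfl, hy⟩ := hx
  intro h
  have h1 : (n : algebraicClosure ℚ k) + y = 0 := Subtype.ext (by simpa using h)
  have h2 := congr((σ $h1).re)
  simp only [map_add, map_natCast, Complex.add_re, Complex.natCast_re, map_zero,
    Complex.zero_re] at h2
  have : (0 : ℝ) < n := by positivity
  linarith

/-- For roots of unity `ωᵢ` the number `∑ ωᵢ ωⱼ⁻¹` is the square of the absolute value of `∑ ωᵢ`. -/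
lemma hasNonnegRe_sum_mul_inv (σ : algebraicClosure ℚ k →+* ℂ) {ι : Type*} [Fintype ι] (ω : ι → k)
    {n : ℕ} (hn : n ≠ 0) (hω : ∀ i, ω i ^ n = 1) :
    HasNonnegRe σ (∑ p : ι × ι, ω p.1 * (ω p.2)⁻¹) := by
  have halg : ∀ i, ω i ∈ algebraicClosure ℚ k := by
    intro i
    rw [mem_algebraicClosure_iff]
    exact (IsIntegral.of_pow (Nat.pos_of_ne_zero hn) (by rw [hω i]; exact isIntegral_one)).isAlgebraic
  choose y hy using fun i => (⟨⟨ω i, halg i⟩, rfl⟩ : ∃ y : algebraicClosure ℚ k, (y : k) = ω i)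
  refine ⟨∑ p : ι × ι, y p.1 * (y p.2)⁻¹, by simp [hy], ?_⟩
  have hσ : ∀ i, (σ (y i))⁻¹ = (starRingEnd ℂ) (σ (y i)) := by
    intro i
    have h1 : (σ (y i)) ^ n = 1 := by
      rw [← map_pow, ← map_one σ]
      congr 1
      exact Subtype.ext (by simp [hy, hω])
    exact Complex.inv_eq_conj (Complex.norm_eq_one_of_pow_eq_one h1 hn)
  have h2 : σ (∑ p : ι × ι, y p.1 * (y p.2)⁻¹) = (∑ i, σ (y i)) * (starRingEnd ℂ) (∑ i, σ (y i)) := by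
    rw [map_sum, map_sum, Finset.sum_mul_sum, Fintype.sum_prod_type]
    simp [hσ]
  rw [h2, Complex.mul_conj, Complex.ofReal_re]
  exact Complex.normSq_nonneg _

variable [IsAlgClosed k]

/-- An endomorphism with a nonzero scalar power is diagonalizable. -/
lemma exists_eigenbasis {V : Type*} [AddCommGroup V] [Module k V] [FiniteDimensional k V]
    (g : End k V) {n : ℕ} (hn : n ≠ 0) {c : k} (hc : c ≠ 0) (hg : g ^ n = c • 1) :
    ∃ (ι : Type v₁) (_ : Fintype ι) (b : Basis ι k V) (ζ : ι → k),
      (∀ i, g (b i) = ζ i • b i) ∧ ∀ i, ζ i ^ n = c := by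
  have hs : g.IsSemisimple := by
    refine End.isSemisimple_of_squarefree_aeval_eq_zero (p := Polynomial.X ^ n - Polynomial.C c)
      (Polynomial.separable_X_pow_sub_C c (by exact_mod_cast hn) hc).squarefree ?_
    simp [hg, Algebra.algebraMap_eq_smul_one]
  classical
  let dec := DirectSum.isInternal_submodule_of_iSupIndep_of_iSup_eq_top
    g.eigenspaces_iSupIndep hs.iSup_eigenspace_eq_top
  let b := dec.collectedBasis fun μ => finBasis k (g.eigenspace μ)
  have : Fintype _ := FiniteDimensional.fintypeBasisIndex b
  have hb : ∀ i, g (b i) = i.1 • b i := fun i =>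
    End.mem_eigenspace_iff.mp (dec.collectedBasis_mem _ i)
  refine ⟨_, this, b, Sigma.fst, hb, fun i => ?_⟩
  have h1 : ∀ m : ℕ, (g ^ m) (b i) = i.1 ^ m • b i := by
    intro m
    induction m with
    | zero => simp
    | succ m ih => rw [pow_succ', End.mul_apply, ih, map_smul, hb, smul_smul, pow_succ]
  have h2 := h1 n
  rw [hg, LinearMap.smul_apply, End.one_apply] at h2
  have h3 : (i.1 ^ n - c) • b i = 0 := by rw [sub_smul, h2, sub_self]
  exact sub_eq_zero.1 ((smul_eq_zero.1 h3).resolve_right (b.ne_zero i))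

/-- An automorphism of finite order of `End(V)` is conjugation by a diagonalizable `g` whose
eigenvalues are roots of unity, and its trace is `tr(g) tr(g⁻¹)`. -/
lemma hasNonnegRe_trace_algEquiv (σ : algebraicClosure ℚ k →+* ℂ) {V : Type*} [AddCommGroup V]
    [Module k V] [FiniteDimensional k V] (F : End k V ≃ₐ[k] End k V) {n : ℕ} (hn : n ≠ 0)
    (hF : F ^ n = 1) : HasNonnegRe σ (LinearMap.trace k (End k V) F.toLinearMap) := by
  rcases subsingleton_or_nontrivial V with hV | hV
  · refine ⟨0, ?_, by simp⟩
    rw [show F.toLinearMap = 0 from Subsingleton.elim _ _]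
    simp
  obtain ⟨T, rfl⟩ := F.eq_linearEquivConjAlgEquiv
  set g : End k V := T.toLinearMap with hgdef
  have hgi : ∀ x, g x = T x := fun x => rfl
  -- since `F ^ n = 1`, the power `g ^ n` is central, hence a scalar `c`; dividing `g` by an `n`-th
  -- root `a` of `c` does not change the conjugation and makes the eigenvalues roots of unity
  have h1 : ∀ (m : ℕ) (x : End k V), ((T.conjAlgEquiv k) ^ m) x * g ^ m = g ^ m * x := by
    intro m
    induction m with
    | zero => intro x; simp
    | succ m ih =>
      intro x
      have h2 : ∀ y : End k V, T.conjAlgEquiv k y * g = g * y := by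
        intro y; ext v; simp [g]
      rw [pow_succ', pow_succ', AlgEquiv.mul_apply, ← mul_assoc, h2, mul_assoc, ih, mul_assoc]
  have hcomm : ∀ x : End k V, x * g ^ n = g ^ n * x := by
    intro x; simpa [hF] using h1 n x
  obtain ⟨c, hc⟩ : ∃ c : k, g ^ n = c • 1 := by
    have : g ^ n ∈ Subalgebra.center k (End k V) :=
      Subalgebra.mem_center_iff.2 fun x => hcomm x
    rw [Algebra.IsCentral.center_eq_bot] at this
    obtain ⟨c, hc⟩ := Algebra.mem_bot.1 this
    exact ⟨c, by rw [← hc, Algebra.algebraMap_eq_smul_one]⟩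
  have hc0 : c ≠ 0 := by
    rintro rfl
    have hu : IsUnit (g ^ n) := ((Module.End.isUnit_iff g).2 T.bijective).pow n
    rw [hc, zero_smul] at hu
    exact not_isUnit_zero hu
  obtain ⟨ι, _, b, ζ, hb, hζ⟩ := exists_eigenbasis g hn hc0 hc
  obtain ⟨a, ha⟩ := IsAlgClosed.exists_pow_nat_eq c (Nat.pos_of_ne_zero hn)
  have ha0 : a ≠ 0 := by
    rintro rfl
    rw [zero_pow hn] at ha
    exact hc0 ha.symm
  classical
  have hζ0 : ∀ i, ζ i ≠ 0 := by
    intro i h0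
    have := hζ i
    rw [h0, zero_pow hn] at this
    exact hc0 this.symm
  have htr := trace_eq_sum_of_diagonal (b.linearMap b) (T.conjAlgEquiv k).toLinearMap
    (fun p => (ζ p.1 / a) * (ζ p.2 / a)⁻¹) (by
      rintro ⟨i, j⟩
      apply b.ext
      intro l
      have hsymm : T.symm (b l) = (ζ l)⁻¹ • b l := by
        rw [LinearEquiv.symm_apply_eq, map_smul, ← hgi, hb, smul_smul, inv_mul_cancel₀ (hζ0 l),
          one_smul]
      simp only [AlgEquiv.toLinearMap_apply, LinearEquiv.conjAlgEquiv_apply, LinearMap.comp_apply,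
        LinearEquiv.coe_coe, hsymm, map_smul, LinearMap.smul_apply, 
        Basis.linearMap_apply_apply (b₁ := b) (b₂ := b) (i, j)]
      split_ifs with h
      · subst h
        rw [← hgi, hb, smul_smul]
        congr 1
        field_simp
      · simp)
  rw [htr]
  exact hasNonnegRe_sum_mul_inv σ (fun i => ζ i / a) hn fun i => by
    rw [div_pow, hζ, ha, div_self hc0]

/-- The compression of an automorphism `T` of finite order to a matrix block is zero if `T` moves the
block, and is an automorphism of finite order of the block otherwise. -/
lemma hasNonnegRe_trace_block (σ : algebraicClosure ℚ k →+* ℂ) {I : Type*} [DecidableEq I]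
    {V : I → Type*} [∀ i, AddCommGroup (V i)] [∀ i, Module k (V i)] [∀ i, FiniteDimensional k (V i)]
    (T : (Π i, End k (V i)) →ₐ[k] Π i, End k (V i)) {n : ℕ} (hn : n ≠ 0) (hT : T ^ n = 1) (i : I) :
    HasNonnegRe σ (LinearMap.trace k (End k (V i))
      (LinearMap.proj i ∘ₗ T.toLinearMap ∘ₗ LinearMap.single k (fun i => End k (V i)) i)) := by
  set e : Π i, End k (V i) := Pi.single i 1 with he
  have hee : e * e = e := by rw [he, ← Pi.single_mul, one_mul]
  have hinj : Function.Injective T := by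
    intro x y hxy
    have h1 : ∀ x, (T ^ n) x = x := fun x => by rw [hT]; rfl
    obtain ⟨m, rfl⟩ := Nat.exists_eq_succ_of_ne_zero hn
    rw [← h1 x, ← h1 y, pow_succ, AlgHom.mul_apply, AlgHom.mul_apply, hxy]
  have hsurj : Function.Surjective T := by
    intro x
    obtain ⟨m, rfl⟩ := Nat.exists_eq_succ_of_ne_zero hn
    refine ⟨(T ^ m) x, ?_⟩
    rw [← AlgHom.mul_apply, ← pow_succ', hT]
    rfl
  have hcent : ∀ x, x * e = e * x := by
    intro x
    ext1 j
    by_cases h : j = i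
    · subst h; simp [he]
    · simp [he, h]
  have hTcent : ∀ x, x * T e = T e * x := by
    intro x
    obtain ⟨y, rfl⟩ := hsurj x
    rw [← map_mul, ← map_mul, hcent]
  set φ : End k (V i) →ₗ[k] End k (V i) :=
    LinearMap.proj i ∘ₗ T.toLinearMap ∘ₗ LinearMap.single k (fun i => End k (V i)) i with hφ
  have hφa : ∀ x, φ x = T (Pi.single i x) i := fun x => rfl
  have hφmul : ∀ x y, φ (x * y) = φ x * φ y := by
    intro x y
    rw [hφa, hφa, hφa, Pi.single_mul, map_mul, Pi.mul_apply]
  obtain ⟨c, hc⟩ : ∃ c : k, φ 1 = c • 1 := by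
    have : φ 1 ∈ Subalgebra.center k (End k (V i)) := by
      refine Subalgebra.mem_center_iff.2 fun x => ?_
      have h := congrFun (hTcent (Pi.single i x)) i
      change x * T e i = T e i * x
      simpa using h
    rw [Algebra.IsCentral.center_eq_bot] at this
    obtain ⟨c, hc⟩ := Algebra.mem_bot.1 this
    exact ⟨c, by rw [← hc, Algebra.algebraMap_eq_smul_one]⟩
  have hzero : φ 1 = 0 → φ = 0 := by
    intro h0
    ext1 x
    rw [← mul_one x, hφmul, h0, mul_zero]
    rfl
  have htriv : φ = 0 → HasNonnegRe σ (LinearMap.trace k _ φ) := fun h =>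
    ⟨0, by rw [h]; simp, by simp⟩
  have hone : φ 1 = 0 ∨ φ 1 = 1 := by
    have h1 : φ 1 * φ 1 = φ 1 := by rw [← hφmul, one_mul]
    by_cases hc0 : c = 0
    · left; rw [hc, hc0, zero_smul]
    · right
      rw [hc, smul_mul_smul_comm, one_mul, mul_smul] at h1
      rw [hc]
      exact smul_right_injective _ hc0 h1
  rcases hone with h0 | h1
  · exact htriv (hzero h0)
  -- the central idempotent `e` is below `T e`, and then equal to it since `T` has finite order
  have heT : e * T e = e := by
    ext1 j
    by_cases h : j = i
    · subst h; rw [Pi.mul_apply, show T e j = 1 from h1, mul_one]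
    · simp [he, h]
  have hchain : ∀ m, T e * (T ^ (m + 1)) e = T e := by
    intro m
    induction m with
    | zero => rw [zero_add, pow_one, ← map_mul, hee]
    | succ m ih =>
      have h2 := congr((T ^ (m + 1)) $heT)
      rw [map_mul, ← AlgHom.mul_apply, ← pow_succ] at h2
      conv_lhs => rw [← ih]
      rw [mul_assoc, h2, ih]
  have hTe : T e = e := by
    obtain ⟨m, rfl⟩ := Nat.exists_eq_succ_of_ne_zero hn
    have h2 := hchain m
    rw [hT, AlgHom.one_apply, hTcent e |>.symm, heT] at h2
    exact h2.symm
  have hTs : ∀ x, T (Pi.single i x) = Pi.single i (φ x) := by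
    intro x
    have h2 : Pi.single i x = e * Pi.single i x := by rw [he, ← Pi.single_mul, one_mul]
    rw [h2, map_mul, hTe]
    ext1 j
    by_cases h : j = i
    · subst h; simp [he, hφa]
    · simp [he, h]
  have hpow : ∀ m x, (T ^ m) (Pi.single i x) = Pi.single i ((φ ^ m) x) := by
    intro m
    induction m with
    | zero => intro x; rfl
    | succ m ih => intro x; rw [pow_succ, AlgHom.mul_apply, hTs, ih, pow_succ, End.mul_apply]
  have hφn : φ ^ n = 1 := by
    ext1 x
    have h2 := congrFun (hpow n x) i
    rw [hT] at h2
    simpa using h2.symm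
  let Φ : End k (V i) →ₐ[k] End k (V i) := AlgHom.ofLinearMap φ h1 hφmul
  have hΦn : ∀ m x, (Φ ^ m) x = (φ ^ m) x := by
    intro m
    induction m with
    | zero => intro x; rfl
    | succ m ih => intro x; rw [pow_succ, AlgHom.mul_apply, ih, pow_succ, End.mul_apply]; rfl
  have hΦb : Function.Bijective Φ := by
    obtain ⟨m, rfl⟩ := Nat.exists_eq_succ_of_ne_zero hn
    refine Function.bijective_iff_has_inverse.2 ⟨⇑(φ ^ m), fun x => ?_, fun x => ?_⟩
    · change (φ ^ m) (φ x) = x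
      rw [← End.mul_apply, ← pow_succ, hφn]; rfl
    · change φ ((φ ^ m) x) = x
      rw [← End.mul_apply, ← pow_succ', hφn]; rfl
  let F := AlgEquiv.ofBijective Φ hΦb
  have hFn : ∀ m x, (F ^ m) x = (φ ^ m) x := by
    intro m
    induction m with
    | zero => intro x; rfl
    | succ m ih => intro x; rw [pow_succ, AlgEquiv.mul_apply, ih, pow_succ, End.mul_apply]; rfl
  exact hasNonnegRe_trace_algEquiv σ F hn (by ext1 x; rw [hFn, hφn]; rfl)

omit [CharZero k] [IsAlgClosed k] in
lemma trace_pi_eq_sum {I : Type*} [Fintype I] [DecidableEq I] {M : I → Type*}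
    [∀ i, AddCommGroup (M i)] [∀ i, Module k (M i)] [∀ i, FiniteDimensional k (M i)]
    (T : (Π i, M i) →ₗ[k] Π i, M i) : LinearMap.trace k (Π i, M i) T =
      ∑ i, LinearMap.trace k (M i) (LinearMap.proj i ∘ₗ T ∘ₗ LinearMap.single k M i) := by
  have h1 : T = ∑ i, (T ∘ₗ LinearMap.single k M i) ∘ₗ LinearMap.proj i := by
    refine LinearMap.ext fun x => ?_
    simp only [LinearMap.sum_apply, LinearMap.comp_apply, LinearMap.proj_apply, ← map_sum]
    congr 1
    exact (Finset.univ_sum_single x).symm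
  conv_lhs => rw [h1]
  rw [map_sum]
  exact Finset.sum_congr rfl fun i _ => LinearMap.trace_comp_comm' _ _

/-- An automorphism of finite order of a semisimple algebra that fixes a central idempotent `e`
spanning a one-dimensional ideal has nonzero trace: the trace is the sum of the traces of the
compressions to the matrix blocks, all of them have nonnegative real part, and the block spanned by
`e` contributes `1`. -/
theorem trace_ne_zero_of_finite_order {A : Type*} [Ring A] [Algebra k A] [FiniteDimensional k A]
    [IsSemisimpleRing A] (T : A →ₐ[k] A) {n : ℕ} (hn : n ≠ 0) (hT : T ^ n = 1) (ε : A →ₐ[k] k)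
    (e : A) (hε : ε e = 1) (hTe : T e = e) (hl : ∀ x, x * e = ε x • e) (hr : ∀ x, e * x = ε x • e) :
    LinearMap.trace k A T.toLinearMap ≠ 0 := by
  classical
  -- the two `ℚ`-algebra structures on the field of algebraic numbers agree, but not by definition
  have : Algebra.IsAlgebraic ℚ (algebraicClosure ℚ k) := by
    rw [Subsingleton.elim (DivisionRing.toRatAlgebra (R := algebraicClosure ℚ k))
      (algebraicClosure ℚ k).algebra']
    exact algebraicClosure.isAlgebraic ℚ k
  let σ : algebraicClosure ℚ k →+* ℂ :=
    (IsAlgClosed.lift (R := ℚ) (S := algebraicClosure ℚ k) (M := ℂ)).toRingHom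
  obtain ⟨m, d, hd, ⟨Ψ₀⟩⟩ := IsSemisimpleRing.exists_algEquiv_pi_matrix_of_isAlgClosed k A
  let V : Fin m → Type v₁ := fun i => Fin (d i) → k
  let Ψ : A ≃ₐ[k] Π i, End k (V i) :=
    Ψ₀.trans (AlgEquiv.piCongrRight fun i => Matrix.toLinAlgEquiv')
  let T' : (Π i, End k (V i)) →ₐ[k] Π i, End k (V i) :=
    (Ψ.toAlgHom.comp T).comp Ψ.symm.toAlgHom
  have hT'a : ∀ x, T' (Ψ x) = Ψ (T x) := fun x => by simp [T']
  have hT'n : T' ^ n = 1 := by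
    have h1 : ∀ j x, (T' ^ j) (Ψ x) = Ψ ((T ^ j) x) := by
      intro j
      induction j with
      | zero => intro x; rfl
      | succ j ih => intro x; rw [pow_succ, AlgHom.mul_apply, hT'a, ih, pow_succ, AlgHom.mul_apply]
    ext1 x
    obtain ⟨y, rfl⟩ := Ψ.surjective x
    rw [h1, hT]; rfl
  have htr : LinearMap.trace k A T.toLinearMap = LinearMap.trace k _ T'.toLinearMap :=
    (LinearMap.trace_conj' T.toLinearMap Ψ.toLinearEquiv).symm
  rw [htr, trace_pi_eq_sum]
  -- the block spanned by `e`
  have hΨe : Ψ e ≠ 0 := by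
    intro h
    have : e = 0 := Ψ.injective (by rw [h, map_zero])
    rw [this, map_zero] at hε
    exact zero_ne_one hε
  obtain ⟨i, hi⟩ : ∃ i, Ψ e i ≠ 0 := by
    by_contra! h
    exact hΨe (funext h)
  have hl' : ∀ x, x * Ψ e = ε (Ψ.symm x) • Ψ e := by
    intro x
    have := congr(Ψ $(hl (Ψ.symm x)))
    simpa using this
  have hr' : ∀ x, Ψ e * x = ε (Ψ.symm x) • Ψ e := by
    intro x
    have := congr(Ψ $(hr (Ψ.symm x)))
    simpa using this
  have hee : Ψ e * Ψ e = Ψ e := by rw [hl']; simp [hε]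
  obtain ⟨c, hc⟩ : ∃ c : k, Ψ e i = c • 1 := by
    have : Ψ e i ∈ Subalgebra.center k (End k (V i)) := by
      refine Subalgebra.mem_center_iff.2 fun x => ?_
      have h1 := congrFun (hl' (Pi.single i x)) i
      rw [← hr'] at h1
      simpa using h1
    rw [Algebra.IsCentral.center_eq_bot] at this
    obtain ⟨c, hc⟩ := Algebra.mem_bot.1 this
    exact ⟨c, by rw [← hc, Algebra.algebraMap_eq_smul_one]⟩
  have hc0 : c ≠ 0 := by
    rintro rfl
    exact hi (by rw [hc, zero_smul])
  have hei : Ψ e i = 1 := by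
    have h1 := congrFun hee i
    rw [Pi.mul_apply, hc, smul_mul_smul_comm, one_mul, mul_smul] at h1
    rw [hc]
    exact smul_right_injective _ hc0 h1
  have hscal : ∀ x : End k (V i), x = ε (Ψ.symm (Pi.single i x)) • 1 := by
    intro x
    have h1 := congrFun (hl' (Pi.single i x)) i
    simpa [hei] using h1
  have hsingle : Ψ e = Pi.single i 1 := by
    have h1 := hl' (Pi.single i 1)
    have h2 : ε (Ψ.symm (Pi.single i (1 : End k (V i)))) = 1 := by
      have h3 := congrFun h1 i
      simp only [Pi.mul_apply, Pi.single_eq_same, one_mul, hei, Pi.smul_apply] at h3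
      have : Nontrivial (End k (V i)) := ⟨⟨_, _, hi⟩⟩
      exact smul_left_injective k (one_ne_zero (α := End k (V i)))
        (h3.symm.trans (one_smul k (1 : End k (V i))).symm)
    rw [h2, one_smul] at h1
    rw [← h1]
    ext1 j
    by_cases h : j = i
    · subst h; simp [hei]
    · simp [h]
  have hid : LinearMap.proj i ∘ₗ T'.toLinearMap ∘ₗ LinearMap.single k (fun i => End k (V i)) i =
      LinearMap.id := by
    ext1 x
    have h1 : ∀ x : End k (V i), Pi.single i x = ε (Ψ.symm (Pi.single i x)) • Ψ e := by
      intro x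
      rw [hsingle, ← Pi.single_smul, ← hscal x]
    change T' (Pi.single i x) i = x
    rw [h1 x, map_smul, hT'a, hTe, Pi.smul_apply, hei, ← hscal x]
  rw [← Finset.add_sum_erase _ _ (Finset.mem_univ i)]
  erw [hid]
  rw [LinearMap.trace_id]
  refine HasNonnegRe.natCast_add_ne_zero (σ := σ) (HasNonnegRe.sum _ fun j =>
    hasNonnegRe_trace_block σ T' hn hT'n j) ?_
  have : Nontrivial (End k (V i)) := ⟨⟨_, _, hi⟩⟩
  exact (finrank_pos (R := k) (M := End k (V i))).ne'

end TracePositivity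

/-! ### Integrals, and the theorem of Larson and Radford -/

section Integrals
open HopfAlgebra
variable {k : Type u} [Field k] {A : Type v} [Ring A]

lemma sum_repr_bilin {M C : Type*} [AddCommGroup C] [Module k C] [Coalgebra k C] [AddCommGroup M]
    [Module k M] (F : C →ₗ[k] C →ₗ[k] M) {ι : Type*} {h : C} (r : Repr k h ι) :
    ∑ i ∈ r.index, F (r.left i) (r.right i) = TensorProduct.lift F (comul h) := by
  simp [← r.eq, map_sum]

lemma eq_of_forall_dual_apply_eq {M : Type*} [AddCommGroup M] [Module k M] {x y : M}
    (h : ∀ φ : Module.Dual k M, φ x = φ y) : x = y :=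
  sub_eq_zero.1 ((Module.forall_dual_apply_eq_zero_iff k _).1 fun φ => by rw [map_sub, h, sub_self])

/-- `(a, b) ↦ φ(b) a` -/
def rightContraction {M : Type*} [AddCommGroup M] [Module k M] (φ : Module.Dual k M) :
    M →ₗ[k] M →ₗ[k] M :=
  (LinearMap.lsmul k M).flip.compl₂ φ

/-- `(a, b) ↦ φ(a) b` -/
def leftContraction {M : Type*} [AddCommGroup M] [Module k M] (φ : Module.Dual k M) :
    M →ₗ[k] M →ₗ[k] M :=
  (LinearMap.lsmul k M) ∘ₗ φ

lemma rightContraction_apply {M : Type*} [AddCommGroup M] [Module k M] (φ : Module.Dual k M) (a b : M) :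
    rightContraction φ a b = φ b • a := rfl

lemma leftContraction_apply {M : Type*} [AddCommGroup M] [Module k M] (φ : Module.Dual k M) (a b : M) :
    leftContraction φ a b = φ a • b := rfl

/-- A complement of the augmentation ideal of a semisimple bialgebra is spanned by an integral. -/
lemma exists_left_integral_counit_eq_one [Bialgebra k A] [IsSemisimpleRing A] :
    ∃ e : A, counit (R := k) e = 1 ∧ ∀ h : A, h * e = counit (R := k) h • e := by
  let ε : A →+* k := (Bialgebra.counitAlgHom k A : A →+* k)
  have hε : ∀ x, ε x = counit (R := k) x := fun x => rfl
  obtain ⟨C, hC⟩ := exists_isCompl (RingHom.ker ε)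
  have h1 : (1 : A) ∈ RingHom.ker ε ⊔ C := by rw [hC.sup_eq_top]; trivial
  obtain ⟨a, ha, e, he, hae⟩ := Submodule.mem_sup.1 h1
  have hεe : ε e = 1 := by
    rw [← map_one ε, ← hae, map_add, (RingHom.mem_ker).1 ha, zero_add]
  have hker : ∀ x ∈ RingHom.ker ε, x * e = 0 := by
    intro x hx
    have h2 : x * e ∈ RingHom.ker ε := by
      rw [RingHom.mem_ker, map_mul, (RingHom.mem_ker).1 hx, zero_mul]
    have h3 : x * e ∈ C := C.smul_mem x he
    exact (Submodule.disjoint_def.1 hC.disjoint) _ h2 h3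
  refine ⟨e, hεe, fun h => ?_⟩
  have h2 : h - algebraMap k A (counit (R := k) h) ∈ RingHom.ker ε := by
    rw [RingHom.mem_ker, map_sub, hε, hε]
    simp
  have h3 := hker _ h2
  rwa [sub_mul, sub_eq_zero, ← Algebra.smul_def] at h3

variable [HopfAlgebra k A]

/-- For an integral `t` one has `t₁ h ⊗ t₂ = t₁ ⊗ t₂ S(h)`. -/
lemma comul_integral_mul_antipode {t : A} (ht : ∀ h : A, t * h = counit (R := k) h • t) (h : A) :
    comul t * (h ⊗ₜ[k] (1 : A)) = comul t * ((1 : A) ⊗ₜ[k] antipode k h) := by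
  have r := ℛ k h
  have rl := fun i => ℛ k (r.left i)
  have rr := fun i => ℛ k (r.right i)
  have h1 : ∀ y : A, comul (R := k) t * comul (R := k) y = counit (R := k) y • comul (R := k) t := by
    intro y
    rw [← Bialgebra.comul_mul, ht, map_smul]
  have h2 : ∑ i ∈ r.index, comul (R := k) (r.left i) * ((1 : A) ⊗ₜ[k] antipode k (r.right i)) =
      h ⊗ₜ[k] (1 : A) := by
    have h3 := congr((LinearMap.mul' k A ∘ₗ (antipode k).lTensor A).lTensor A
      $(sum_tmul_tmul_eq r rl rr))
    simp only [map_sum, LinearMap.lTensor_tmul, LinearMap.comp_apply, LinearMap.mul'_apply] at h3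
    simp only [← TensorProduct.tmul_sum, sum_mul_antipode_eq_smul, TensorProduct.tmul_smul,
      TensorProduct.smul_tmul'] at h3
    rw [← TensorProduct.sum_tmul, sum_smul_counit] at h3
    rw [← h3]
    refine Finset.sum_congr rfl fun i _ => ?_
    rw [← (rl i).eq, Finset.sum_mul]
    simp
  rw [← h2, Finset.mul_sum]
  simp only [← mul_assoc, h1]
  conv_rhs => rw [← sum_counit_smul r, map_sum, TensorProduct.tmul_sum, Finset.mul_sum]
  refine Finset.sum_congr rfl fun i _ => ?_
  rw [map_smul, TensorProduct.tmul_smul, smul_mul_assoc, mul_smul_comm]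

lemma sum_mul_antipode_right {e : A} (hr : ∀ h : A, e * h = counit (R := k) h • e) {ι : Type*}
    (r : Repr k e ι) {M : Type*} [AddCommGroup M] [Module k M] (F : A →ₗ[k] A →ₗ[k] M)
    (h : A) : ∑ i ∈ r.index, F (r.left i * h) (r.right i) =
      ∑ i ∈ r.index, F (r.left i) (r.right i * antipode k h) := by
  have h1 := congr(TensorProduct.lift F $(comul_integral_mul_antipode hr h))
  rw [← r.eq] at h1
  simpa [Finset.sum_mul] using h1

variable [Module.Finite k A]

lemma antipode_integral {e : A} (he : counit (R := k) e = 1)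
    (hl : ∀ h : A, h * e = counit (R := k) h • e) : antipode k e = e := by
  obtain ⟨x, hx⟩ := (LinearMap.injective_iff_surjective (f := antipode k (A := A))).1
    antipode_injective e
  have h1 : antipode k e * antipode k x = counit (R := k) x • antipode k e := by
    rw [← antipode_mul_antidistrib, hl, map_smul]
  rw [hx, hl, counit_antipode, he, one_smul] at h1
  rw [← counit_antipode, hx, he, one_smul] at h1
  exact h1.symm

lemma right_integral_of_left_integral {e : A} (he : counit (R := k) e = 1)
    (hl : ∀ h : A, h * e = counit (R := k) h • e) (h : A) : e * h = counit (R := k) h • e := by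
  obtain ⟨x, rfl⟩ := (LinearMap.injective_iff_surjective (f := antipode k (A := A))).1
    antipode_injective h
  conv_lhs => rw [← antipode_integral he hl]
  rw [← antipode_mul_antidistrib, hl, map_smul, antipode_integral he hl, counit_antipode]

section TwoSided
variable {e : A} (he : counit (R := k) e = 1) (hl : ∀ h : A, h * e = counit (R := k) h • e)
  (hr : ∀ h : A, e * h = counit (R := k) h • e) {ι : Type*} (r : Repr k e ι)
include hl

lemma sum_antipode_mul_left {M : Type*} [AddCommGroup M] [Module k M] (F : A →ₗ[k] A →ₗ[k] M)
    (h : A) : ∑ i ∈ r.index, F (antipode k h * r.left i) (r.right i) =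
      ∑ i ∈ r.index, F (r.left i) (h * r.right i) := by
  have h1 := congr(TensorProduct.lift F $(antipode_mul_comul_integral hl h))
  rw [← r.eq] at h1
  simpa [Finset.mul_sum] using h1

include he

/-- The map `φ ↦ e₁ φ(e₂)` is injective. -/
lemma functional_ext_right {φ ψ : Module.Dual k A}
    (h : ∑ i ∈ r.index, φ (r.right i) • r.left i = ∑ i ∈ r.index, ψ (r.right i) • r.left i) :
    φ = ψ := by
  rw [← sub_eq_zero]
  refine integral_nondegenerate (by rintro rfl; simp at he) hl ((TensorProduct.rid k A).injective ?_)
  rw [← r.eq]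
  simp only [map_sum, LinearMap.lTensor_tmul, TensorProduct.rid_tmul, map_zero, LinearMap.sub_apply,
    sub_smul, Finset.sum_sub_distrib, h, sub_self]

/-- The map `φ ↦ e₁ φ(e₂)` is surjective. -/
lemma exists_functional_right (a : A) :
    ∃ φ : Module.Dual k A, ∑ i ∈ r.index, φ (r.right i) • r.left i = a := by
  let J : Module.Dual k A →ₗ[k] A := ∑ i ∈ r.index,
    (LinearMap.toSpanSingleton k A (r.left i)) ∘ₗ (Module.Dual.eval k A (r.right i))
  have hJ : ∀ φ, J φ = ∑ i ∈ r.index, φ (r.right i) • r.left i := by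
    intro φ
    simp [J]
  have hi : Function.Injective J := fun φ ψ h => functional_ext_right he hl r (by rw [← hJ, h, hJ])
  have hdim : Module.finrank k (Module.Dual k A) = Module.finrank k A := Subspace.dual_finrank_eq
  obtain ⟨φ, hφ⟩ := (LinearMap.injective_iff_surjective_of_finrank_eq_finrank hdim).1 hi a
  exact ⟨φ, by rw [← hJ, hφ]⟩

section
variable {ρ : Module.Dual k A} (hρ : ∑ i ∈ r.index, ρ (r.right i) • r.left i = 1)
include hρ

/-- The functional `ρ` with `e₁ ρ(e₂) = 1` is an integral of the dual. -/
lemma sum_smul_left_eq (x : A) {κ : Type*} (s : Repr k x κ) :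
    ∑ j ∈ s.index, ρ (s.right j) • s.left j = ρ x • (1 : A) := by
  refine eq_of_forall_dual_apply_eq (k := k) fun φ => ?_
  let F : A →ₗ[k] A →ₗ[k] k := (LinearMap.mul k k).compl₁₂ φ ρ
  have hF : ∀ a b, F a b = φ a * ρ b := fun _ _ => rfl
  have key : TensorProduct.lift F ∘ₗ comul = φ 1 • ρ := by
    refine functional_ext_right he hl r ?_
    let G : A →ₗ[k] A →ₗ[k] A →ₗ[k] A := (rightContraction φ).compr₂ (rightContraction ρ)
    have hG : ∀ a b c, G a b c = ρ c • φ b • a := fun _ _ _ => rfl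
    have h1 := sum_coassoc G r (fun i => ℛ k (r.left i)) (fun i => ℛ k (r.right i))
    simp only [hG] at h1
    simp only [LinearMap.comp_apply, ← sum_repr_bilin F (ℛ k (r.right _)), hF, Finset.sum_smul,
      LinearMap.smul_apply, smul_eq_mul, mul_smul, ← Finset.smul_sum, hρ]
    simp only [smul_comm (φ _) (ρ _)]
    rw [← h1]
    simp only [← rightContraction_apply φ, ← Finset.smul_sum, sum_repr_bilin]
    simp only [← map_smul, ← map_sum, hρ]
    simp [Algebra.TensorProduct.one_def, rightContraction_apply]
  have h2 := LinearMap.congr_fun key x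
  rw [LinearMap.comp_apply, ← sum_repr_bilin F s] at h2
  simpa [hF, mul_comm] using h2

/-- On the other side, the functional `ρ` with `e₁ ρ(e₂) = 1` satisfies `ρ(x₁) x₂ = ρ(x) G` for the
element `G = ρ(e₁) e₂`. -/
lemma sum_smul_right_eq (x : A) {κ : Type*} (s : Repr k x κ) :
    ∑ j ∈ s.index, ρ (s.left j) • s.right j =
      ρ x • ∑ i ∈ r.index, ρ (r.left i) • r.right i := by
  refine eq_of_forall_dual_apply_eq (k := k) fun φ => ?_
  let F : A →ₗ[k] A →ₗ[k] k := (LinearMap.mul k k).compl₁₂ ρ φ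
  have hF : ∀ a b, F a b = ρ a * φ b := fun _ _ => rfl
  have key : TensorProduct.lift F ∘ₗ comul = φ (∑ i ∈ r.index, ρ (r.left i) • r.right i) • ρ := by
    refine functional_ext_right he hl r ?_
    let G : A →ₗ[k] A →ₗ[k] A →ₗ[k] A := (rightContraction ρ).compr₂ (rightContraction φ)
    have hG : ∀ a b c, G a b c = φ c • ρ b • a := fun _ _ _ => rfl
    have h1 := sum_coassoc G r (fun i => ℛ k (r.left i)) (fun i => ℛ k (r.right i))
    simp only [hG] at h1
    simp only [LinearMap.comp_apply, ← sum_repr_bilin F (ℛ k (r.right _)), hF, Finset.sum_smul,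
      LinearMap.smul_apply, smul_eq_mul, mul_smul, ← Finset.smul_sum, hρ]
    simp only [smul_comm (ρ _) (φ _)]
    rw [← h1]
    simp only [← Finset.smul_sum]
    simp only [sum_smul_left_eq he hl r hρ _ (ℛ k _), map_sum, map_smul, Finset.sum_smul,
      smul_smul, smul_eq_mul, mul_comm]
  have h2 := LinearMap.congr_fun key x
  rw [LinearMap.comp_apply, ← sum_repr_bilin F s] at h2
  simpa [hF, mul_comm, Finset.mul_sum] using h2

/-- The element `G = ρ(e₁) e₂` is the distinguished group-like element of the algebra. -/
lemma isGroupLikeElem_sum_smul_right :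
    IsGroupLikeElem k (∑ i ∈ r.index, ρ (r.left i) • r.right i) := by
  have h1 : ρ e = 1 := by
    have h2 := congr(counit (R := k) $hρ)
    simp only [map_sum, map_smul, smul_eq_mul, Bialgebra.counit_one] at h2
    rw [← h2]
    conv_lhs => rw [← sum_counit_smul r]
    simp [mul_comm]
  refine ⟨?_, ?_⟩
  · conv_rhs => rw [← h1, ← sum_smul_counit r]
    simp [mul_comm]
  · set G := ∑ i ∈ r.index, ρ (r.left i) • r.right i with hG
    have h2 := congr(TensorProduct.lid k _ (ρ.rTensor (A ⊗[k] A) $(sum_tmul_tmul_eq r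
      (fun i => ℛ k (r.left i)) (fun i => ℛ k (r.right i)))))
    simp only [map_sum, LinearMap.rTensor_tmul, TensorProduct.lid_tmul,
      TensorProduct.smul_tmul'] at h2
    simp only [← TensorProduct.sum_tmul] at h2
    simp only [sum_smul_right_eq he hl r hρ _ (ℛ k (r.left _))] at h2
    simp only [TensorProduct.smul_tmul, ← TensorProduct.tmul_sum] at h2
    rw [← hG] at h2
    rw [h2]
    conv_lhs => rw [hG, map_sum]
    refine Finset.sum_congr rfl fun i _ => ?_
    rw [map_smul, ← (ℛ k (r.right i)).eq, Finset.smul_sum]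
    simp [TensorProduct.smul_tmul']

include hr in
/-- The square of the antipode is the Nakayama automorphism of `ρ`. -/
lemma functional_mul_eq (h x : A) : ρ (h * x) = ρ (x * antipode k (antipode k h)) := by
  have key : ρ ∘ₗ LinearMap.mulLeft k h = ρ ∘ₗ LinearMap.mulRight k (antipode k (antipode k h)) := by
    refine functional_ext_right he hl r ?_
    have h1 := sum_antipode_mul_left hl r (rightContraction ρ) h
    have h2 := sum_mul_antipode_right hr r (rightContraction ρ) (antipode k h)
    simp only [rightContraction_apply] at h1 h2
    simp only [LinearMap.comp_apply, LinearMap.mulLeft_apply, LinearMap.mulRight_apply]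
    rw [← h1, ← h2]
    have h3 : ∀ (c : k) (a b : A), c • (a * b) = (c • a) * b :=
      fun c a b => (smul_mul_assoc c a b).symm
    simp only [← mul_smul_comm _ (antipode k h), ← Finset.mul_sum, hρ, mul_one]
    simp only [h3, ← Finset.sum_mul, hρ, one_mul]
  exact LinearMap.congr_fun key x

include hr in
/-- Radford's formula for the fourth power of the antipode, in the unimodular case. -/
lemma antipode_pow_four (h : A) :
    (∑ i ∈ r.index, ρ (r.left i) • r.right i) * antipode k (antipode k (antipode k (antipode k h))) =
      h * ∑ i ∈ r.index, ρ (r.left i) • r.right i := by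
  set G := ∑ i ∈ r.index, ρ (r.left i) • r.right i with hG
  have h1 := sum_antipode_mul_left hl r (leftContraction ρ) h
  have h2 := sum_mul_antipode_right hr r (leftContraction ρ) (antipode k (antipode k (antipode k h)))
  simp only [leftContraction_apply] at h1 h2
  simp only [functional_mul_eq he hl hr r hρ (antipode k h)] at h1
  rw [h1] at h2
  have h3 : ∀ (c : k) (a b : A), c • (a * b) = (c • a) * b :=
    fun c a b => (smul_mul_assoc c a b).symm
  simp only [← mul_smul_comm _ h, ← Finset.mul_sum, ← hG] at h2
  rw [h2]
  simp only [h3, ← Finset.sum_mul, ← hG]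

include hr in
/-- Radford's formula for the trace of the square of the antipode, for a normalized integral `e`. -/
lemma trace_antipode_sq : LinearMap.trace k A (antipode k ∘ₗ antipode k) = ρ 1 := by
  -- `e₁` and `ρ(e₂ S(-))` are dual bases of `A`
  have h1 : ∀ h, h = ∑ i ∈ r.index, ρ (r.right i * antipode k h) • r.left i := by
    intro h
    have h2 := sum_mul_antipode_right hr r (rightContraction ρ) h
    simp only [rightContraction_apply] at h2
    rw [← h2]
    have h3 : ∀ (c : k) (a b : A), c • (a * b) = (c • a) * b :=
      fun c a b => (smul_mul_assoc c a b).symm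
    simp only [h3, ← Finset.sum_mul, hρ, one_mul]
  have h2 : (antipode k ∘ₗ antipode k : A →ₗ[k] A) = ∑ i ∈ r.index,
      (ρ ∘ₗ LinearMap.mulLeft k (r.right i) ∘ₗ antipode k).smulRight
        (antipode k (antipode k (r.left i))) := by
    ext h
    conv_lhs => rw [h1 h]
    simp
  rw [h2, map_sum]
  simp only [LinearMap.trace_smulRight, LinearMap.comp_apply, LinearMap.mulLeft_apply]
  simp only [← functional_mul_eq he hl hr r hρ (antipode k _)]
  rw [← map_sum, sum_antipode_mul_eq_smul, he, one_smul]

end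
end TwoSided

/-- **Larson–Radford**: a finite-dimensional semisimple Hopf algebra over an algebraically closed
field of characteristic zero is cosemisimple, that is, its dual has an integral `ρ` with
`ρ(1) ≠ 0`. -/
theorem exists_dual_integral [IsAlgClosed k] [CharZero k] [IsSemisimpleRing A] :
    ∃ ρ : Module.Dual k A, ρ 1 ≠ 0 ∧
      (∀ (x : A) {κ : Type v} (s : Repr k x κ),
        ∑ j ∈ s.index, ρ (s.right j) • s.left j = ρ x • (1 : A)) ∧
      ∀ h x : A, ρ (h * x) = ρ (x * antipode k (antipode k h)) := by
  obtain ⟨e, he, hl⟩ := exists_left_integral_counit_eq_one (k := k) (A := A)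
  have hr := right_integral_of_left_integral he hl
  obtain ⟨ρ, hρ⟩ := exists_functional_right he hl (ℛ k e) 1
  refine ⟨ρ, ?_, fun x _ s => sum_smul_left_eq he hl _ hρ x s, functional_mul_eq he hl hr _ hρ⟩
  rw [← trace_antipode_sq he hl hr _ hρ]
  let T : A →ₐ[k] A := AlgHom.ofLinearMap (antipode k ∘ₗ antipode k) (by simp)
    (fun x y => by simp [antipode_mul_antidistrib])
  have hTa : ∀ x, T x = antipode k (antipode k x) := fun x => rfl
  -- `T ^ 2` is conjugation by a group-like element; the group-like elements are linearly
  -- independent, so they form a finite group and `T` has finite order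
  have hG := isGroupLikeElem_sum_smul_right he hl (ℛ k e) hρ
  have h4 := antipode_pow_four he hl hr (ℛ k e) hρ
  set G := ∑ i ∈ (ℛ k e).index, ρ ((ℛ k e).left i) • (ℛ k e).right i
  have : Finite (GroupLike k A) := (linearIndep_groupLikeVal (R := k) (A := A)).finite
  obtain ⟨n, hn, hGn⟩ :=
    (isOfFinOrder_iff_pow_eq_one).1 (isOfFinOrder_of_finite (⟨G, hG⟩ : GroupLike k A))
  have hGn' : G ^ n = 1 := by
    have := congr(($hGn).val)
    simpa using this
  have h5 : ∀ (m : ℕ) (x : A), G ^ m * ((T ^ 2) ^ m) x = x * G ^ m := by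
    intro m
    induction m with
    | zero => intro x; simp
    | succ m ih =>
      intro x
      rw [pow_succ' (T ^ 2), AlgHom.mul_apply, pow_succ G, mul_assoc, pow_two T, AlgHom.mul_apply,
        hTa, hTa, h4, ← mul_assoc, ← pow_two, ih, mul_assoc]
  have hTn : T ^ (2 * n) = 1 := by
    ext1 x
    have h6 := h5 n x
    rw [hGn', one_mul, mul_one, ← pow_mul] at h6
    exact h6
  exact trace_ne_zero_of_finite_order T (by positivity) hTn (Bialgebra.counitAlgHom k A) e he
    (by rw [hTa, antipode_integral he hl, antipode_integral he hl]) hl hr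

end Integrals

/-! ### The two factors of a double and its universal property -/

section TwistComp
open WithConv
variable {k : Type u} [Field k] {A : Type v} [Ring A] [Bialgebra k A] (c : TwoCocycle k A)
  {C : Type*} [AddCommGroup C] [Module k C] [Coalgebra k C]

/-- The twisted product agrees with the original one where the cocycle is trivial. -/
lemma twistMul_comp_eq (h : C →ₗc[k] A ⊗[k] A) (hc : c.toFun ∘ₗ h.toLinearMap = counit) :
    c.twistMul ∘ₗ h.toLinearMap = LinearMap.mul' k A ∘ₗ h.toLinearMap := by
  have h1 : pull h (sc A c.toFun) = 1 := by
    rw [pull_sc, hc]; rfl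
  have h2 : pull h (sc A c.inv) = 1 := by
    have h3 : pull h (sc A c.toFun) * pull h (sc A c.inv) = 1 := by
      rw [← pull_mul, c.sc_mul_inv, pull_one]
    rwa [h1, one_mul] at h3
  have h3 : pull h (toConv c.twistMul) = pull h (toConv (LinearMap.mul' k A)) := by
    rw [c.toConv_twistMul, pull_mul, pull_mul, h1, h2, one_mul, mul_one]
  exact congr(($h3).ofConv)

end TwistComp

section DoubleStructure
open WithConv HopfAlgebra
variable {k : Type u} [Field k] {P : Type v} {Q : Type w} [Ring P] [Ring Q]

section Incl
variable (k P Q) [Bialgebra k P] [Bialgebra k Q]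

/-- The inclusion `p ↦ p ⊗ 1` of bialgebras. -/
def tensorInl : P →ₐc[k] P ⊗[k] Q :=
  (Bialgebra.TensorProduct.map (BialgHom.id k P) (Bialgebra.unitBialgHom k Q)).comp
    ((Bialgebra.TensorProduct.rid k k P).symm : P →ₐc[k] P ⊗[k] k)

/-- The inclusion `q ↦ 1 ⊗ q` of bialgebras. -/
def tensorInr : Q →ₐc[k] P ⊗[k] Q :=
  (Bialgebra.TensorProduct.map (Bialgebra.unitBialgHom k P) (BialgHom.id k Q)).comp
    ((Bialgebra.TensorProduct.lid k Q).symm : Q →ₐc[k] k ⊗[k] Q)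

variable {k P Q}

lemma tensorInl_apply (p : P) : tensorInl k P Q p = p ⊗ₜ 1 := by
  simp [tensorInl]

lemma tensorInr_apply (q : Q) : tensorInr k P Q q = 1 ⊗ₜ q := by
  simp [tensorInr]

end Incl

namespace SkewPairing
variable [HopfAlgebra k P] [Bialgebra k Q] (l : SkewPairing k P Q)

lemma twoCocycle_toFun_tmul (p p' : P) (q q' : Q) :
    l.twoCocycle.toFun ((p ⊗ₜ q) ⊗ₜ (p' ⊗ₜ q')) = counit p * l.toFun p' q * counit q' :=
  form_tmul _ _ _ _ _

/-- The inclusion of the first factor in the double. -/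
def inl : P →ₐ[k] l.Double :=
  AlgHom.ofLinearMap
    ((CocycleTwist.of l.twoCocycle).toLinearMap ∘ₗ (tensorInl k P Q : P →ₗ[k] P ⊗[k] Q))
    (by simp; rfl)
    (fun x y => by
      have h := twistMul_comp_eq l.twoCocycle (Coalgebra.TensorProduct.map
        (tensorInl k P Q : P →ₗc[k] P ⊗[k] Q) (tensorInl k P Q : P →ₗc[k] P ⊗[k] Q)) (by
          ext p p'
          simp [tensorInl_apply, twoCocycle_toFun_tmul, l.apply_one, mul_comm])
      have h1 := congr(CocycleTwist.of l.twoCocycle ($h (x ⊗ₜ y)))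
      refine Eq.trans ?_ h1.symm
      simp)

/-- The inclusion of the second factor in the double. -/
def inr : Q →ₐ[k] l.Double :=
  AlgHom.ofLinearMap
    ((CocycleTwist.of l.twoCocycle).toLinearMap ∘ₗ (tensorInr k P Q : Q →ₗ[k] P ⊗[k] Q))
    (by simp; rfl)
    (fun x y => by
      have h := twistMul_comp_eq l.twoCocycle (Coalgebra.TensorProduct.map
        (tensorInr k P Q : Q →ₗc[k] P ⊗[k] Q) (tensorInr k P Q : Q →ₗc[k] P ⊗[k] Q)) (by
          ext q q'
          simp [tensorInr_apply, twoCocycle_toFun_tmul, l.one_apply, mul_comm])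
      have h1 := congr(CocycleTwist.of l.twoCocycle ($h (x ⊗ₜ y)))
      refine Eq.trans ?_ h1.symm
      simp)

lemma inl_apply (p : P) : l.inl p = CocycleTwist.of l.twoCocycle (p ⊗ₜ 1) :=
  congrArg (CocycleTwist.of l.twoCocycle) (tensorInl_apply p)

lemma inr_apply (q : Q) : l.inr q = CocycleTwist.of l.twoCocycle (1 ⊗ₜ q) :=
  congrArg (CocycleTwist.of l.twoCocycle) (tensorInr_apply q)

lemma inl_mul_inr (p : P) (q : Q) :
    l.inl p * l.inr q = CocycleTwist.of l.twoCocycle (p ⊗ₜ q) := by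
  have h := twistMul_comp_eq l.twoCocycle (Coalgebra.TensorProduct.map
    (tensorInl k P Q : P →ₗc[k] P ⊗[k] Q) (tensorInr k P Q : Q →ₗc[k] P ⊗[k] Q)) (by
      ext p q
      simp [tensorInl_apply, tensorInr_apply, twoCocycle_toFun_tmul, l.apply_one, mul_comm])
  have h1 := congr(CocycleTwist.of l.twoCocycle ($h (p ⊗ₜ q)))
  refine Eq.trans ?_ (h1.trans ?_)
  · rfl
  · simp [tensorInl_apply, tensorInr_apply]

lemma double_ext {M : Type*} [AddCommGroup M] [Module k M] {F G : l.Double →ₗ[k] M}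
    (h : ∀ p q, F (l.inl p * l.inr q) = G (l.inl p * l.inr q)) : F = G := by
  have h1 : F ∘ₗ (CocycleTwist.of l.twoCocycle).toLinearMap =
      G ∘ₗ (CocycleTwist.of l.twoCocycle).toLinearMap :=
    TensorProduct.ext' fun p q => by
      simp only [LinearMap.comp_apply, LinearEquiv.coe_coe, ← inl_mul_inr, h]
  ext x
  obtain ⟨y, rfl⟩ := (CocycleTwist.of l.twoCocycle).surjective x
  exact LinearMap.congr_fun h1 y

lemma comul_inl (p : P) : comul (R := k) (l.inl p) =
    TensorProduct.map l.inl.toLinearMap l.inl.toLinearMap (comul p) := by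
  have h := LinearMap.congr_fun (tensorInl k P Q).toCoalgHom.map_comp_comul p
  have h1 := congr(CocycleTwist.ofTensor l.twoCocycle $h)
  rw [inl_apply, CocycleTwist.comul_of, ← tensorInl_apply]
  refine h1.symm.trans ?_
  rw [LinearMap.comp_apply, CocycleTwist.ofTensor, ← LinearMap.comp_apply, ← TensorProduct.map_comp]
  rfl

lemma comul_inr (q : Q) : comul (R := k) (l.inr q) =
    TensorProduct.map l.inr.toLinearMap l.inr.toLinearMap (comul q) := by
  have h := LinearMap.congr_fun (tensorInr k P Q).toCoalgHom.map_comp_comul q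
  have h1 := congr(CocycleTwist.ofTensor l.twoCocycle $h)
  rw [inr_apply, CocycleTwist.comul_of, ← tensorInr_apply]
  refine h1.symm.trans ?_
  rw [LinearMap.comp_apply, CocycleTwist.ofTensor, ← LinearMap.comp_apply, ← TensorProduct.map_comp]
  rfl

lemma counit_inl (p : P) : counit (R := k) (l.inl p) = counit (R := k) p := by
  rw [inl_apply, CocycleTwist.counit_of, ← tensorInl_apply]
  exact LinearMap.congr_fun (tensorInl k P Q).toCoalgHom.counit_comp p

lemma counit_inr (q : Q) : counit (R := k) (l.inr q) = counit (R := k) q := by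
  rw [inr_apply, CocycleTwist.counit_of, ← tensorInr_apply]
  exact LinearMap.congr_fun (tensorInr k P Q).toCoalgHom.counit_comp q

/-- The map `q ⊗ p ↦ (1 ⊗ q) ⊗ (p ⊗ 1)`. -/
def cross : Q ⊗[k] P →ₗc[k] (P ⊗[k] Q) ⊗[k] (P ⊗[k] Q) :=
  Coalgebra.TensorProduct.map
    (tensorInr k P Q : Q →ₗc[k] P ⊗[k] Q) (tensorInl k P Q : P →ₗc[k] P ⊗[k] Q)

/-- On elements `(1 ⊗ q) ⊗ (p ⊗ 1)` the cocycle is the skew pairing, so its inverse restricts to the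
inverse of the skew pairing. -/
lemma sc_flip_mul_inv {B : Type*} [Ring B] [Algebra k B] :
    sc B (TensorProduct.lift l.toFun.flip) *
      sc B (l.twoCocycle.inv ∘ₗ (cross (k := k) (P := P) (Q := Q)).toLinearMap) = 1 := by
  have h : l.twoCocycle.toFun ∘ₗ (cross (k := k) (P := P) (Q := Q)).toLinearMap =
      TensorProduct.lift l.toFun.flip := by
    ext q p
    simp [cross, tensorInl_apply, tensorInr_apply, twoCocycle_toFun_tmul]
  rw [← h, ← pull_sc, ← pull_sc, ← pull_mul, l.twoCocycle.sc_mul_inv, pull_one]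

section Crossed
variable {E : Type*} [Ring E] [Algebra k E] (α : P →ₐ[k] E) (β : Q →ₐ[k] E)

/-- The commutation rule `λ(p₁, q₁) α(p₂) β(q₂) = β(q₁) α(p₁) λ(p₂, q₂)` between the images of the
two factors of the double in an algebra. -/
def Crossed : Prop :=
  ∀ (p : P) (q : Q), ∑ j ∈ (ℛ k q).index, ∑ i ∈ (ℛ k p).index,
      l.toFun ((ℛ k p).left i) ((ℛ k q).left j) • (α ((ℛ k p).right i) * β ((ℛ k q).right j)) =
    ∑ j ∈ (ℛ k q).index, ∑ i ∈ (ℛ k p).index,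
      l.toFun ((ℛ k p).right i) ((ℛ k q).right j) • (β ((ℛ k q).left j) * α ((ℛ k p).left i))

/-- `q ⊗ p ↦ α(p) β(q)` -/
def mulSwap : Q ⊗[k] P →ₗ[k] E :=
  LinearMap.mul' k E ∘ₗ TensorProduct.map α.toLinearMap β.toLinearMap ∘ₗ
    (TensorProduct.comm k Q P).toLinearMap

/-- `q ⊗ p ↦ β(q) α(p)` -/
def mulStraight : Q ⊗[k] P →ₗ[k] E :=
  LinearMap.mul' k E ∘ₗ TensorProduct.map β.toLinearMap α.toLinearMap

lemma crossed_iff : l.Crossed α β ↔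
    sc E (TensorProduct.lift l.toFun.flip) * toConv (mulSwap α β) =
      toConv (mulStraight α β) * sc E (TensorProduct.lift l.toFun.flip) := by
  have h1 : ∀ q p, (sc E (TensorProduct.lift l.toFun.flip) * toConv (mulSwap α β)) (q ⊗ₜ p) =
      ∑ j ∈ (ℛ k q).index, ∑ i ∈ (ℛ k p).index,
      l.toFun ((ℛ k p).left i) ((ℛ k q).left j) • (α ((ℛ k p).right i) * β ((ℛ k q).right j)) := by
    intro q p
    rw [((ℛ k q).tmul (ℛ k p)).convMul_apply]
    simp [sc, mulSwap, Finset.sum_product, ← Algebra.smul_def]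
  have h2 : ∀ q p, (toConv (mulStraight α β) * sc E (TensorProduct.lift l.toFun.flip)) (q ⊗ₜ p) =
      ∑ j ∈ (ℛ k q).index, ∑ i ∈ (ℛ k p).index,
      l.toFun ((ℛ k p).right i) ((ℛ k q).right j) • (β ((ℛ k q).left j) * α ((ℛ k p).left i)) := by
    intro q p
    rw [((ℛ k q).tmul (ℛ k p)).convMul_apply]
    simp [sc, mulStraight, Finset.sum_product, ← Algebra.commutes, ← Algebra.smul_def]
  constructor
  · intro h
    apply WithConv.ext
    ext q p
    exact (h1 q p).trans ((h p q).trans (h2 q p).symm)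
  · intro h p q
    rw [← h1, ← h2, h]

variable {α β} in
/-- The commutation rule, solved for the products `β(q) α(p)`. -/
lemma Crossed.mulStraight_eq (h : l.Crossed α β) : toConv (mulStraight α β) =
    sc E (TensorProduct.lift l.toFun.flip) * toConv (mulSwap α β) *
      sc E (l.twoCocycle.inv ∘ₗ (cross (k := k) (P := P) (Q := Q)).toLinearMap) := by
  rw [(l.crossed_iff α β).1 h, mul_assoc, sc_flip_mul_inv, mul_one]

end Crossed

/-- The two factors of the double satisfy the commutation rule: it is the definition of the twisted
product `(1 ⊗ q) (p ⊗ 1)`. -/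
lemma crossed_inl_inr : l.Crossed l.inl l.inr := by
  rw [crossed_iff]
  let T := (CocycleTwist.of l.twoCocycle).toLinearMap
  let c := cross (k := k) (P := P) (Q := Q)
  have hσ : l.twoCocycle.toFun ∘ₗ c.toLinearMap = TensorProduct.lift l.toFun.flip := by
    ext q p
    simp [c, cross, tensorInl_apply, tensorInr_apply, twoCocycle_toFun_tmul]
  have h1 := congr(pull c ($(l.twoCocycle.comp_twistMul T) * sc l.Double l.twoCocycle.toFun))
  rw [mul_assoc _ (sc _ l.twoCocycle.inv), l.twoCocycle.sc_inv_mul, mul_one, pull_mul, pull_mul,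
    pull_sc, hσ] at h1
  have h2 : pull c (toConv (T ∘ₗ l.twoCocycle.twistMul)) = toConv (mulStraight l.inl l.inr) := by
    apply WithConv.ext
    ext q p
    rfl
  have h3 : pull c (toConv (T ∘ₗ LinearMap.mul' k (P ⊗[k] Q))) = toConv (mulSwap l.inl l.inr) := by
    apply WithConv.ext
    ext q p
    simp [pull, c, cross, mulSwap, inl_mul_inr, tensorInl_apply, tensorInr_apply, T]
  rw [h2, h3] at h1
  exact h1.symm

section Lift
variable {E : Type*} [Ring E] [Algebra k E] {α : P →ₐ[k] E} {β : Q →ₐ[k] E} (h : l.Crossed α β)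

/-- The linear map `p ⊗ q ↦ α(p) β(q)` on the double. -/
def liftLin (α : P →ₐ[k] E) (β : Q →ₐ[k] E) : l.Double →ₗ[k] E :=
  LinearMap.mul' k E ∘ₗ TensorProduct.map α.toLinearMap β.toLinearMap ∘ₗ
    (CocycleTwist.of l.twoCocycle).symm.toLinearMap

lemma liftLin_inl_mul_inr (p : P) (q : Q) : l.liftLin α β (l.inl p * l.inr q) = α p * β q := by
  rw [inl_mul_inr]
  simp [liftLin]

include h in
lemma liftLin_inr_mul_inl (p : P) (q : Q) : l.liftLin α β (l.inr q * l.inl p) = β q * α p := by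
  have h1 := (l.crossed_inl_inr).mulStraight_eq
  have h2 := congr(toConv (l.liftLin α β ∘ₗ ($h1).ofConv))
  rw [comp_mul_sc, comp_sc_mul] at h2
  have h3 : l.liftLin α β ∘ₗ mulSwap l.inl l.inr = mulSwap α β := by
    ext q p
    simp [mulSwap, liftLin_inl_mul_inr]
  rw [ofConv_toConv, h3, ← h.mulStraight_eq] at h2
  exact congr(($h2).ofConv (q ⊗ₜ p))

/-- The universal property of the double. -/
def lift (h : l.Crossed α β) : l.Double →ₐ[k] E :=
  AlgHom.ofLinearMap (l.liftLin α β)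
    (by
      have h1 := l.liftLin_inl_mul_inr (α := α) (β := β) 1 1
      simpa using h1)
    (by
      have hl : ∀ p z, l.liftLin α β (l.inl p * z) = α p * l.liftLin α β z := by
        intro p z
        refine LinearMap.congr_fun (l.double_ext (F := l.liftLin α β ∘ₗ LinearMap.mulLeft k (l.inl p))
          (G := LinearMap.mulLeft k (α p) ∘ₗ l.liftLin α β) fun p' q' => ?_) z
        simp only [LinearMap.comp_apply, LinearMap.mulLeft_apply]
        rw [← mul_assoc, ← map_mul, liftLin_inl_mul_inr, liftLin_inl_mul_inr, map_mul, mul_assoc]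
      have hr : ∀ q z, l.liftLin α β (z * l.inr q) = l.liftLin α β z * β q := by
        intro q z
        refine LinearMap.congr_fun (l.double_ext
          (F := l.liftLin α β ∘ₗ LinearMap.mulRight k (l.inr q))
          (G := LinearMap.mulRight k (β q) ∘ₗ l.liftLin α β) fun p' q' => ?_) z
        simp only [LinearMap.comp_apply, LinearMap.mulRight_apply]
        rw [mul_assoc, ← map_mul, liftLin_inl_mul_inr, liftLin_inl_mul_inr, map_mul, mul_assoc]
      intro x y
      have h1 : ∀ p q, l.liftLin α β (l.inl p * l.inr q * y) =
          l.liftLin α β (l.inl p * l.inr q) * l.liftLin α β y := by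
        intro p q
        refine LinearMap.congr_fun (l.double_ext
          (F := l.liftLin α β ∘ₗ LinearMap.mulLeft k (l.inl p * l.inr q))
          (G := LinearMap.mulLeft k (l.liftLin α β (l.inl p * l.inr q)) ∘ₗ l.liftLin α β)
          fun p' q' => ?_) y
        simp only [LinearMap.comp_apply, LinearMap.mulLeft_apply]
        rw [← mul_assoc, hr, mul_assoc (l.inl p), hl, l.liftLin_inr_mul_inl h, liftLin_inl_mul_inr,
          liftLin_inl_mul_inr]
        simp only [mul_assoc]
      exact LinearMap.congr_fun (l.double_ext
        (F := l.liftLin α β ∘ₗ LinearMap.mulRight k y)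
        (G := LinearMap.mulRight k (l.liftLin α β y) ∘ₗ l.liftLin α β) h1) x)

lemma lift_inl (p : P) : l.lift h (l.inl p) = α p := by
  have h1 := l.liftLin_inl_mul_inr (α := α) (β := β) p 1
  simp only [map_one, mul_one] at h1
  exact h1

lemma lift_inr (q : Q) : l.lift h (l.inr q) = β q := by
  have h1 := l.liftLin_inl_mul_inr (α := α) (β := β) 1 q
  simp only [map_one, one_mul] at h1
  exact h1

end Lift

instance [Module.Finite k P] [Module.Finite k Q] : Module.Finite k l.Double :=
  inferInstanceAs (Module.Finite k (P ⊗[k] Q))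

end SkewPairing

/-! ### The antipode of a double -/

section Antipode
variable [HopfAlgebra k P]

/-- An algebra morphism `f` on a Hopf algebra has the convolution inverse `f ∘ S`. -/
lemma toConv_mul_comp_antipode {B : Type*} [Ring B] [Algebra k B] (f : P →ₐ[k] B) :
    toConv f.toLinearMap * toConv (f.toLinearMap ∘ₗ antipode k) = 1 := by
  apply WithConv.ext
  ext p
  refine ((ℛ k p).convMul_apply _ _).trans ?_
  have h := congr(f $(sum_mul_antipode_eq_smul (ℛ k p)))
  simpa [Algebra.algebraMap_eq_smul_one] using h

lemma comp_antipode_mul_toConv {B : Type*} [Ring B] [Algebra k B] (f : P →ₐ[k] B) :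
    toConv (f.toLinearMap ∘ₗ antipode k) * toConv f.toLinearMap = 1 := by
  apply WithConv.ext
  ext p
  refine ((ℛ k p).convMul_apply _ _).trans ?_
  have h := congr(f $(sum_antipode_mul_eq_smul (ℛ k p)))
  simpa [Algebra.algebraMap_eq_smul_one] using h

variable [HopfAlgebra k Q] (l : SkewPairing k P Q)
open SkewPairing

/-- The convolution inverse of `p ⊗ q ↦ (p ⊗ 1) (1 ⊗ q)`. -/
def doubleAntipode : WithConv (P ⊗[k] Q →ₗ[k] l.Double) :=
  pull (toRight k P Q : P ⊗[k] Q →ₗc[k] Q) (toConv (l.inr.toLinearMap ∘ₗ antipode k)) *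
    pull (toLeft k P Q : P ⊗[k] Q →ₗc[k] P) (toConv (l.inl.toLinearMap ∘ₗ antipode k))

lemma toConv_of_eq : toConv (CocycleTwist.of l.twoCocycle).toLinearMap =
    pull (toLeft k P Q : P ⊗[k] Q →ₗc[k] P) (toConv l.inl.toLinearMap) *
    pull (toRight k P Q : P ⊗[k] Q →ₗc[k] Q) (toConv l.inr.toLinearMap) := by
  apply WithConv.ext
  ext p q
  refine Eq.trans ?_ (((ℛ k p).tmul (ℛ k q)).convMul_apply _ _).symm
  simp [pull, toLeft_tmul, toRight_tmul, Finset.sum_product]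
  simp only [inl_mul_inr, ← map_smul, ← map_sum]
  congr 1
  simp only [← Finset.smul_sum, ← TensorProduct.tmul_smul, ← TensorProduct.tmul_sum,
    sum_counit_smul]
  simp only [← TensorProduct.smul_tmul, ← TensorProduct.sum_tmul, sum_smul_counit]

/-- The antipode of the double is the convolution inverse of the identity, which is the convolution
product of the maps `p ⊗ q ↦ ε(q) p` and `p ⊗ q ↦ ε(p) q`. -/
instance : HopfAlgebra k l.Double where
  antipode := (doubleAntipode l).ofConv
  mul_antipode_rTensor_comul := by
    have h : doubleAntipode l * toConv (CocycleTwist.of l.twoCocycle).toLinearMap = 1 := by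
      rw [toConv_of_eq, doubleAntipode, mul_assoc, ← mul_assoc (pull _ _) (pull _ _) (pull _ _),
        ← pull_mul, comp_antipode_mul_toConv, pull_one, one_mul, ← pull_mul, comp_antipode_mul_toConv,
        pull_one]
    exact congr(($h).ofConv)
  mul_antipode_lTensor_comul := by
    have h : toConv (CocycleTwist.of l.twoCocycle).toLinearMap * doubleAntipode l = 1 := by
      rw [toConv_of_eq, doubleAntipode, mul_assoc, ← mul_assoc (pull _ _) (pull _ _) (pull _ _),
        ← pull_mul, toConv_mul_comp_antipode, pull_one, one_mul, ← pull_mul, toConv_mul_comp_antipode,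
        pull_one]
    exact congr(($h).ofConv)

end Antipode
end DoubleStructure

/-! ### Semisimplicity of the generalized double -/

section Maschke
open HopfAlgebra
variable {k : Type u} [Field k] {A : Type v} [Ring A] [HopfAlgebra k A] [Module.Finite k A]

/-- **Maschke's theorem**: a finite-dimensional Hopf algebra with a normalized integral is
semisimple. -/
theorem isSemisimpleRing_of_integral {t : A} (hε : counit (R := k) t = 1)
    (ht : ∀ h : A, h * t = counit (R := k) h • t) : IsSemisimpleRing A := by
  suffices h : ComplementedLattice (Submodule A A) from { toComplementedLattice := h }
  refine ⟨fun N => ?_⟩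
  have r := ℛ k t
  -- `t₁ ⊗ S(t₂)` is a Casimir element
  have hcas : ∀ {M : Type v} [AddCommGroup M] [Module k M] (F : A →ₗ[k] A →ₗ[k] M) (a : A),
      ∑ i ∈ r.index, F (a * r.left i) (antipode k (r.right i)) =
        ∑ i ∈ r.index, F (r.left i) (antipode k (r.right i) * a) := by
    intro M _ _ F a
    obtain ⟨h, rfl⟩ := (LinearMap.injective_iff_surjective (f := antipode k (A := A))).1
      antipode_injective a
    have h1 := sum_antipode_mul_left ht r (F.compl₂ (antipode k)) h
    simpa [antipode_mul_antidistrib] using h1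
  obtain ⟨p, hp⟩ := (N.subtype.restrictScalars k).exists_leftInverse_of_injective
    (LinearMap.ker_eq_bot.2 N.subtype_injective)
  have hp' : ∀ n : N, p n = n := fun n => LinearMap.congr_fun hp n
  let F : A → A →ₗ[k] A →ₗ[k] N := fun v => LinearMap.mk₂ k (fun x y => x • p (y * v))
    (by intros; simp [add_smul]) (by intros; simp) (by intros; simp [add_mul]) (by
      intro c x y
      rw [smul_mul_assoc, map_smul]
      ext; simp)
  have hF : ∀ v x y, F v x y = x • p (y * v) := fun _ _ _ => rfl
  have hmul : ∀ a v, ∑ i ∈ r.index, F (a * v) (r.left i) (antipode k (r.right i)) =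
      a • ∑ i ∈ r.index, F v (r.left i) (antipode k (r.right i)) := by
    intro a v
    have h1 := hcas (F v) a
    simp only [hF, mul_smul, ← Finset.smul_sum, mul_assoc] at h1 ⊢
    exact h1.symm
  let Pr : A →ₗ[A] N :=
    { toFun := fun v => ∑ i ∈ r.index, F v (r.left i) (antipode k (r.right i))
      map_add' := fun v w => by simp [hF, mul_add, Finset.sum_add_distrib]
      map_smul' := fun a v => hmul a v }
  refine ⟨LinearMap.ker Pr, LinearMap.isCompl_of_proj fun n => ?_⟩
  have h2 : ∀ i, p (antipode k (r.right i) * (n : A)) = antipode k (r.right i) • n := fun i =>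
    hp' (antipode k (r.right i) • n)
  change ∑ i ∈ r.index, F n (r.left i) (antipode k (r.right i)) = n
  simp only [hF, h2, smul_smul, ← Finset.sum_smul, sum_mul_antipode_eq_smul, hε, one_smul]

end Maschke

section DualCopDouble
open HopfAlgebra
variable {k : Type u} [Field k] {U : Type v} {H : Type w} [Ring U] [Ring H] [HopfAlgebra k U]
  [HopfAlgebra k H] [Module.Finite k U] [Module.Finite k H]

namespace DualCop

instance : Module.Finite k (DualCop k H) :=
  Module.Finite.equiv (toDual (k := k) (H := H)).symm

/-- The functional `φ(- a)`. -/
def translateRight (φ : DualCop k H) (a : H) : DualCop k H :=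
  toDual.symm (toDual φ ∘ₗ LinearMap.mulRight k a)

/-- The functional `φ(a -)`. -/
def translateLeft (φ : DualCop k H) (a : H) : DualCop k H :=
  toDual.symm (toDual φ ∘ₗ LinearMap.mulLeft k a)

omit [Module.Finite k H] in
lemma toDual_translateRight (φ : DualCop k H) (a x : H) :
    toDual (translateRight φ a) x = toDual φ (x * a) := by
  simp [translateRight]

omit [Module.Finite k H] in
lemma toDual_translateLeft (φ : DualCop k H) (a x : H) :
    toDual (translateLeft φ a) x = toDual φ (a * x) := by
  simp [translateLeft]

lemma sum_toDual_left_smul {φ : DualCop k H} {ι : Type*} (r : Repr k φ ι) (a : H) :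
    ∑ i ∈ r.index, toDual (r.left i) a • r.right i = translateRight φ a := by
  ext x
  have h := pairing_comul φ a x
  rw [← r.eq] at h
  simpa [toDual_translateRight] using h

lemma sum_toDual_right_smul {φ : DualCop k H} {ι : Type*} (r : Repr k φ ι) (a : H) :
    ∑ i ∈ r.index, toDual (r.right i) a • r.left i = translateLeft φ a := by
  ext x
  have h := pairing_comul φ x a
  rw [← r.eq] at h
  simpa [toDual_translateLeft, mul_comm] using h

end DualCop

open DualCop

lemma skewPairing_dualCopMap_apply (f : U →ₐc[k] H) (φ : DualCop k H) (u : U) :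
    (skewPairing (dualCopMap f)).toFun φ u = toDual φ (f u) := rfl

/-- For the skew pairing of `f : U → H` the commutation rule of the double reads
`α(φ(- f(u₁))) β(u₂) = β(u₁) α(φ(f(u₂) -))`. -/
lemma crossed_dualCopMap_iff (f : U →ₐc[k] H) {E : Type*} [Ring E] [Algebra k E]
    (α : DualCop k H →ₐ[k] E) (β : U →ₐ[k] E) :
    (skewPairing (dualCopMap f)).Crossed α β ↔ ∀ (φ : DualCop k H) (u : U),
      ∑ j ∈ (ℛ k u).index, α (translateRight φ (f ((ℛ k u).left j))) * β ((ℛ k u).right j) =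
      ∑ j ∈ (ℛ k u).index, β ((ℛ k u).left j) * α (translateLeft φ (f ((ℛ k u).right j))) := by
  have h1 : ∀ φ a b, ∑ i ∈ (ℛ k φ).index, toDual ((ℛ k φ).left i) a •
      (α ((ℛ k φ).right i) * b) = α (translateRight φ a) * b := by
    intro φ a b
    rw [← sum_toDual_left_smul (ℛ k φ) a, map_sum, Finset.sum_mul]
    simp
  have h2 : ∀ φ a b, ∑ i ∈ (ℛ k φ).index, toDual ((ℛ k φ).right i) a •
      (b * α ((ℛ k φ).left i)) = b * α (translateLeft φ a) := by
    intro φ a b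
    rw [← sum_toDual_right_smul (ℛ k φ) a, map_sum, Finset.mul_sum]
    simp
  simp only [SkewPairing.Crossed, skewPairing_dualCopMap_apply, h1, h2]

/-- If `ρ` is an integral of `H^*` and `Λ` is a left integral of `U`, then `ρ ⊗ Λ` is a left integral of
the double. -/
lemma mul_integral_eq (f : U →ₐc[k] H) {ρ : DualCop k H}
    (hρ : ∀ (x : H), ∑ j ∈ (ℛ k x).index, toDual ρ ((ℛ k x).right j) • (ℛ k x).left j =
      toDual ρ x • (1 : H))
    (hρ' : ∀ h x : H, toDual ρ (h * x) = toDual ρ (x * antipode k (antipode k h)))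
    {Λ : U} (hΛ : ∀ u : U, u * Λ = counit (R := k) u • Λ)
    (x : GeneralizedDouble (dualCopMap f)) :
    x * ((skewPairing (dualCopMap f)).inl ρ * (skewPairing (dualCopMap f)).inr Λ) =
      counit (R := k) x •
        ((skewPairing (dualCopMap f)).inl ρ * (skewPairing (dualCopMap f)).inr Λ) := by
  set l := skewPairing (dualCopMap f)
  set t := l.inl ρ * l.inr Λ
  have hinl : ∀ φ, l.inl φ * t = counit (R := k) φ • t := by
    intro φ
    have h1 : φ * ρ = counit (R := k) φ • ρ := by
      ext x
      rw [toDual_mul _ _ (ℛ k x)]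
      have h2 := congr(toDual φ $(hρ x))
      simp only [map_sum, map_smul, smul_eq_mul] at h2
      simp only [mul_comm (toDual φ _), h2]
      simp [counit_apply, mul_comm]
    rw [← mul_assoc, ← map_mul, h1, map_smul, smul_mul_assoc]
  -- `N' h = ρ(- h) ⊗ Λ`
  let N' : H →ₗ[k] l.Double :=
    { toFun := fun h => l.inl (translateRight ρ h) * l.inr Λ
      map_add' := fun a b => by
        rw [← add_mul, ← map_add]
        congr 2
        ext x
        simp [toDual_translateRight, mul_add]
      map_smul' := fun c a => by
        rw [RingHom.id_apply, ← smul_mul_assoc, ← map_smul]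
        congr 2
        ext x
        simp [toDual_translateRight] }
  have hN' : ∀ h, N' h = l.inl (translateRight ρ h) * l.inr Λ := fun _ => rfl
  have hN'1 : N' 1 = t := by
    rw [hN']
    congr 2
    ext x
    simp [toDual_translateRight]
  -- the commutation rule for the functional `ρ(- h)`, together with `ρ(a x) = ρ(x S²(a))`
  have hrel : ∀ u h, ∑ j ∈ (ℛ k u).index, l.inr ((ℛ k u).left j) *
      N' (h * antipode k (antipode k (f ((ℛ k u).right j)))) = N' (f u * h) := by
    intro u h
    have h1 := congr($((crossed_dualCopMap_iff f l.inl l.inr).1 l.crossed_inl_inr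
      (translateRight ρ h) u) * l.inr Λ)
    simp only [Finset.sum_mul, mul_assoc, ← map_mul, hΛ] at h1
    have e1 : ∀ a, translateRight (translateRight ρ h) a = translateRight ρ (a * h) := by
      intro a; ext x; simp [toDual_translateRight, mul_assoc]
    have e2 : ∀ a, translateLeft (translateRight ρ h) a =
        translateRight ρ (h * antipode k (antipode k a)) := by
      intro a; ext x
      rw [toDual_translateLeft, toDual_translateRight, toDual_translateRight, mul_assoc, hρ',
        mul_assoc]
    simp only [e1, e2, map_smul, mul_smul_comm, ← hN'] at h1
    rw [← h1]
    conv_rhs => rw [← sum_smul_counit (ℛ k u)]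
    simp [Finset.sum_mul]
  have hinr : ∀ u, l.inr u * t = counit (R := k) u • t := by
    intro u
    have r := ℛ k u
    let G : U →ₗ[k] U →ₗ[k] U →ₗ[k] l.Double := LinearMap.mk₂ k
      (fun a b => LinearMap.mulLeft k (l.inr a) ∘ₗ N' ∘ₗ
        LinearMap.mulRight k (antipode k (antipode k (f b))) ∘ₗ antipode k ∘ₗ (f : U →ₗ[k] H))
      (by intros; ext; simp [add_mul]) (by intros; ext; simp)
      (by intros; ext; simp [mul_add]) (by intros; ext; simp)
    have hG : ∀ a b c, G a b c = l.inr a * N' (antipode k (f c) * antipode k (antipode k (f b))) :=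
      fun _ _ _ => rfl
    -- `u₁ N'(S(f(u₃)) S²(f(u₂)))` equals `u N'(1)` by the antipode axiom for `u₂` and `u₃`, and
    -- equals `N'(f(u₁) S(f(u₂))) = ε(u) N'(1)` by `hrel`
    have h1 := sum_coassoc G r (fun i => ℛ k (r.left i)) (fun i => ℛ k (r.right i))
    simp only [hG] at h1
    simp only [hrel] at h1
    have h2 : ∀ v, ∑ j ∈ (ℛ k v).index, antipode k (f ((ℛ k v).right j)) *
        antipode k (antipode k (f ((ℛ k v).left j))) = counit (R := k) v • (1 : H) := by
      intro v
      have h3 := congr(antipode k $(sum_antipode_mul_eq_smul ((ℛ k v).induced f)))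
      simpa [antipode_mul_antidistrib] using h3
    have h3 : ∑ j ∈ r.index, f (r.left j) * antipode k (f (r.right j)) =
        counit (R := k) u • (1 : H) := by
      have h3 := sum_mul_antipode_eq_smul (r.induced f)
      simpa using h3
    rw [← map_sum, h3, map_smul, hN'1] at h1
    rw [h1]
    simp only [← Finset.mul_sum, ← map_sum, h2, map_smul, hN'1]
    conv_lhs => rw [← sum_smul_counit r]
    simp [Finset.sum_mul]
  have hlin : LinearMap.mulRight k t = (LinearMap.toSpanSingleton k l.Double t) ∘ₗ counit := by
    refine l.double_ext fun φ u => ?_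
    simp only [LinearMap.mulRight_apply, LinearMap.comp_apply, LinearMap.toSpanSingleton_apply]
    rw [mul_assoc, hinr, mul_smul_comm, hinl, smul_smul, Bialgebra.counit_mul, l.counit_inl,
      l.counit_inr, mul_comm]
  exact LinearMap.congr_fun hlin x

/-- The generalized double of semisimple Hopf algebras is semisimple: the counit of the integral
`ρ ⊗ Λ` is `ρ(1)`, which does not vanish. -/
theorem isSemisimpleRing_generalizedDouble [IsAlgClosed k] [CharZero k] [IsSemisimpleRing U]
    [IsSemisimpleRing H] (f : U →ₐc[k] H) :
    IsSemisimpleRing (GeneralizedDouble (dualCopMap f)) := by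
  obtain ⟨ρ, hρ1, hρ, hρ'⟩ := exists_dual_integral (k := k) (A := H)
  obtain ⟨Λ, hΛ1, hΛ⟩ := exists_left_integral_counit_eq_one (k := k) (A := U)
  set l := skewPairing (dualCopMap f)
  set t := l.inl (toDual.symm ρ) * l.inr Λ
  have ht := mul_integral_eq f (ρ := toDual.symm ρ)
    (fun x => by simpa using hρ x (ℛ k x)) (by simpa using hρ') hΛ
  have hε : counit (R := k) t = ρ 1 := by
    rw [Bialgebra.counit_mul, l.counit_inl, l.counit_inr, hΛ1, mul_one, counit_apply,
      LinearEquiv.apply_symm_apply]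
  refine isSemisimpleRing_of_integral (k := k) (t := (ρ 1)⁻¹ • t) ?_ fun h => ?_
  · rw [map_smul, hε, smul_eq_mul, inv_mul_cancel₀ hρ1]
  · rw [mul_smul_comm, ht h, smul_comm]

end DualCopDouble

/-! ### Representations of a semisimple Hopf algebra -/

section InverseAntipode
open HopfAlgebra
variable {k : Type u} [Field k] {H : Type v} [Ring H] [HopfAlgebra k H] [Module.Finite k H]

lemma antipodeEquiv_symm_one : (antipodeEquiv k H).symm 1 = 1 := by
  rw [LinearEquiv.symm_apply_eq]
  exact antipode_one.symm

lemma antipodeEquiv_symm_mul (a b : H) : (antipodeEquiv k H).symm (a * b) =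
    (antipodeEquiv k H).symm b * (antipodeEquiv k H).symm a := by
  have h : ∀ y, antipodeEquiv k H y = antipode k y := fun y => rfl
  rw [LinearEquiv.symm_apply_eq, h, antipode_mul_antidistrib, ← h, ← h,
    LinearEquiv.apply_symm_apply, LinearEquiv.apply_symm_apply]

end InverseAntipode

section Fusion
open CategoryTheory MonoidalCategory Limits HopfAlgebra

namespace RepCat
variable {k : Type u} [Field k] {A : Type u} [Ring A]

section Algebra
variable [Algebra k A]

/-- The vector space of a representation, regarded as an `A`-module. -/
def Mod (X : RepCat k A) : Type u := X.V

instance (X : RepCat k A) : AddCommGroup X.Mod := X.addCommGroup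
instance (X : RepCat k A) : Module k X.Mod := X.module
instance (X : RepCat k A) : Module.Finite k X.Mod := X.finite
instance (X : RepCat k A) : Module A X.Mod :=
  Module.compHom X.V (X.ρ : A →+* Module.End k X.V)

lemma smul_mod_def (X : RepCat k A) (a : A) (x : X.Mod) : a • x = X.ρ a (x : X.V) := rfl

instance (X : RepCat k A) : IsScalarTower k A X.Mod :=
  ⟨fun c a x => by rw [smul_mod_def, map_smul]; rfl⟩

instance (X : RepCat k A) : Module.Finite A X.Mod :=
  Module.Finite.of_restrictScalars_finite k A X.Mod

/-- A morphism of representations as an `A`-linear map. -/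
def linMod {X Y : RepCat k A} (f : X ⟶ Y) : X.Mod →ₗ[A] Y.Mod where
  toFun := toLin f
  map_add' := map_add (toLin f)
  map_smul' a x := LinearMap.congr_fun (toLin_comm f a) x

variable (k A) in
/-- The functor from representations to finitely generated `A`-modules. -/
def toFG : RepCat k A ⥤ FGModuleCat.{u} A where
  obj X := FGModuleCat.of A X.Mod
  map f := FGModuleCat.ofHom (linMod f)

instance : (toFG k A).Faithful where
  map_injective {X Y f g} h := by
    have h1 : linMod f = linMod g := congrArg (fun t => t.hom.hom) h
    exact toLin_injective (LinearMap.ext fun x => congrArg (fun t => t x) h1)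

instance : (toFG k A).Full where
  map_surjective {X Y} g := by
    let g' : X.Mod →ₗ[A] Y.Mod := g.hom.hom
    have hg (a : A) (x : X.Mod) : g' (a • x) = a • g' x := g'.map_smul a x
    exact ⟨ofLin (X := X) (Y := Y) (g'.restrictScalars k) fun a => LinearMap.ext (hg a), rfl⟩

variable [Module.Finite k A]

instance : (toFG k A).EssSurj where
  mem_essImage M := by
    let _ : Module k M := Module.compHom M (algebraMap k A)
    have : IsScalarTower k A M := ⟨fun c a x => by
      rw [Algebra.smul_def, mul_smul]; rfl⟩
    have : Module.Finite k M := Module.Finite.trans A M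
    refine ⟨{ V := M, ρ := Algebra.lsmul k k M }, ⟨?_⟩⟩
    exact (LinearEquiv.toFGModuleCatIso
      { toFun := fun x => x, invFun := fun x => x, map_add' := fun _ _ => rfl,
        map_smul' := fun _ _ => rfl, left_inv := fun _ => rfl, right_inv := fun _ => rfl })

instance : (toFG k A).IsEquivalence where

instance : HasFiniteProducts (RepCat k A) :=
  haveI := IsNoetherianRing.of_finite k A
  ⟨fun _ => Adjunction.hasLimitsOfShape_of_equivalence (toFG k A)⟩

instance : Abelian (RepCat k A) :=
  haveI := IsNoetherianRing.of_finite k A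
  abelianOfEquivalence (toFG k A)

/-- The subrepresentation on an invariant subspace. -/
def sub (X : RepCat k A) (N : Submodule k X.V) (h : ∀ a, ∀ x ∈ N, X.ρ a x ∈ N) : RepCat k A where
  V := N
  ρ := AlgHom.ofLinearMap
    { toFun := fun a => (X.ρ a).restrict (h a)
      map_add' := fun a b => by ext; simp
      map_smul' := fun c a => by ext; simp }
    (by ext; simp) (fun a b => by ext; simp)

/-- The inclusion of a subrepresentation. -/
def subι (X : RepCat k A) (N : Submodule k X.V) (h : ∀ a, ∀ x ∈ N, X.ρ a x ∈ N) : X.sub N h ⟶ X :=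
  ofLin (X := X.sub N h) N.subtype fun _ => rfl

omit [Module.Finite k A] in
lemma ker_toLin_eq_bot {X Y : RepCat k A} (f : X ⟶ Y) [Mono f] : LinearMap.ker (toLin f) = ⊥ := by
  have hN : ∀ a, ∀ x ∈ LinearMap.ker (toLin f), X.ρ a x ∈ LinearMap.ker (toLin f) := by
    intro a x hx
    have h := LinearMap.congr_fun (toLin_comm f a) x
    rw [LinearMap.mem_ker] at hx ⊢
    simpa [hx] using h
  have h : X.subι _ hN = 0 := by
    rw [← cancel_mono f, zero_comp]
    exact toLin_injective (LinearMap.ext fun x => x.2)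
  rw [eq_bot_iff]
  intro x hx
  exact LinearMap.congr_fun (congrArg toLin h) ⟨x, hx⟩

omit [Module.Finite k A] in
/-- A representation without proper invariant subspaces is a simple object. -/
lemma simple_of_invariant (X : RepCat k A) [Nontrivial X.V]
    (hX : ∀ N : Submodule k X.V, (∀ a, ∀ x ∈ N, X.ρ a x ∈ N) → N = ⊥ ∨ N = ⊤) : Simple X where
  mono_isIso_iff_nonzero {Y} f _ := by
    constructor
    · rintro _ rfl
      have h : 𝟙 X = 0 := by rw [← IsIso.inv_hom_id (0 : Y ⟶ X), comp_zero]
      obtain ⟨x, hx⟩ := exists_ne (0 : X.V)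
      exact hx (LinearMap.congr_fun (congrArg toLin h) x)
    · intro hf
      have hr : LinearMap.range (toLin f) = ⊤ := by
        refine (hX _ ?_).resolve_left fun h => hf (toLin_injective (LinearMap.range_eq_bot.1 h))
        rintro a _ ⟨y, rfl⟩
        exact ⟨Y.ρ a y, LinearMap.congr_fun (toLin_comm f a) y⟩
      exact (isoMk (LinearEquiv.ofBijective (toLin f)
        ⟨LinearMap.ker_eq_bot.1 (ker_toLin_eq_bot f), LinearMap.range_eq_top.1 hr⟩)
        (toLin_comm f)).isIso_hom

instance (X Y : RepCat k A) : Module.Finite k (X ⟶ Y) :=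
  inferInstanceAs (Module.Finite k (homs X Y))

omit [Module.Finite k A] in
lemma toLin_sum {X Y : RepCat k A} {ι : Type*} (s : Finset ι) (f : ι → (X ⟶ Y)) :
    toLin (∑ i ∈ s, f i) = ∑ i ∈ s, toLin (f i) :=
  map_sum (homs X Y).subtype f s

omit [Module.Finite k A] in
lemma simple_sub_of_isSimpleModule (X : RepCat k A) (N : Submodule A X.Mod) [IsSimpleModule A N] :
    Simple (X.sub (N.restrictScalars k) fun a _ hx => N.smul_mem a hx) := by
  have : Nontrivial N := IsSimpleModule.nontrivial A N
  refine @simple_of_invariant _ _ _ _ _ _ ‹_› fun P hP => ?_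
  let Q : Submodule A N :=
    { carrier := {x | P.carrier x}, add_mem' := P.add_mem, zero_mem' := P.zero_mem, smul_mem' := hP }
  rcases eq_bot_or_eq_top Q with h | h
  · left
    exact SetLike.coe_injective (congrArg (fun T : Submodule A N => (T : Set N)) h)
  · right
    exact SetLike.coe_injective (congrArg (fun T : Submodule A N => (T : Set N)) h)

omit [Module.Finite k A] in
/-- Every representation is a direct sum of simple ones; the splitting `∑ πᵢ ≫ ιᵢ = 𝟙` makes the
bicone a biproduct. -/
lemma exists_simple_bicone [IsSemisimpleRing A] (X : RepCat k A) :
    ∃ (n : ℕ) (S : Fin n → RepCat k A) (b : Bicone S),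
      (∀ i, Simple (S i)) ∧ ∑ i, b.π i ≫ b.ι i = 𝟙 b.pt ∧ b.pt = X := by
  obtain ⟨n, N, e, hN⟩ := IsSemisimpleModule.exists_linearEquiv_fin_dfinsupp A X.Mod
  let S : Fin n → RepCat k A := fun i =>
    X.sub ((N i).restrictScalars k) fun a _ hx => (N i).smul_mem a hx
  let π : ∀ i, X ⟶ S i := fun i => ofLin (X := X) (Y := S i)
    (((DFinsupp.lapply i : (Π₀ i, N i) →ₗ[A] N i) ∘ₗ e.toLinearMap).restrictScalars k)
    fun a => LinearMap.ext fun x =>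
      ((DFinsupp.lapply i : (Π₀ i, N i) →ₗ[A] N i) ∘ₗ e.toLinearMap).map_smul a (x : X.Mod)
  let ι' : ∀ i, N i →ₗ[A] X.Mod := fun i =>
    e.symm.toLinearMap ∘ₗ DFinsupp.lsingle (R := A) (M := fun i => N i) i
  let ι : ∀ i, S i ⟶ X := fun i => ofLin (X := S i) (Y := X) ((ι' i).restrictScalars k)
    fun a => LinearMap.ext fun x => (ι' i).map_smul a x
  have hιπ : ∀ i j (x : N i), toLin (ι i ≫ π j) x = (DFinsupp.single i x : Π₀ i, N i) j := fun i j x =>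
    congrArg (fun t : Π₀ i, N i => t j) (e.apply_symm_apply (DFinsupp.single i x))
  refine ⟨n, S, ⟨X, π, ι, fun i j => ?_⟩, fun i => ?_, ?_, rfl⟩
  · refine toLin_injective (LinearMap.ext fun x => ?_)
    refine (hιπ i j x).trans ?_
    split_ifs with h
    · subst h
      exact DFinsupp.single_eq_same
    · exact DFinsupp.single_eq_of_ne (Ne.symm h)
  · have := hN i
    exact simple_sub_of_isSimpleModule X (N i)
  · refine toLin_injective (LinearMap.ext fun x => ?_)
    have h1 : ∀ y : Π₀ i, N i, ∑ i, e.symm (DFinsupp.single i (y i)) = e.symm y := by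
      intro y
      rw [← map_sum]
      congr 1
      ext i : 1
      simp [DFinsupp.single_apply]
    have h2 := (h1 (e x)).trans (e.symm_apply_apply x)
    refine Eq.trans ?_ h2
    exact (LinearMap.congr_fun (toLin_sum Finset.univ fun i => π i ≫ ι i) x).trans
      (LinearMap.sum_apply _ _ _)

/-- The regular representation. -/
def regular (k A : Type u) [Field k] [Ring A] [Algebra k A] [Module.Finite k A] : RepCat k A where
  V := A
  ρ := Algebra.lmul k A

/-- The morphism `a ↦ a x` from the regular representation. -/
def orbit (X : RepCat k A) (x : X.V) : regular k A ⟶ X :=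
  ofLin (X := regular k A) (X.ρ.toLinearMap.flip x) fun a => by
    refine LinearMap.ext fun (b : A) => ?_
    exact LinearMap.congr_fun (map_mul X.ρ a b) x

omit [Module.Finite k A] in
lemma exists_ne_zero_of_simple (X : RepCat k A) [Simple X] : ∃ x : X.V, x ≠ 0 := by
  by_contra! h
  exact id_nonzero X (toLin_injective (LinearMap.ext h))

lemma exists_finite_simples [IsSemisimpleRing A] :
    ∃ (n : ℕ) (S : Fin n → RepCat k A), ∀ X : RepCat k A, Simple X → ∃ i, Nonempty (X ≅ S i) := by
  -- a simple object receives a nonzero morphism from the regular representation, hence is isomorphic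
  -- to one of the simple summands of the latter
  obtain ⟨n, S, b, hS, hb, hpt⟩ := exists_simple_bicone (regular k A)
  refine ⟨n, S, fun X hX => ?_⟩
  obtain ⟨x, hx⟩ := exists_ne_zero_of_simple X
  by_contra! h
  have h1 : ∀ g : b.pt ⟶ X, g = 0 := by
    intro g
    rw [← Category.id_comp g, ← hb, Preadditive.sum_comp]
    refine Finset.sum_eq_zero fun i _ => ?_
    have := hS i
    have h2 : b.ι i ≫ g = 0 := by
      by_contra h3
      have := isIso_of_hom_simple h3
      exact (h i).false (asIso (b.ι i ≫ g)).symm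
    rw [Category.assoc, h2, comp_zero]
  have h2 := congrArg toLin (h1 (eqToHom hpt ≫ orbit X x))
  have h3 : orbit X x = 0 := by
    rw [← cancel_epi (eqToHom hpt), comp_zero]
    exact h1 _
  have h4 : X.ρ 1 x = 0 := LinearMap.congr_fun (congrArg toLin h3) (1 : A)
  rw [map_one] at h4
  exact hx h4

end Algebra

section Rigid
variable [HopfAlgebra k A]

section Action
variable {V : Type*} [AddCommGroup V] [Module k V]

/-- The action `(a φ)(x) = φ(T(a) x)` on the dual space, for an antiautomorphism `T`. -/
def dualAct (ρ : A →ₐ[k] Module.End k V) (T : A →ₗ[k] A) (h1 : T 1 = 1)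
    (hT : ∀ a b, T (a * b) = T b * T a) : A →ₐ[k] Module.End k (Module.Dual k V) :=
  AlgHom.ofLinearMap (Module.Dual.transpose (R := k) (M := V) (M' := V) ∘ₗ ρ.toLinearMap ∘ₗ T)
    (by
      refine LinearMap.ext fun φ => LinearMap.ext fun x => ?_
      simp [h1, Module.Dual.transpose_apply])
    (fun a b => by
      refine LinearMap.ext fun φ => LinearMap.ext fun x => ?_
      simp [hT, Module.Dual.transpose_apply])

variable (ρ : A →ₐ[k] Module.End k V) (T : A →ₗ[k] A) (h1 : T 1 = 1)
  (hT : ∀ a b, T (a * b) = T b * T a)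

lemma dualAct_apply (a : A) (φ : Module.Dual k V) : dualAct ρ T h1 hT a φ = φ ∘ₗ ρ (T a) := rfl

lemma contractLeft_tensorAct
    (h : ∀ a, ∑ i ∈ (ℛ k a).index, T ((ℛ k a).left i) * (ℛ k a).right i = counit (R := k) a • 1)
    (a : A) :
    contractLeft k V ∘ₗ tensorAct (dualAct ρ T h1 hT) ρ a =
      unitAct k A a ∘ₗ contractLeft k V := by
  refine TensorProduct.ext' fun φ x => ?_
  have h2 := congr(φ (ρ $(h a) x))
  simp only [map_sum, map_mul, map_smul, map_one, LinearMap.sum_apply, LinearMap.smul_apply] at h2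
  simpa [tensorAct_tmul _ _ (ℛ k a), dualAct_apply, unitAct_apply] using h2

lemma contractRight_tensorAct
    (h : ∀ a, ∑ i ∈ (ℛ k a).index, T ((ℛ k a).right i) * (ℛ k a).left i = counit (R := k) a • 1)
    (a : A) :
    contractRight k V ∘ₗ tensorAct ρ (dualAct ρ T h1 hT) a =
      unitAct k A a ∘ₗ contractRight k V := by
  refine TensorProduct.ext' fun x φ => ?_
  have h2 := congr(φ (ρ $(h a) x))
  simp only [map_sum, map_mul, map_smul, map_one, LinearMap.sum_apply, LinearMap.smul_apply] at h2
  simpa [tensorAct_tmul _ _ (ℛ k a), dualAct_apply, unitAct_apply] using h2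

variable [Module.Finite k V]

/-- The canonical element `∑ bᵢ ⊗ bⁱ` of `V ⊗ V^*`, written in the chosen basis of `V`. -/
def canonicalElem (k V : Type*) [Field k] [AddCommGroup V] [Module k V] [Module.Finite k V] :
    V ⊗[k] Module.Dual k V :=
  ∑ i, Module.finBasis k V i ⊗ₜ[k] (Module.finBasis k V).coord i

/-- Elements of `V ⊗ V^*` may be compared as endomorphisms of `V`. -/
lemma tmul_dual_ext {z z' : V ⊗[k] Module.Dual k V}
    (h : dualTensorHom k V V (TensorProduct.comm k _ _ z) =
      dualTensorHom k V V (TensorProduct.comm k _ _ z')) : z = z' :=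
  (TensorProduct.comm k _ _).injective
    ((dualTensorHomEquiv k V V).injective (by simpa using h))

lemma dualTensorHom_canonicalElem :
    dualTensorHom k V V (TensorProduct.comm k _ _ (canonicalElem k V)) = LinearMap.id := by
  ext x
  simp [canonicalElem, (Module.finBasis k V).sum_repr x]

lemma sum_map_dualMap_canonicalElem {ι : Type*} (s : Finset ι) (F G : ι → Module.End k V) (c : k)
    (h : ∑ i ∈ s, F i * G i = c • 1) :
    ∑ i ∈ s, TensorProduct.map (F i) (G i).dualMap (canonicalElem k V) =
      c • canonicalElem k V := by
  apply tmul_dual_ext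
  have h2 : ∀ F G : Module.End k V, ∀ z : V ⊗[k] Module.Dual k V,
      dualTensorHom k V V (TensorProduct.comm k _ _ (TensorProduct.map F G.dualMap z)) =
        F ∘ₗ dualTensorHom k V V (TensorProduct.comm k _ _ z) ∘ₗ G := by
    intro F G z
    induction z with
    | zero => simp
    | add z z' hz hz' => simp only [map_add, hz, hz', LinearMap.add_comp, LinearMap.comp_add]
    | tmul y φ => ext x; simp
  simp only [map_sum, h2, map_smul, dualTensorHom_canonicalElem]
  exact h

lemma tensorAct_canonicalElem
    (h : ∀ a, ∑ i ∈ (ℛ k a).index, (ℛ k a).left i * T ((ℛ k a).right i) = counit (R := k) a • 1)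
    (a : A) :
    tensorAct ρ (dualAct ρ T h1 hT) a (canonicalElem k V) = counit (R := k) a • canonicalElem k V := by
  rw [← sum_map_dualMap_canonicalElem (ℛ k a).index (fun i => ρ ((ℛ k a).left i))
    (fun i => ρ (T ((ℛ k a).right i)))]
  · simp only [canonicalElem, map_sum]
    rw [Finset.sum_comm]
    exact Finset.sum_congr rfl fun i _ => tensorAct_tmul _ _ (ℛ k a) _ _
  · simpa using congrArg ρ (h a)

lemma tensorAct_comm_canonicalElem
    (h : ∀ a, ∑ i ∈ (ℛ k a).index, (ℛ k a).right i * T ((ℛ k a).left i) = counit (R := k) a • 1)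
    (a : A) :
    tensorAct (dualAct ρ T h1 hT) ρ a (TensorProduct.comm k _ _ (canonicalElem k V)) =
      counit (R := k) a • TensorProduct.comm k _ _ (canonicalElem k V) := by
  rw [← map_smul, ← sum_map_dualMap_canonicalElem (ℛ k a).index (fun i => ρ ((ℛ k a).right i))
    (fun i => ρ (T ((ℛ k a).left i)))]
  · simp only [canonicalElem, map_sum, TensorProduct.map_tmul, TensorProduct.comm_tmul]
    rw [Finset.sum_comm]
    exact Finset.sum_congr rfl fun i _ => tensorAct_tmul _ _ (ℛ k a) _ _
  · simpa using congrArg ρ (h a)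

variable (k V) in
/-- The linear map `k → V ⊗ V^*` sending `1` to the canonical element. -/
def coev : k →ₗ[k] V ⊗[k] Module.Dual k V := LinearMap.toSpanSingleton k _ (canonicalElem k V)

variable (k V) in
/-- The linear map `k → V^* ⊗ V` sending `1` to the canonical element. -/
def coevLeft : k →ₗ[k] Module.Dual k V ⊗[k] V :=
  (TensorProduct.comm k V (Module.Dual k V)).toLinearMap ∘ₗ coev k V

lemma coev_tensorAct
    (h : ∀ a, ∑ i ∈ (ℛ k a).index, (ℛ k a).left i * T ((ℛ k a).right i) = counit (R := k) a • 1)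
    (a : A) :
    coev k V ∘ₗ unitAct k A a = tensorAct ρ (dualAct ρ T h1 hT) a ∘ₗ coev k V := by
  refine LinearMap.ext_ring ?_
  simp [coev, unitAct_apply, tensorAct_canonicalElem ρ T h1 hT h a]

lemma coevLeft_tensorAct
    (h : ∀ a, ∑ i ∈ (ℛ k a).index, (ℛ k a).right i * T ((ℛ k a).left i) = counit (R := k) a • 1)
    (a : A) :
    coevLeft k V ∘ₗ unitAct k A a = tensorAct (dualAct ρ T h1 hT) ρ a ∘ₗ coevLeft k V := by
  refine LinearMap.ext_ring ?_
  simp [coevLeft, coev, unitAct_apply, tensorAct_comm_canonicalElem ρ T h1 hT h a]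

lemma sum_coord_smul (x : V) :
    ∑ i, (Module.finBasis k V).coord i x • Module.finBasis k V i = x := by
  simp [(Module.finBasis k V).sum_repr x]

lemma sum_smul_coord (φ : Module.Dual k V) :
    ∑ i, φ (Module.finBasis k V i) • (Module.finBasis k V).coord i = φ :=
  (Module.finBasis k V).ext fun j => by
    simp

lemma triangle_coev_contractLeft (φ : Module.Dual k V) (c : k) :
    TensorProduct.map (contractLeft k V) (LinearMap.id : Module.Dual k V →ₗ[k] Module.Dual k V)
      ((TensorProduct.assoc k _ _ _).symm (TensorProduct.map
        (LinearMap.id : Module.Dual k V →ₗ[k] Module.Dual k V) (coev k V) (φ ⊗ₜ c))) =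
      (TensorProduct.lid k _).symm (TensorProduct.rid k _ (φ ⊗ₜ c)) := by
  rw [← (TensorProduct.lid k _).injective.eq_iff]
  conv_rhs => rw [LinearEquiv.apply_symm_apply, TensorProduct.rid_tmul]
  simp only [coev, canonicalElem, TensorProduct.map_tmul, TensorProduct.tmul_sum, map_sum,
    LinearMap.toSpanSingleton_apply, TensorProduct.tmul_smul, map_smul,
    TensorProduct.assoc_symm_tmul, contractLeft_apply, LinearMap.id_apply,
    TensorProduct.lid_tmul, sum_smul_coord]

lemma triangle_contractLeft_coev (c : k) (x : V) :
    TensorProduct.map (LinearMap.id : V →ₗ[k] V) (contractLeft k V)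
      (TensorProduct.assoc k _ _ _ (TensorProduct.map (coev k V) (LinearMap.id : V →ₗ[k] V)
        (c ⊗ₜ x))) = (TensorProduct.rid k _).symm (TensorProduct.lid k _ (c ⊗ₜ x)) := by
  rw [← (TensorProduct.rid k _).injective.eq_iff]
  conv_rhs => rw [LinearEquiv.apply_symm_apply, TensorProduct.lid_tmul]
  simp only [coev, canonicalElem, TensorProduct.map_tmul, TensorProduct.sum_tmul, map_sum,
    LinearMap.toSpanSingleton_apply, ← TensorProduct.smul_tmul', map_smul,
    TensorProduct.assoc_tmul, contractLeft_apply, LinearMap.id_apply,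
    TensorProduct.rid_tmul, sum_coord_smul]

lemma triangle_coevLeft_contractRight (x : V) (c : k) :
    TensorProduct.map (contractRight k V) (LinearMap.id : V →ₗ[k] V)
      ((TensorProduct.assoc k _ _ _).symm (TensorProduct.map
        (LinearMap.id : V →ₗ[k] V) (coevLeft k V) (x ⊗ₜ c))) =
      (TensorProduct.lid k _).symm (TensorProduct.rid k _ (x ⊗ₜ c)) := by
  rw [← (TensorProduct.lid k _).injective.eq_iff]
  conv_rhs => rw [LinearEquiv.apply_symm_apply, TensorProduct.rid_tmul]
  simp only [coevLeft, coev, canonicalElem, TensorProduct.map_tmul, TensorProduct.tmul_sum, map_sum,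
    LinearMap.comp_apply, LinearEquiv.coe_coe, TensorProduct.comm_tmul,
    LinearMap.toSpanSingleton_apply, TensorProduct.tmul_smul, map_smul,
    TensorProduct.assoc_symm_tmul, contractRight_apply, LinearMap.id_apply,
    TensorProduct.lid_tmul, sum_coord_smul]

lemma triangle_contractRight_coevLeft (c : k) (φ : Module.Dual k V) :
    TensorProduct.map (LinearMap.id : Module.Dual k V →ₗ[k] Module.Dual k V)
      (contractRight k V) (TensorProduct.assoc k _ _ _ (TensorProduct.map (coevLeft k V)
        (LinearMap.id : Module.Dual k V →ₗ[k] Module.Dual k V) (c ⊗ₜ φ))) =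
      (TensorProduct.rid k _).symm (TensorProduct.lid k _ (c ⊗ₜ φ)) := by
  rw [← (TensorProduct.rid k _).injective.eq_iff]
  conv_rhs => rw [LinearEquiv.apply_symm_apply, TensorProduct.lid_tmul]
  simp only [coevLeft, coev, canonicalElem, TensorProduct.map_tmul, TensorProduct.sum_tmul, map_sum,
    LinearMap.comp_apply, LinearEquiv.coe_coe, TensorProduct.comm_tmul,
    LinearMap.toSpanSingleton_apply, ← TensorProduct.smul_tmul', map_smul,
    TensorProduct.assoc_tmul, contractRight_apply, LinearMap.id_apply,
    TensorProduct.rid_tmul, sum_smul_coord]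

end Action

/-- The dual space with the action `(a φ)(x) = φ(T(a) x)`, for an antiautomorphism `T`. -/
def dualRep (X : RepCat k A) (T : A →ₗ[k] A) (h1 : T 1 = 1) (hT : ∀ a b, T (a * b) = T b * T a) :
    RepCat k A where
  V := Module.Dual k X.V
  ρ := dualAct X.ρ T h1 hT

section ExactPairing
variable (X : RepCat k A) (T : A →ₗ[k] A) (h1 : T 1 = 1) (hT : ∀ a b, T (a * b) = T b * T a)

/-- The dual space is a right dual if `a₁ T(a₂) = ε(a) = T(a₁) a₂`. -/
abbrev exactPairingDual
    (hc : ∀ a, ∑ i ∈ (ℛ k a).index, (ℛ k a).left i * T ((ℛ k a).right i) = counit (R := k) a • 1)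
    (he : ∀ a, ∑ i ∈ (ℛ k a).index, T ((ℛ k a).left i) * (ℛ k a).right i = counit (R := k) a • 1) :
    ExactPairing X (X.dualRep T h1 hT) where
  coevaluation' := ofLin (X := 𝟙_ (RepCat k A)) (Y := X ⊗ X.dualRep T h1 hT) (coev k X.V)
    (coev_tensorAct X.ρ T h1 hT hc)
  evaluation' := ofLin (X := X.dualRep T h1 hT ⊗ X) (Y := 𝟙_ (RepCat k A))
    (contractLeft k X.V) (contractLeft_tensorAct X.ρ T h1 hT he)
  coevaluation_evaluation' := toLin_injective
    (TensorProduct.ext' (triangle_coev_contractLeft (V := X.V)))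
  evaluation_coevaluation' := toLin_injective
    (TensorProduct.ext' (triangle_contractLeft_coev (V := X.V)))

/-- The dual space is a left dual if `a₂ T(a₁) = ε(a) = T(a₂) a₁`. -/
abbrev exactPairingDualLeft
    (hc : ∀ a, ∑ i ∈ (ℛ k a).index, (ℛ k a).right i * T ((ℛ k a).left i) = counit (R := k) a • 1)
    (he : ∀ a, ∑ i ∈ (ℛ k a).index, T ((ℛ k a).right i) * (ℛ k a).left i = counit (R := k) a • 1) :
    ExactPairing (X.dualRep T h1 hT) X where
  coevaluation' := ofLin (X := 𝟙_ (RepCat k A)) (Y := X.dualRep T h1 hT ⊗ X) (coevLeft k X.V)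
    (coevLeft_tensorAct X.ρ T h1 hT hc)
  evaluation' := ofLin (X := X ⊗ X.dualRep T h1 hT) (Y := 𝟙_ (RepCat k A))
    (contractRight k X.V) (contractRight_tensorAct X.ρ T h1 hT he)
  coevaluation_evaluation' := toLin_injective
    (TensorProduct.ext' (triangle_coevLeft_contractRight (V := X.V)))
  evaluation_coevaluation' := toLin_injective
    (TensorProduct.ext' (triangle_contractRight_coevLeft (V := X.V)))

end ExactPairing

/-- The right and left duals are the dual space, with `A` acting through the antipode and through its
inverse. -/
lemma nonempty_rigidCategory [Module.Finite k A] : Nonempty (RigidCategory (RepCat k A)) := by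
  exact ⟨{
    rightDual := fun X => @HasRightDual.mk _ _ _ X
      (X.dualRep (antipode k) antipode_one fun a b => antipode_mul_antidistrib a b)
      (exactPairingDual X (antipode k) _ _ (fun _ => sum_mul_antipode_eq_smul _)
        fun _ => sum_antipode_mul_eq_smul _)
    leftDual := fun X => @HasLeftDual.mk _ _ _ X (X.dualRep (antipodeEquiv k A).symm.toLinearMap
        antipodeEquiv_symm_one antipodeEquiv_symm_mul)
      (exactPairingDualLeft X (antipodeEquiv k A).symm.toLinearMap _ _
        (fun _ => DualCop.sum_mul_antipodeEquiv_symm _)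
        fun _ => DualCop.sum_antipodeEquiv_symm_mul _) }⟩

end Rigid

section Fusion
variable [HopfAlgebra k A]

instance : Simple (𝟙_ (RepCat k A)) := by
  have : Nontrivial (𝟙_ (RepCat k A)).V := inferInstanceAs (Nontrivial k)
  exact simple_of_invariant _ fun N _ => eq_bot_or_eq_top (α := Submodule k k) N

variable (k A) in
/-- The representations of a finite-dimensional semisimple Hopf algebra form a fusion category. -/
theorem isFusionCategory [Module.Finite k A] [IsSemisimpleRing A] :
    IsFusionCategory k (RepCat k A) where
  monoidalPreadditive := inferInstance
  monoidalLinear := inferInstance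
  hasFiniteProducts := inferInstance
  hasKernels := inferInstance
  hasCokernels := inferInstance
  isNormalMonoCategory := inferInstance
  isNormalEpiCategory := inferInstance
  rigid := nonempty_rigidCategory
  finite_hom := inferInstance
  simple_unit := inferInstance
  finite_simple := exists_finite_simples
  semisimple X := by
    obtain ⟨n, S, b, hS, hb, rfl⟩ := exists_simple_bicone X
    exact ⟨n, S, b, hS, ⟨isBilimitOfTotal b hb⟩, ⟨Iso.refl _⟩⟩

end Fusion
end RepCat
end Fusion

/-! ### Transport of fusion categories along equivalences -/

section FusionTransport
open CategoryTheory MonoidalCategory Limits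

/-- A linear monoidal category that is equivalent to a fusion category is a fusion category. -/
theorem IsFusionCategory.of_equivalence {k : Type u} [Field k] {C : Type u₁} [Category.{v₁} C]
    [Preadditive C] [Linear k C] [MonoidalCategory C] {D : Type u₂} [Category.{v₂} D]
    [Preadditive D] [Linear k D] [MonoidalCategory D] [MonoidalPreadditive D]
    [MonoidalLinear k D] (e : C ≌ D) [e.functor.Monoidal] [e.functor.Additive]
    [e.functor.Linear k] (h : IsFusionCategory k C) : IsFusionCategory k D := by
  have := h.hasFiniteProducts
  have := h.hasKernels
  have := h.hasCokernels
  have := h.isNormalMonoCategory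
  have := h.isNormalEpiCategory
  let _ : Abelian C := { }
  have hD : HasFiniteProducts D :=
    ⟨fun _ => Adjunction.hasLimitsOfShape_of_equivalence e.inverse⟩
  let _ : Abelian D := abelianOfEquivalence e.inverse
  refine
    { monoidalPreadditive := inferInstance
      monoidalLinear := inferInstance
      hasFiniteProducts := inferInstance
      hasKernels := inferInstance
      hasCokernels := inferInstance
      isNormalMonoCategory := inferInstance
      isNormalEpiCategory := inferInstance
      rigid := ?_
      finite_hom := fun X Y => ?_
      simple_unit := ?_
      finite_simple := ?_
      semisimple := fun X => ?_ }
  · obtain ⟨_⟩ := h.rigid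
    let _ : e.inverse.Monoidal := e.inverseMonoidal
    exact ⟨rigidCategoryOfEquivalence e.symm.toAdjunction⟩
  · have := h.finite_hom (e.inverse.obj X) (e.inverse.obj Y)
    exact Module.Finite.of_injective (e.inverse.mapLinearMap k) e.inverse.map_injective
  · have := h.simple_unit
    have := simple_obj e.functor (𝟙_ C)
    exact Simple.of_iso (Functor.Monoidal.εIso e.functor)
  · obtain ⟨n, S, hS⟩ := h.finite_simple
    refine ⟨n, fun i => e.functor.obj (S i), fun X hX => ?_⟩
    obtain ⟨i, ⟨j⟩⟩ := hS (e.inverse.obj X) (simple_obj e.inverse X)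
    exact ⟨i, ⟨(e.counitIso.app X).symm ≪≫ e.functor.mapIso j⟩⟩
  · obtain ⟨n, S, b, hS, ⟨hb⟩, ⟨j⟩⟩ := h.semisimple (e.inverse.obj X)
    refine ⟨n, e.functor.obj ∘ S, e.functor.mapBicone b, fun i => ?_, ⟨?_⟩,
      ⟨(e.counitIso.app X).symm ≪≫ e.functor.mapIso j⟩⟩
    · have := hS i
      exact simple_obj e.functor (S i)
    · refine isBilimitOfTotal _ ?_
      have h1 := congrArg e.functor.map (IsBilimit.total hb)
      simp only [Functor.map_sum, Functor.map_comp] at h1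
      exact h1.trans (e.functor.map_id _)

end FusionTransport

/-! ### Actions of the dual as tensors over the Hopf algebra -/

section Coaction
open HopfAlgebra DualCop WithConv
variable {k : Type u} [Field k] {H : Type v} [Ring H] [HopfAlgebra k H] [Module.Finite k H]

section Slice
variable {W : Type*} [AddCommGroup W] [Module k W]

variable (k H) in
/-- The basis of `H^{* cop}` dual to the chosen basis of `H`. -/
def dualCoord (i : Fin (Module.finrank k H)) : DualCop k H :=
  toDual.symm ((Module.finBasis k H).coord i)

lemma sum_toDual_smul_dualCoord (φ : DualCop k H) :
    ∑ i, toDual φ (Module.finBasis k H i) • dualCoord k H i = φ := by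
  apply toDual.injective
  simp [dualCoord]

lemma sum_dualCoord_smul (x : H) :
    ∑ i, toDual (dualCoord k H i) x • Module.finBasis k H i = x := by
  simp [dualCoord, (Module.finBasis k H).sum_repr x]

/-- Contraction of the first factor of `H ⊗ W` with a functional. -/
def slice (φ : DualCop k H) : H ⊗[k] W →ₗ[k] W :=
  (TensorProduct.lid k W).toLinearMap ∘ₗ (toDual φ).rTensor W

omit [Module.Finite k H] in
lemma slice_tmul (φ : DualCop k H) (h : H) (w : W) : slice φ (h ⊗ₜ[k] w) = toDual φ h • w := by
  simp [slice]

lemma sum_tmul_slice (z : H ⊗[k] W) :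
    ∑ i, Module.finBasis k H i ⊗ₜ[k] slice (dualCoord k H i) z = z := by
  induction z with
  | zero => simp
  | add x y hx hy => simp only [map_add, TensorProduct.tmul_add, Finset.sum_add_distrib, hx, hy]
  | tmul h w =>
    simp only [slice_tmul, ← TensorProduct.smul_tmul, ← TensorProduct.sum_tmul, sum_dualCoord_smul]

lemma slice_ext {z z' : H ⊗[k] W} (h : ∀ φ : DualCop k H, slice φ z = slice φ z') : z = z' := by
  rw [← sum_tmul_slice z, ← sum_tmul_slice z']
  simp only [h]

/-- The element `∑ hᵢ ⊗ a(hⁱ)` of `H ⊗ W` corresponding to a linear map `a : H^* → W`, for dual bases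
`hᵢ` and `hⁱ`. -/
def canonTensor (a : DualCop k H →ₗ[k] W) : H ⊗[k] W :=
  ∑ i, Module.finBasis k H i ⊗ₜ[k] a (dualCoord k H i)

lemma slice_canonTensor (a : DualCop k H →ₗ[k] W) (φ : DualCop k H) :
    slice φ (canonTensor a) = a φ := by
  simp only [canonTensor, map_sum, slice_tmul, ← map_smul]
  rw [← map_sum, sum_toDual_smul_dualCoord]

/-- The comultiplication of `H` is dual to the multiplication of `H^*`. -/
lemma sum_comul_tmul_dualCoord :
    ∑ i, comul (R := k) (Module.finBasis k H i) ⊗ₜ[k] dualCoord k H i =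
      ∑ i, ∑ j, (Module.finBasis k H i ⊗ₜ[k] Module.finBasis k H j) ⊗ₜ[k]
        (dualCoord k H i * dualCoord k H j) := by
  have h1 : ∀ i j, dualCoord k H i * dualCoord k H j = ∑ m, (∑ l ∈ (ℛ k (Module.finBasis k H m)).index,
      toDual (dualCoord k H i) ((ℛ k (Module.finBasis k H m)).left l) *
        toDual (dualCoord k H j) ((ℛ k (Module.finBasis k H m)).right l)) • dualCoord k H m := by
    intro i j
    simp only [← toDual_mul _ _ (ℛ k _)]
    rw [sum_toDual_smul_dualCoord]
  simp only [h1, TensorProduct.tmul_sum, TensorProduct.tmul_smul, TensorProduct.smul_tmul']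
  rw [Finset.sum_congr rfl fun i _ => Finset.sum_comm, Finset.sum_comm]
  refine Finset.sum_congr rfl fun m _ => ?_
  simp only [← TensorProduct.sum_tmul]
  congr 1
  conv_lhs => rw [← (ℛ k (Module.finBasis k H m)).eq]
  have h2 : ∀ x y : H, x ⊗ₜ[k] y = ∑ i, ∑ j, (toDual (dualCoord k H i) x *
      toDual (dualCoord k H j) y) • (Module.finBasis k H i ⊗ₜ[k] Module.finBasis k H j) := by
    intro x y
    conv_lhs => rw [← sum_dualCoord_smul (k := k) x, ← sum_dualCoord_smul (k := k) y,
      TensorProduct.sum_tmul]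
    simp only [TensorProduct.tmul_sum, TensorProduct.smul_tmul_smul]
  simp only [Finset.sum_smul]
  rw [Finset.sum_congr rfl fun l _ => h2 _ _, Finset.sum_comm]
  refine Finset.sum_congr rfl fun i _ => ?_
  rw [Finset.sum_comm]
  refine Finset.sum_congr rfl fun j _ => ?_
  simp only [TensorProduct.sum_tmul, TensorProduct.smul_tmul']

/-- The multiplication of `H` is dual to the comultiplication of `H^{* cop}`. -/
lemma sum_tmul_comul_dualCoord :
    ∑ i, Module.finBasis k H i ⊗ₜ[k] comul (R := k) (dualCoord k H i) =
      ∑ i, ∑ j, (Module.finBasis k H j * Module.finBasis k H i) ⊗ₜ[k]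
        (dualCoord k H i ⊗ₜ[k] dualCoord k H j) := by
  have h1 : ∀ i j, Module.finBasis k H j * Module.finBasis k H i =
      ∑ m, toDual (dualCoord k H m) (Module.finBasis k H j * Module.finBasis k H i) •
        Module.finBasis k H m := fun i j => (sum_dualCoord_smul _).symm
  rw [Finset.sum_congr rfl fun i _ => Finset.sum_congr rfl fun j _ => by
    rw [h1 i j, TensorProduct.sum_tmul]]
  rw [Finset.sum_congr rfl fun i _ => Finset.sum_comm, Finset.sum_comm]
  refine Finset.sum_congr rfl fun m _ => ?_
  simp only [TensorProduct.smul_tmul, ← TensorProduct.tmul_sum]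
  congr 1
  apply pairing.injective
  refine TensorProduct.ext' fun x y => ?_
  rw [pairing_comul]
  simp only [map_sum, map_smul, LinearMap.sum_apply, LinearMap.smul_apply]
  conv_lhs => rw [← sum_dualCoord_smul (k := k) x, ← sum_dualCoord_smul (k := k) y]
  simp [Finset.sum_mul_sum]
  rw [Finset.sum_comm]
  refine Finset.sum_congr rfl fun i _ => Finset.sum_congr rfl fun j _ => ?_
  ring

end Slice

section Antipode

lemma toDual_antipode (φ : DualCop k H) (x : H) :
    toDual (antipode k φ) x = toDual φ ((antipodeEquiv k H).symm x) := rfl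

lemma toDual_antipodeEquiv_symm (φ : DualCop k H) (x : H) :
    toDual ((antipodeEquiv k (DualCop k H)).symm φ) x = toDual φ (antipode k x) := by
  obtain ⟨ψ, rfl⟩ := (antipodeEquiv k (DualCop k H)).surjective φ
  rw [LinearEquiv.symm_apply_apply]
  have h : antipodeEquiv k (DualCop k H) ψ = antipode k ψ := rfl
  rw [h, toDual_antipode]
  exact congrArg (toDual ψ) ((antipodeEquiv k H).symm_apply_apply x).symm

lemma comul_antipodeEquiv_symm (φ : DualCop k H) :
    comul (R := k) ((antipodeEquiv k (DualCop k H)).symm φ) =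
      TensorProduct.map (antipodeEquiv k (DualCop k H)).symm.toLinearMap
        (antipodeEquiv k (DualCop k H)).symm.toLinearMap (TensorProduct.comm k _ _ (comul φ)) := by
  apply pairing.injective
  refine TensorProduct.ext' fun x y => ?_
  have h : ∀ w : DualCop k H ⊗[k] DualCop k H,
      pairing (TensorProduct.map (antipodeEquiv k (DualCop k H)).symm.toLinearMap
        (antipodeEquiv k (DualCop k H)).symm.toLinearMap (TensorProduct.comm k _ _ w)) (x ⊗ₜ[k] y) =
      pairing w (antipode k y ⊗ₜ[k] antipode k x) := by
    intro w
    induction w with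
    | zero => simp
    | add a b ha hb => simp only [map_add, LinearMap.add_apply, ha, hb]
    | tmul a b => simp [toDual_antipodeEquiv_symm, mul_comm]
  rw [h, pairing_comul, pairing_comul, toDual_antipodeEquiv_symm, antipode_mul_antidistrib]

lemma antipode_translateRight (φ : DualCop k H) (x : H) :
    antipode k (translateRight φ x) = translateLeft (antipode k φ) (antipode k x) := by
  ext y
  rw [toDual_antipode, toDual_translateRight, toDual_translateLeft, toDual_antipode,
    antipodeEquiv_symm_mul]
  exact congrArg (fun z => toDual φ ((antipodeEquiv k H).symm y * z))
    ((antipodeEquiv k H).symm_apply_apply x).symm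

lemma antipode_translateLeft (φ : DualCop k H) (x : H) :
    antipode k (translateLeft φ x) = translateRight (antipode k φ) (antipode k x) := by
  ext y
  rw [toDual_antipode, toDual_translateLeft, toDual_translateRight, toDual_antipode,
    antipodeEquiv_symm_mul]
  exact congrArg (fun z => toDual φ (z * (antipodeEquiv k H).symm y))
    ((antipodeEquiv k H).symm_apply_apply x).symm

end Antipode

section Action
variable {E : Type*} [Ring E] [Algebra k E]

/-- The antimultiplicative map `a = α ∘ S⁻¹` on `H^{* cop}` attached to an algebra morphism `α`. -/
def antiMap (α : DualCop k H →ₐ[k] E) : DualCop k H →ₗ[k] E :=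
  α.toLinearMap ∘ₗ (antipodeEquiv k (DualCop k H)).symm.toLinearMap

lemma antiMap_antipode (α : DualCop k H →ₐ[k] E) (φ : DualCop k H) :
    antiMap α (antipode k φ) = α φ :=
  congrArg α ((antipodeEquiv k (DualCop k H)).symm_apply_apply φ)

lemma antiMap_one (α : DualCop k H →ₐ[k] E) : antiMap α 1 = 1 :=
  (congrArg α antipodeEquiv_symm_one).trans (map_one α)

lemma antiMap_mul (α : DualCop k H →ₐ[k] E) (φ ψ : DualCop k H) :
    antiMap α (φ * ψ) = antiMap α ψ * antiMap α φ :=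
  (congrArg α (antipodeEquiv_symm_mul φ ψ)).trans (map_mul α _ _)

/-- The algebra morphism `α = a ∘ S` attached to an antimultiplicative map `a`. -/
def ofAntiMap (a : DualCop k H →ₗ[k] E) (h1 : a 1 = 1) (hm : ∀ φ ψ, a (φ * ψ) = a ψ * a φ) :
    DualCop k H →ₐ[k] E :=
  AlgHom.ofLinearMap (a ∘ₗ antipode k) (by simp [h1]) (fun φ ψ => by
    simp [antipode_mul_antidistrib, hm])

lemma antiMap_ofAntiMap (a : DualCop k H →ₗ[k] E) (h1 : a 1 = 1)
    (hm : ∀ φ ψ, a (φ * ψ) = a ψ * a φ) : antiMap (ofAntiMap a h1 hm) = a := by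
  ext φ
  exact congrArg a ((antipodeEquiv k (DualCop k H)).apply_symm_apply φ)

variable {U : Type w} [Ring U] [HopfAlgebra k U] [Module.Finite k U] (f : U →ₐc[k] H)
  (β : U →ₐ[k] E)

/-- `u ↦ f(u) ⊗ 1` -/
def inclLeft : U →ₐ[k] H ⊗[k] E :=
  Algebra.TensorProduct.includeLeft.comp (f : U →ₐ[k] H)

/-- `u ↦ 1 ⊗ β(u)` -/
def inclRight : U →ₐ[k] H ⊗[k] E :=
  Algebra.TensorProduct.includeRight.comp β

omit [Module.Finite k H] in
lemma slice_inclLeft_mul (φ : DualCop k H) (x : H) (z : H ⊗[k] E) :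
    slice φ ((x ⊗ₜ[k] (1 : E)) * z) = slice (translateLeft φ x) z := by
  induction z with
  | zero => simp
  | add z z' h h' => simp only [mul_add, map_add, h, h']
  | tmul y e => simp [slice_tmul, toDual_translateLeft]

omit [Module.Finite k H] in
lemma slice_mul_inclLeft (φ : DualCop k H) (x : H) (z : H ⊗[k] E) :
    slice φ (z * (x ⊗ₜ[k] (1 : E))) = slice (translateRight φ x) z := by
  induction z with
  | zero => simp
  | add z z' h h' => simp only [add_mul, map_add, h, h']
  | tmul y e => simp [slice_tmul, toDual_translateRight]

omit [Module.Finite k H] in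
lemma slice_inclRight_mul (φ : DualCop k H) (e : E) (z : H ⊗[k] E) :
    slice φ (((1 : H) ⊗ₜ[k] e) * z) = e * slice φ z := by
  induction z with
  | zero => simp
  | add z z' h h' => simp only [mul_add, map_add, h, h']
  | tmul y e => simp [slice_tmul]

omit [Module.Finite k H] in
lemma slice_mul_inclRight (φ : DualCop k H) (e : E) (z : H ⊗[k] E) :
    slice φ (z * ((1 : H) ⊗ₜ[k] e)) = slice φ z * e := by
  induction z with
  | zero => simp
  | add z z' h h' => simp only [add_mul, map_add, h, h']
  | tmul y e => simp [slice_tmul]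

omit [Module.Finite k H] [Module.Finite k U] in
/-- A morphism of bialgebras between Hopf algebras commutes with the antipodes. -/
lemma map_antipode_of_bialgHom (u : U) : f (antipode k u) = antipode k (f u) := by
  have h1 : toConv (antipode k ∘ₗ (f : U →ₗ[k] H)) * toConv (f : U →ₐ[k] H).toLinearMap = 1 := by
    refine WithConv.ext (LinearMap.ext fun x => ?_)
    refine ((ℛ k x).convMul_apply _ _).trans ?_
    have h := sum_antipode_mul_eq_smul ((ℛ k x).induced f)
    simpa [Algebra.algebraMap_eq_smul_one] using h
  have h2 := left_inv_eq_right_inv h1 (toConv_mul_comp_antipode (f : U →ₐ[k] H))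
  exact congr(($h2).ofConv u).symm

/-- The element `x ↦ ε(x) c` of the convolution algebra. -/
def convConst {C B : Type*} [AddCommGroup C] [Module k C] [Coalgebra k C] [Ring B] [Algebra k B]
    (c : B) : WithConv (C →ₗ[k] B) :=
  toConv ((counit : C →ₗ[k] k).smulRight c)

lemma mul_convConst_apply {C B : Type*} [AddCommGroup C] [Module k C] [Coalgebra k C] [Ring B]
    [Algebra k B] (F : WithConv (C →ₗ[k] B)) (c : B) (x : C) :
    (F * convConst c).ofConv x = F.ofConv x * c := by
  rw [(ℛ k x).convMul_apply]
  have h := congr((F.ofConv $(sum_smul_counit (ℛ k x))) * c)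
  simpa [convConst, Finset.sum_mul] using h

lemma convConst_mul_apply {C B : Type*} [AddCommGroup C] [Module k C] [Coalgebra k C] [Ring B]
    [Algebra k B] (F : WithConv (C →ₗ[k] B)) (c : B) (x : C) :
    (convConst c * F).ofConv x = c * F.ofConv x := by
  rw [(ℛ k x).convMul_apply]
  have h := congr(c * F.ofConv $(sum_counit_smul (ℛ k x)))
  simpa [convConst, Finset.mul_sum] using h

/-- In terms of the element `c = ∑ hᵢ ⊗ a(hⁱ)`, the commutation rule of the double reads
`c · (f(u₂) ⊗ β(u₁)) = (f(u₁) ⊗ β(u₂)) · c`. -/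
lemma crossed_iff_canonTensor (α : DualCop k H →ₐ[k] E) :
    (skewPairing (dualCopMap f)).Crossed α β ↔ ∀ u : U,
      canonTensor (antiMap α) * ∑ j ∈ (ℛ k u).index, f ((ℛ k u).right j) ⊗ₜ[k] β ((ℛ k u).left j) =
      (∑ j ∈ (ℛ k u).index, f ((ℛ k u).left j) ⊗ₜ[k] β ((ℛ k u).right j)) *
        canonTensor (antiMap α) := by
  -- in the convolution algebra, with `F u = f(u) ⊗ 1`, `F' = F⁻¹` and `G u = 1 ⊗ β(u)`, the rule of
  -- the double reads `F' c G = G c F'`, and multiplication by `F` on both sides gives `c G F = F G c`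
  set c := canonTensor (antiMap α)
  let F : WithConv (U →ₗ[k] H ⊗[k] E) := toConv (inclLeft (E := E) f).toLinearMap
  let F' : WithConv (U →ₗ[k] H ⊗[k] E) := toConv ((inclLeft (E := E) f).toLinearMap ∘ₗ antipode k)
  let G : WithConv (U →ₗ[k] H ⊗[k] E) := toConv (inclRight (H := H) β).toLinearMap
  have hFF' : F * F' = 1 := toConv_mul_comp_antipode _
  have hF'F : F' * F = 1 := comp_antipode_mul_toConv _
  have h1 : (skewPairing (dualCopMap f)).Crossed α β ↔
      F' * convConst c * G = G * convConst c * F' := by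
    rw [crossed_dualCopMap_iff]
    have hF' : ∀ u, F'.ofConv u = antipode k (f u) ⊗ₜ[k] (1 : E) := fun u =>
      congrArg (· ⊗ₜ[k] (1 : E)) (map_antipode_of_bialgHom f u)
    have hG : ∀ u, G.ofConv u = (1 : H) ⊗ₜ[k] β u := fun _ => rfl
    have e1 : ∀ ψ u, slice (antipode k ψ) ((F' * convConst c * G).ofConv u) = ∑ j ∈ (ℛ k u).index,
        α (translateRight ψ (f ((ℛ k u).left j))) * β ((ℛ k u).right j) := by
      intro ψ u
      rw [(ℛ k u).convMul_apply, map_sum]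
      refine Finset.sum_congr rfl fun j _ => ?_
      rw [mul_convConst_apply, hF', hG, slice_mul_inclRight, slice_inclLeft_mul,
        ← antipode_translateRight, slice_canonTensor, antiMap_antipode]
    have e2 : ∀ ψ u, slice (antipode k ψ) ((G * convConst c * F').ofConv u) = ∑ j ∈ (ℛ k u).index,
        β ((ℛ k u).left j) * α (translateLeft ψ (f ((ℛ k u).right j))) := by
      intro ψ u
      rw [(ℛ k u).convMul_apply, map_sum]
      refine Finset.sum_congr rfl fun j _ => ?_
      rw [mul_convConst_apply, hF', hG, slice_mul_inclLeft, slice_inclRight_mul,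
        ← antipode_translateLeft, slice_canonTensor, antiMap_antipode]
    constructor
    · intro h
      refine WithConv.ext (LinearMap.ext fun u => slice_ext fun φ => ?_)
      obtain ⟨ψ, rfl⟩ := (antipodeEquiv k (DualCop k H)).surjective φ
      exact (e1 ψ u).trans ((h ψ u).trans (e2 ψ u).symm)
    · intro h ψ u
      rw [← e1, h, e2]
  have h2 : (∀ u : U,
      c * ∑ j ∈ (ℛ k u).index, f ((ℛ k u).right j) ⊗ₜ[k] β ((ℛ k u).left j) =
      (∑ j ∈ (ℛ k u).index, f ((ℛ k u).left j) ⊗ₜ[k] β ((ℛ k u).right j)) * c) ↔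
      convConst c * (G * F) = F * G * convConst c := by
    have e1 : ∀ u, (convConst c * (G * F)).ofConv u =
        c * ∑ j ∈ (ℛ k u).index, f ((ℛ k u).right j) ⊗ₜ[k] β ((ℛ k u).left j) := by
      intro u
      rw [convConst_mul_apply, (ℛ k u).convMul_apply]
      refine congrArg (c * ·) (Finset.sum_congr rfl fun j _ => ?_)
      exact (Algebra.TensorProduct.tmul_mul_tmul _ _ _ _).trans (by simp)
    have e2 : ∀ u, (F * G * convConst c).ofConv u =
        (∑ j ∈ (ℛ k u).index, f ((ℛ k u).left j) ⊗ₜ[k] β ((ℛ k u).right j)) * c := by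
      intro u
      rw [mul_convConst_apply, (ℛ k u).convMul_apply]
      refine congrArg (· * c) (Finset.sum_congr rfl fun j _ => ?_)
      exact (Algebra.TensorProduct.tmul_mul_tmul _ _ _ _).trans (by simp)
    simp only [← e1, ← e2]
    exact ⟨fun h => WithConv.ext (LinearMap.ext h), fun h u => by rw [h]⟩
  rw [h1, h2]
  constructor
  · intro h
    calc convConst c * (G * F) = F * (F' * convConst c * G) * F := by
          simp only [← mul_assoc, hFF', one_mul]
      _ = F * G * convConst c := by
          rw [h]
          simp only [mul_assoc, hF'F, mul_one]
  · intro h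
    calc F' * convConst c * G = F' * (convConst c * (G * F)) * F' := by
          simp only [mul_assoc, hFF', mul_one]
      _ = G * convConst c * F' := by
          rw [h]
          simp only [← mul_assoc, hF'F, one_mul]

end Action
end Coaction

/-! ### The half braiding of an action of the dual -/

section Braid
open HopfAlgebra DualCop
variable {k : Type u} [Field k] {H : Type v} [Ring H] [HopfAlgebra k H]
  {V W Y Z : Type*} [AddCommGroup V] [Module k V] [AddCommGroup W] [Module k W]
  [AddCommGroup Y] [Module k Y] [AddCommGroup Z] [Module k Z]

/-- The action of `H ⊗ End(V)` on `Y ⊗ V`, for a representation `Y` of `H`. -/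
def tensorEnd (ρ : H →ₐ[k] Module.End k Y) : H ⊗[k] Module.End k V →ₐ[k] Module.End k (Y ⊗[k] V) :=
  (Module.endTensorEndAlgHom (R := k) (S := k) (A := k) (M := Y) (N := V)).comp
    (Algebra.TensorProduct.map ρ (AlgHom.id k _))

lemma tensorEnd_tmul (ρ : H →ₐ[k] Module.End k Y) (h : H) (F : Module.End k V) :
    tensorEnd ρ (h ⊗ₜ F) = TensorProduct.map (ρ h) F := rfl

/-- The map `v ⊗ y ↦ c · (y ⊗ v)` for an element `c` of `H ⊗ End(V)`. -/
def braid (c : H ⊗[k] Module.End k V) (ρ : H →ₐ[k] Module.End k Y) : V ⊗[k] Y →ₗ[k] Y ⊗[k] V :=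
  tensorEnd ρ c ∘ₗ (TensorProduct.comm k V Y).toLinearMap

lemma braid_naturality (c : H ⊗[k] Module.End k V) {ρ : H →ₐ[k] Module.End k Y}
    {ρ' : H →ₐ[k] Module.End k Z} {g : Y →ₗ[k] Z} (hg : ∀ h, g ∘ₗ ρ h = ρ' h ∘ₗ g) :
    braid c ρ' ∘ₗ TensorProduct.map (LinearMap.id : V →ₗ[k] V) g =
      TensorProduct.map g (LinearMap.id : V →ₗ[k] V) ∘ₗ braid c ρ := by
  refine TensorProduct.ext' fun v y => ?_
  have hg' : ∀ h y, g (ρ h y) = ρ' h (g y) := fun h y => LinearMap.congr_fun (hg h) y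
  induction c with
  | zero => simp [braid]
  | add c c' h h' =>
    simp only [braid, map_add, LinearMap.comp_apply, LinearMap.add_apply] at h h' ⊢
    rw [h, h']
  | tmul h F => simp [braid, tensorEnd_tmul, hg']

/-- The half braiding intertwines the diagonal actions of `U` if the commutation rule holds. -/
lemma braid_equivariant {U : Type w} [Ring U] [HopfAlgebra k U] (f : U →ₐc[k] H)
    (β : U →ₐ[k] Module.End k V) (c : H ⊗[k] Module.End k V) (u : U)
    (h : c * ∑ j ∈ (ℛ k u).index, f ((ℛ k u).right j) ⊗ₜ[k] β ((ℛ k u).left j) =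
      (∑ j ∈ (ℛ k u).index, f ((ℛ k u).left j) ⊗ₜ[k] β ((ℛ k u).right j)) * c)
    (ρ : H →ₐ[k] Module.End k Y) :
    braid c ρ ∘ₗ tensorAct β (ρ.comp (f : U →ₐ[k] H)) u =
      tensorAct (ρ.comp (f : U →ₐ[k] H)) β u ∘ₗ braid c ρ := by
  refine TensorProduct.ext' fun v y => ?_
  have h1 := congr(tensorEnd ρ $h (y ⊗ₜ v))
  simp only [map_mul, map_sum, tensorEnd_tmul, Module.End.mul_apply, LinearMap.sum_apply,
    TensorProduct.map_tmul] at h1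
  have h2 : ∀ z : Y ⊗[k] V, tensorAct (ρ.comp (f : U →ₐ[k] H)) β u z =
      ∑ j ∈ (ℛ k u).index, TensorProduct.map (ρ (f ((ℛ k u).left j))) (β ((ℛ k u).right j)) z := by
    intro z
    induction z with
    | zero => simp
    | add z z' h h' => simp only [map_add, h, h', Finset.sum_add_distrib]
    | tmul y v => exact tensorAct_tmul _ _ (ℛ k u) y v
  rw [LinearMap.comp_apply, tensorAct_tmul _ _ (ℛ k u), LinearMap.comp_apply, h2]
  refine Eq.trans ?_ h1
  simp [braid]

variable [Module.Finite k H]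

lemma braid_canonTensor_tmul (a : DualCop k H →ₗ[k] Module.End k V) (ρ : H →ₐ[k] Module.End k Y)
    (v : V) (y : Y) : braid (canonTensor a) ρ (v ⊗ₜ y) =
      ∑ i, ρ (Module.finBasis k H i) y ⊗ₜ[k] a (dualCoord k H i) v := by
  simp [braid, canonTensor, tensorEnd_tmul]

lemma braid_comm {a : DualCop k H →ₗ[k] Module.End k V} {a' : DualCop k H →ₗ[k] Module.End k W}
    {g : V →ₗ[k] W} (hg : ∀ φ, g ∘ₗ a φ = a' φ ∘ₗ g) (ρ : H →ₐ[k] Module.End k Y) :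
    braid (canonTensor a') ρ ∘ₗ TensorProduct.map g (LinearMap.id : Y →ₗ[k] Y) =
      TensorProduct.map (LinearMap.id : Y →ₗ[k] Y) g ∘ₗ braid (canonTensor a) ρ := by
  refine TensorProduct.ext' fun v y => ?_
  have hg' : ∀ h y, g (a h y) = a' h (g y) := fun h y => LinearMap.congr_fun (hg h) y
  simp [braid_canonTensor_tmul, hg']

/-- The map `a` is recovered from the half braiding with the regular representation. -/
lemma slice_braid (a : DualCop k H →ₗ[k] Module.End k V) (φ : DualCop k H) (v : V) :
    slice φ (braid (canonTensor a) (Algebra.lmul k H) (v ⊗ₜ (1 : H))) = a φ v := by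
  have h := congr(a $(sum_toDual_smul_dualCoord φ) v)
  simp only [map_sum, map_smul, LinearMap.sum_apply, LinearMap.smul_apply] at h
  simpa [braid_canonTensor_tmul, slice_tmul] using h

omit [Module.Finite k H] in
lemma tensorAct_tmul_eq_map (ρ : H →ₐ[k] Module.End k Y) (ρ' : H →ₐ[k] Module.End k Z) (h : H)
    (y : Y) (z : Z) : tensorAct ρ ρ' h (y ⊗ₜ z) =
      TensorProduct.map (ρ.toLinearMap.flip y) (ρ'.toLinearMap.flip z) (comul h) := by
  rw [tensorAct_tmul _ _ (ℛ k h)]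
  conv_rhs => rw [← (ℛ k h).eq]
  simp

/-- The hexagon of the half braiding of an antimultiplicative map. -/
lemma braid_tensorAct {a : DualCop k H →ₗ[k] Module.End k V} (hm : ∀ φ ψ, a (φ * ψ) = a ψ * a φ)
    (ρ : H →ₐ[k] Module.End k Y) (ρ' : H →ₐ[k] Module.End k Z) (v : V) (y : Y) (z : Z) :
    braid (canonTensor a) (tensorAct ρ ρ') (v ⊗ₜ (y ⊗ₜ z)) =
      (TensorProduct.assoc k Y Z V).symm
        (TensorProduct.map (LinearMap.id : Y →ₗ[k] Y) (braid (canonTensor a) ρ')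
          (TensorProduct.assoc k Y V Z
            (TensorProduct.map (braid (canonTensor a) ρ) (LinearMap.id : Z →ₗ[k] Z)
              ((v ⊗ₜ y) ⊗ₜ z)))) := by
  let G : (H ⊗[k] H) ⊗[k] DualCop k H →ₗ[k] (Y ⊗[k] Z) ⊗[k] V :=
    TensorProduct.map (TensorProduct.map (ρ.toLinearMap.flip y) (ρ'.toLinearMap.flip z)) (a.flip v)
  have h := congr(G $(sum_comul_tmul_dualCoord (k := k) (H := H)))
  simp only [map_sum] at h
  rw [braid_canonTensor_tmul]
  refine Eq.trans ?_ (h.trans ?_)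
  · refine Finset.sum_congr rfl fun i _ => ?_
    rw [tensorAct_tmul_eq_map]
    rfl
  · simp [braid_canonTensor_tmul, G, hm, TensorProduct.sum_tmul, TensorProduct.tmul_sum]

/-- Conversely, the hexagon for the regular representation implies antimultiplicativity. -/
lemma antimul_of_braid {a : DualCop k H →ₗ[k] Module.End k V}
    (h : ∀ v : V, braid (canonTensor a) (tensorAct (Algebra.lmul k H) (Algebra.lmul k H))
      (v ⊗ₜ ((1 : H) ⊗ₜ (1 : H))) =
      (TensorProduct.assoc k H H V).symm
        (TensorProduct.map (LinearMap.id : H →ₗ[k] H) (braid (canonTensor a) (Algebra.lmul k H))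
          (TensorProduct.assoc k H V H
            (TensorProduct.map (braid (canonTensor a) (Algebra.lmul k H)) (LinearMap.id : H →ₗ[k] H)
              ((v ⊗ₜ (1 : H)) ⊗ₜ (1 : H)))))) (φ ψ : DualCop k H) : a (φ * ψ) = a ψ * a φ := by
  refine LinearMap.ext fun v => ?_
  have h1 : TensorProduct.map (LinearMap.id : H ⊗[k] H →ₗ[k] H ⊗[k] H) (a.flip v)
      (∑ i, comul (R := k) (Module.finBasis k H i) ⊗ₜ[k] dualCoord k H i) =
      ∑ i, ∑ j, (Module.finBasis k H i ⊗ₜ[k] Module.finBasis k H j) ⊗ₜ[k]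
        a (dualCoord k H j) (a (dualCoord k H i) v) := by
    have h2 := h v
    rw [braid_canonTensor_tmul] at h2
    have h3 : ∀ x : H, tensorAct (Algebra.lmul k H) (Algebra.lmul k H) x ((1 : H) ⊗ₜ (1 : H)) =
        comul (R := k) x := by
      intro x
      rw [tensorAct_tmul _ _ (ℛ k x)]
      simpa using (ℛ k x).eq
    simp only [h3] at h2
    simpa [braid_canonTensor_tmul, TensorProduct.sum_tmul, TensorProduct.tmul_sum] using h2
  rw [sum_comul_tmul_dualCoord] at h1
  have h4 := congr(TensorProduct.lid k V (((LinearMap.mul' k k ∘ₗ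
    TensorProduct.map (toDual φ) (toDual ψ)).rTensor V) $h1))
  simp only [map_sum, TensorProduct.map_tmul, LinearMap.rTensor_tmul, LinearMap.comp_apply,
    LinearMap.mul'_apply, TensorProduct.lid_tmul, LinearMap.id_apply, LinearMap.flip_apply] at h4
  have h5 := congr(a ($(sum_toDual_smul_dualCoord φ) * $(sum_toDual_smul_dualCoord ψ)) v)
  have h6 := congr(a $(sum_toDual_smul_dualCoord ψ) (a $(sum_toDual_smul_dualCoord φ) v))
  rw [Finset.sum_mul_sum] at h5
  rw [Module.End.mul_apply, ← h5, ← h6]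
  simp only [smul_mul_smul_comm, map_sum, map_smul, LinearMap.sum_apply, LinearMap.smul_apply] at h4 ⊢
  rw [h4]
  simp only [Finset.smul_sum, smul_smul]

/-- The unit axiom of the half braiding. -/
lemma braid_unitAct (a : DualCop k H →ₗ[k] Module.End k V) (v : V) (c : k) :
    braid (canonTensor a) (unitAct k H) (v ⊗ₜ c) = c ⊗ₜ a 1 v := by
  rw [braid_canonTensor_tmul]
  have h := congr(c ⊗ₜ[k] a $(sum_toDual_smul_dualCoord (1 : DualCop k H)) v)
  rw [← h]
  simp only [map_sum, map_smul, LinearMap.sum_apply, LinearMap.smul_apply, TensorProduct.tmul_sum,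
    ← TensorProduct.smul_tmul, DualCop.toDual_one, unitAct_apply, smul_eq_mul]

/-- The half braiding of a tensor product. -/
lemma braid_tensorProduct {a : DualCop k H →ₗ[k] Module.End k V} {a' : DualCop k H →ₗ[k] Module.End k W}
    {b : DualCop k H →ₗ[k] Module.End k (V ⊗[k] W)} (hb : ∀ φ, b φ = Module.endTensorEndAlgHom
      (R := k) (S := k) (A := k) (M := V) (N := W) (TensorProduct.map a a'
      (TensorProduct.comm k _ _ (comul φ))))
    (ρ : H →ₐ[k] Module.End k Y) (v : V) (w : W) (y : Y) :
    braid (canonTensor b) ρ ((v ⊗ₜ w) ⊗ₜ y) =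
      TensorProduct.assoc k Y V W (TensorProduct.map (braid (canonTensor a) ρ)
        (LinearMap.id : W →ₗ[k] W) ((TensorProduct.assoc k V Y W).symm
          (TensorProduct.map (LinearMap.id : V →ₗ[k] V) (braid (canonTensor a') ρ)
            (TensorProduct.assoc k V W Y ((v ⊗ₜ w) ⊗ₜ y))))) := by
  let G : H ⊗[k] (DualCop k H ⊗[k] DualCop k H) →ₗ[k] Y ⊗[k] (V ⊗[k] W) :=
    TensorProduct.map (ρ.toLinearMap.flip y) (TensorProduct.map (a.flip v) (a'.flip w) ∘ₗ
      (TensorProduct.comm k _ _).toLinearMap)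
  have h := congr(G $(sum_tmul_comul_dualCoord (k := k) (H := H)))
  simp only [map_sum] at h
  rw [braid_canonTensor_tmul]
  refine Eq.trans ?_ (h.trans ?_)
  · refine Finset.sum_congr rfl fun i _ => ?_
    have h1 : ∀ z : DualCop k H ⊗[k] DualCop k H, Module.endTensorEndAlgHom
        (R := k) (S := k) (A := k) (M := V) (N := W) (TensorProduct.map a a' z) (v ⊗ₜ w) =
        TensorProduct.map (a.flip v) (a'.flip w) z := by
      intro z
      induction z with
      | zero => simp
      | add z z' h h' => simp only [map_add, LinearMap.add_apply, h, h']
      | tmul φ ψ => rfl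
    rw [hb, h1]
    rfl
  · simp [braid_canonTensor_tmul, G, TensorProduct.sum_tmul, TensorProduct.tmul_sum]

end Braid

/-! ### The functor from representations of the double to the relative center -/

section CenterFunctor
open CategoryTheory MonoidalCategory HopfAlgebra DualCop
variable {k : Type u} [Field k] {U : Type u} [Ring U] [HopfAlgebra k U] [Module.Finite k U]
  {H : Type u} [Ring H] [HopfAlgebra k H] [Module.Finite k H] (f : U →ₐc[k] H)

/-- The inclusion of `U` in the generalized double, as a morphism of bialgebras. -/
def inrHom : U →ₐc[k] GeneralizedDouble (dualCopMap f) :=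
  BialgHom.ofAlgHom (skewPairing (dualCopMap f)).inr
    (AlgHom.ext fun u => (skewPairing (dualCopMap f)).counit_inr u)
    (AlgHom.ext fun u => ((skewPairing (dualCopMap f)).comul_inr u).symm)

lemma tmul_eq_lid_symm_rid {V : Type*} [AddCommGroup V] [Module k V] (v : V) (c : k) :
    c ⊗ₜ[k] v = (TensorProduct.lid k V).symm (TensorProduct.rid k V (v ⊗ₜ[k] c)) := by
  rw [TensorProduct.rid_tmul, TensorProduct.lid_symm_apply, TensorProduct.tmul_smul,
    TensorProduct.smul_tmul', smul_eq_mul, mul_one]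

lemma tmul_eq_rid_symm_lid {V : Type*} [AddCommGroup V] [Module k V] (v : V) (c : k) :
    v ⊗ₜ[k] c = (TensorProduct.rid k V).symm (TensorProduct.lid k V (c ⊗ₜ[k] v)) := by
  rw [TensorProduct.lid_tmul, TensorProduct.rid_symm_apply, ← TensorProduct.smul_tmul',
    ← TensorProduct.tmul_smul, smul_eq_mul, mul_one]

/-- If `H^*` acts trivially, then the half braiding is the flip. -/
lemma braid_eq_flip {V Y : Type*} [AddCommGroup V] [Module k V] [AddCommGroup Y] [Module k Y]
    {a : DualCop k H →ₗ[k] Module.End k V} {v : V} (ha : ∀ φ, a φ v = toDual φ 1 • v)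
    (ρ : H →ₐ[k] Module.End k Y) (y : Y) : braid (canonTensor a) ρ (v ⊗ₜ y) = y ⊗ₜ v := by
  rw [braid_canonTensor_tmul]
  have h := congr(ρ $(sum_dualCoord_smul (k := k) (1 : H)) y ⊗ₜ[k] v)
  rw [map_one, Module.End.one_apply] at h
  rw [← h]
  simp [ha, TensorProduct.sum_tmul, TensorProduct.smul_tmul]

namespace RelativeCenter

/-- The action of `H^{* cop}` on a representation of the double. -/
def dualAction (X : RepCat k (GeneralizedDouble (dualCopMap f))) :
    DualCop k H →ₐ[k] Module.End k X.V :=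
  X.ρ.comp (skewPairing (dualCopMap f)).inl

variable {f} in
/-- The braiding element `∑ hᵢ ⊗ S⁻¹(hⁱ)` acting on a representation of the double. -/
def braidElem (X : RepCat k (GeneralizedDouble (dualCopMap f))) : H ⊗[k] Module.End k X.V :=
  canonTensor (antiMap (dualAction f X))

lemma crossed_dualAction (X : RepCat k (GeneralizedDouble (dualCopMap f))) :
    (skewPairing (dualCopMap f)).Crossed (dualAction f X)
      (X.ρ.comp (skewPairing (dualCopMap f)).inr) := by
  rw [crossed_dualCopMap_iff]
  intro φ u
  have h := congrArg X.ρ ((crossed_dualCopMap_iff f _ _).1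
    (skewPairing (dualCopMap f)).crossed_inl_inr φ u)
  simpa [dualAction] using h

/-- The object of the relative center attached to a representation of the double: its half braiding
is `v ⊗ y ↦ ∑ hᵢ y ⊗ S⁻¹(hⁱ) v`. -/
def ofRep (X : RepCat k (GeneralizedDouble (dualCopMap f))) :
    RelativeCenter (RepCat.res (k := k) f) where
  V := (RepCat.res (inrHom f)).obj X
  γ Y := RepCat.ofLin (X := (RepCat.res (inrHom f)).obj X ⊗ (RepCat.res f).obj Y)
    (Y := (RepCat.res f).obj Y ⊗ (RepCat.res (inrHom f)).obj X) (braid (braidElem X) Y.ρ) fun u =>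
      braid_equivariant f _ _ u
        ((crossed_iff_canonTensor f _ (dualAction f X)).1 (crossed_dualAction f X) u) Y.ρ
  naturality g := RepCat.toLin_injective (braid_naturality (braidElem X) (RepCat.toLin_comm g))
  tensor Y Z := RepCat.toLin_injective (TensorProduct.ext_threefold' fun v y z =>
    (braid_tensorAct (antiMap_mul (dualAction f X)) Y.ρ Z.ρ v y z).trans
      (LinearMap.congr_fun (TensorProduct.map_id (R := k) (M := Y.V ⊗[k] Z.V) (N := X.V)) _).symm)
  unit := RepCat.toLin_injective (TensorProduct.ext' fun v c =>
    (braid_unitAct (antiMap (dualAction f X)) v c).trans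
      ((congrArg (fun F : Module.End k X.V => c ⊗ₜ[k] F v) (antiMap_one _)).trans
        (tmul_eq_lid_symm_rid (V := X.V) v c)))

/-- A linear map is a morphism of representations of the double if it commutes with the actions of
`H^{* cop}` and of `U`. -/
lemma hom_comm_double {X Y : RepCat k (GeneralizedDouble (dualCopMap f))}
    (g : X.V →ₗ[k] Y.V) (h1 : ∀ φ, g ∘ₗ X.ρ ((skewPairing (dualCopMap f)).inl φ) =
      Y.ρ ((skewPairing (dualCopMap f)).inl φ) ∘ₗ g)
    (h2 : ∀ u, g ∘ₗ X.ρ ((skewPairing (dualCopMap f)).inr u) =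
      Y.ρ ((skewPairing (dualCopMap f)).inr u) ∘ₗ g) (x : GeneralizedDouble (dualCopMap f)) :
    g ∘ₗ X.ρ x = Y.ρ x ∘ₗ g := by
  refine LinearMap.congr_fun ((skewPairing (dualCopMap f)).double_ext
    (F := (LinearMap.llcomp k X.V X.V Y.V g) ∘ₗ X.ρ.toLinearMap)
    (G := (LinearMap.lcomp k Y.V g) ∘ₗ Y.ρ.toLinearMap) fun φ u => ?_) x
  change g ∘ₗ X.ρ (_ * _) = Y.ρ (_ * _) ∘ₗ g
  rw [map_mul, map_mul, Module.End.mul_eq_comp, Module.End.mul_eq_comp, ← LinearMap.comp_assoc, h1,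
    LinearMap.comp_assoc, h2, LinearMap.comp_assoc]

variable {f} in
lemma comm_antiMap {X Y : RepCat k (GeneralizedDouble (dualCopMap f))} (g : X ⟶ Y)
    (φ : DualCop k H) : RepCat.toLin g ∘ₗ antiMap (dualAction f X) φ =
      antiMap (dualAction f Y) φ ∘ₗ RepCat.toLin g :=
  RepCat.toLin_comm g _

/-- The functor from representations of the double to the relative center. -/
def repFunctor :
    RepCat k (GeneralizedDouble (dualCopMap f)) ⥤ RelativeCenter (RepCat.res (k := k) f) where
  obj X := ofRep f X
  map g := ⟨(RepCat.res (inrHom f)).map g, fun Y => RepCat.toLin_injective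
    (braid_comm (comm_antiMap g) Y.ρ)⟩

instance : (repFunctor f).Additive where
  map_add := rfl

instance : (repFunctor f).Linear k where
  map_smul _ _ := rfl

instance : (repFunctor f).Faithful where
  map_injective {_ _ _ _} h := RepCat.toLin_injective
    (congrArg (fun t => RepCat.toLin (RelativeCenter.Hom.f t)) h)

variable {f} in
/-- The linear map underlying a morphism of the relative center. -/
def homLin {X Y : RepCat k (GeneralizedDouble (dualCopMap f))} (g : ofRep f X ⟶ ofRep f Y) :
    X.V →ₗ[k] Y.V :=
  RepCat.toLin (X := (ofRep f X).V) (Y := (ofRep f Y).V) g.f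

/-- A morphism of the relative center commutes with the action of `H^*`, since this action is read off
from the half braiding with the regular representation. -/
lemma comm_antiMap_of_hom {X Y : RepCat k (GeneralizedDouble (dualCopMap f))}
    (g : ofRep f X ⟶ ofRep f Y) (φ : DualCop k H) :
    homLin g ∘ₗ antiMap (dualAction f X) φ = antiMap (dualAction f Y) φ ∘ₗ homLin g := by
  let g' := homLin g
  refine LinearMap.ext fun v => ?_
  have h : ∀ z : X.V ⊗[k] H, braid (braidElem Y) (Algebra.lmul k H)
      (TensorProduct.map g' (LinearMap.id : H →ₗ[k] H) z) =
      TensorProduct.map (LinearMap.id : H →ₗ[k] H) g' (braid (braidElem X) (Algebra.lmul k H) z) :=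
    fun z => LinearMap.congr_fun (congrArg RepCat.toLin (g.comm (RepCat.regular k H))) z
  have h1 := congrArg (slice φ) (h (v ⊗ₜ (1 : H)))
  have h2 : ∀ z : H ⊗[k] X.V, slice φ (TensorProduct.map (LinearMap.id : H →ₗ[k] H) g' z) =
      g' (slice φ z) := by
    intro z
    induction z with
    | zero => simp
    | add z z' h h' => simp only [map_add, h, h']
    | tmul h v => simp [slice_tmul]
  rw [h2, TensorProduct.map_tmul, LinearMap.id_apply, braidElem, braidElem, slice_braid,
    slice_braid] at h1
  exact h1.symm

instance : (repFunctor f).Full where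
  map_surjective {X Y} g := by
    refine ⟨RepCat.ofLin (X := X) (Y := Y) (homLin g) (hom_comm_double f (X := X) (Y := Y) _
      (fun φ => ?_) fun u => RepCat.toLin_comm (X := (ofRep f X).V) (Y := (ofRep f Y).V) g.f u), rfl⟩
    have h := comm_antiMap_of_hom f g (antipode k φ)
    rw [antiMap_antipode, antiMap_antipode] at h
    exact h

lemma antiMap_dualAction_unit (φ : DualCop k H) (c : k) :
    (antiMap (dualAction f (𝟙_ (RepCat k (GeneralizedDouble (dualCopMap f))))) φ : Module.End k k) c =
      toDual φ 1 • c := by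
  have h : counit (R := k) ((skewPairing (dualCopMap f)).inl
      ((antipodeEquiv k (DualCop k H)).symm φ)) = toDual φ 1 := by
    rw [SkewPairing.counit_inl, counit_apply, toDual_antipodeEquiv_symm, antipode_one]
  exact congrArg (· * c) h

/-- The opposite comultiplication appears because `S⁻¹` is anticomultiplicative. -/
lemma antiMap_dualAction_tensor (X Y : RepCat k (GeneralizedDouble (dualCopMap f)))
    (φ : DualCop k H) :
    (antiMap (dualAction f (X ⊗ Y)) φ : Module.End k (X.V ⊗[k] Y.V)) =
      Module.endTensorEndAlgHom (R := k) (S := k) (A := k) (M := X.V) (N := Y.V)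
        (TensorProduct.map (antiMap (dualAction f X)) (antiMap (dualAction f Y))
          (TensorProduct.comm k _ _ (comul φ))) := by
  have h : comul (R := k) ((skewPairing (dualCopMap f)).inl
      ((antipodeEquiv k (DualCop k H)).symm φ)) = _ := SkewPairing.comul_inl _ _
  rw [comul_antipodeEquiv_symm] at h
  change Module.endTensorEndAlgHom (R := k) (S := k) (A := k) (M := X.V) (N := Y.V)
    (TensorProduct.map X.ρ.toLinearMap Y.ρ.toLinearMap (comul _)) = _
  refine (congrArg (fun z => Module.endTensorEndAlgHom (R := k) (S := k) (A := k) (M := X.V)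
    (N := Y.V) (TensorProduct.map X.ρ.toLinearMap Y.ρ.toLinearMap z)) h).trans ?_
  generalize TensorProduct.comm k _ _ (comul (R := k) φ) = z
  induction z with
  | zero => simp
  | add z z' h h' => simp only [map_add, h, h']
  | tmul φ ψ => rfl

/-- The functor from representations of the double to the relative center is monoidal, with identity
structure maps. -/
instance : (repFunctor f).Monoidal :=
  Functor.CoreMonoidal.toMonoidal
    { εIso := isoMk (RepCat.isoMk (LinearEquiv.refl k k) fun a => by
        refine LinearMap.ext_ring ?_
        exact congrArg (· * (1 : k)) ((skewPairing (dualCopMap f)).counit_inr a).symm)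
          fun Y => RepCat.toLin_injective (TensorProduct.ext' fun c y =>
            (braid_eq_flip (V := k) (fun φ => antiMap_dualAction_unit f φ c) Y.ρ y).trans
              (tmul_eq_rid_symm_lid y c))
      μIso := fun X Y => isoMk (RepCat.isoMk (LinearEquiv.refl k (X.V ⊗[k] Y.V)) fun a =>
        RepCat.res_tensorAct (inrHom f) X Y a) fun Z => RepCat.toLin_injective
          (TensorProduct.ext_threefold fun v w z =>
            (braid_tensorProduct (antiMap_dualAction_tensor f X Y) Z.ρ v w z).trans
              (LinearMap.congr_fun (TensorProduct.map_id (R := k) (M := Z.V)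
                (N := X.V ⊗[k] Y.V)) _).symm)
      μIso_hom_natural_left := fun f Z => hom_ext (RepCat.toLin_injective
        (TensorProduct.ext' fun _ _ => rfl))
      μIso_hom_natural_right := fun f Z => hom_ext (RepCat.toLin_injective
        (TensorProduct.ext' fun _ _ => rfl))
      associativity := fun X Y Z => hom_ext (RepCat.toLin_injective
        (TensorProduct.ext_threefold fun _ _ _ => rfl))
      left_unitality := fun X => hom_ext (RepCat.toLin_injective (TensorProduct.ext' fun _ _ => rfl))
      right_unitality := fun X => hom_ext (RepCat.toLin_injective
        (TensorProduct.ext' fun _ _ => rfl)) }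

end RelativeCenter
end CenterFunctor

/-! ### The half braidings of the relative center -/

section EssSurj
open CategoryTheory MonoidalCategory HopfAlgebra DualCop

section Linear
variable {k : Type u} [Field k] {H : Type v} [Ring H] [HopfAlgebra k H]
  {V : Type*} [AddCommGroup V] [Module k V]

/-- The map `a(φ) v = (φ ⊗ id)(γ(v ⊗ 1))` attached to a linear map `γ : V ⊗ H → H ⊗ V`. -/
def sliceMap (γ : V ⊗[k] H →ₗ[k] H ⊗[k] V) : DualCop k H →ₗ[k] Module.End k V where
  toFun φ := slice φ ∘ₗ γ ∘ₗ (TensorProduct.mk k V H).flip 1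
  map_add' φ ψ := by
    have h : ∀ z : H ⊗[k] V, slice (φ + ψ) z = slice φ z + slice ψ z := by
      intro z
      simp [slice, LinearMap.rTensor_add]
    exact LinearMap.ext fun v => h _
  map_smul' c φ := by
    have h : ∀ z : H ⊗[k] V, slice (c • φ) z = c • slice φ z := by
      intro z
      simp [slice, LinearMap.rTensor_smul]
    exact LinearMap.ext fun v => h _

lemma sliceMap_apply (γ : V ⊗[k] H →ₗ[k] H ⊗[k] V) (φ : DualCop k H) (v : V) :
    sliceMap γ φ v = slice φ (γ (v ⊗ₜ 1)) := rfl

variable [Module.Finite k H]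

/-- A natural family of maps `V ⊗ Y → Y ⊗ V` is determined by its value at the regular
representation. -/
lemma eq_braid_sliceMap {Y : Type*} [AddCommGroup Y] [Module k Y] (ρ : H →ₐ[k] Module.End k Y)
    (γ : V ⊗[k] H →ₗ[k] H ⊗[k] V) (γ' : V ⊗[k] Y →ₗ[k] Y ⊗[k] V)
    (h : ∀ y (z : V ⊗[k] H),
      γ' (TensorProduct.map (LinearMap.id : V →ₗ[k] V) (ρ.toLinearMap.flip y) z) =
      TensorProduct.map (ρ.toLinearMap.flip y) (LinearMap.id : V →ₗ[k] V) (γ z)) :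
    γ' = braid (canonTensor (sliceMap γ)) ρ := by
  refine TensorProduct.ext' fun v y => ?_
  have h1 := h y (v ⊗ₜ 1)
  rw [← sum_tmul_slice (γ (v ⊗ₜ 1))] at h1
  simpa [braid_canonTensor_tmul, sliceMap_apply] using h1

omit [Module.Finite k H] in
lemma slice_tensorEnd_lmul (φ : DualCop k H) (z : H ⊗[k] Module.End k V) (v : V) :
    slice φ (tensorEnd (Algebra.lmul k H) z ((1 : H) ⊗ₜ v)) = slice φ z v := by
  induction z with
  | zero => simp
  | add z z' h h' => simp only [map_add, LinearMap.add_apply, h, h']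
  | tmul h F => simp [tensorEnd_tmul, slice_tmul]

/-- Conversely to `braid_equivariant`, equivariance of the half braiding with the regular
representation implies the commutation rule. -/
lemma commutation_of_braid_equivariant {U : Type w} [Ring U] [HopfAlgebra k U] (f : U →ₐc[k] H)
    (β : U →ₐ[k] Module.End k V) (c : H ⊗[k] Module.End k V) (u : U)
    (h : braid c (Algebra.lmul k H) ∘ₗ tensorAct β ((Algebra.lmul k H).comp (f : U →ₐ[k] H)) u =
      tensorAct ((Algebra.lmul k H).comp (f : U →ₐ[k] H)) β u ∘ₗ braid c (Algebra.lmul k H)) :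
    c * ∑ j ∈ (ℛ k u).index, f ((ℛ k u).right j) ⊗ₜ[k] β ((ℛ k u).left j) =
      (∑ j ∈ (ℛ k u).index, f ((ℛ k u).left j) ⊗ₜ[k] β ((ℛ k u).right j)) * c := by
  refine slice_ext fun φ => LinearMap.ext fun v => ?_
  rw [← slice_tensorEnd_lmul, ← slice_tensorEnd_lmul]
  congr 1
  have h1 := LinearMap.congr_fun h (v ⊗ₜ 1)
  have h2 : ∀ z : H ⊗[k] V, tensorAct ((Algebra.lmul k H).comp (f : U →ₐ[k] H)) β u z =
      ∑ j ∈ (ℛ k u).index, TensorProduct.map (Algebra.lmul k H (f ((ℛ k u).left j)))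
        (β ((ℛ k u).right j)) z := by
    intro z
    induction z with
    | zero => simp
    | add z z' h h' => simp only [map_add, h, h', Finset.sum_add_distrib]
    | tmul y v => exact tensorAct_tmul _ _ (ℛ k u) y v
  rw [LinearMap.comp_apply, LinearMap.comp_apply, h2, tensorAct_tmul _ _ (ℛ k u)] at h1
  simpa [braid, tensorEnd_tmul] using h1

end Linear

variable {k : Type u} [Field k] {U : Type u} [Ring U] [HopfAlgebra k U]
  {H : Type u} [Ring H] [HopfAlgebra k H] [Module.Finite k H] (f : U →ₐc[k] H)

namespace RelativeCenter
variable {f} (Q : RelativeCenter (RepCat.res (k := k) f))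

/-- The linear map underlying the half braiding. -/
def γLin (Y : RepCat k H) : Q.V.V ⊗[k] Y.V →ₗ[k] Y.V ⊗[k] Q.V.V :=
  RepCat.toLin (X := Q.V ⊗ (RepCat.res f).obj Y) (Y := (RepCat.res f).obj Y ⊗ Q.V) (Q.γ Y)

/-- The (antimultiplicative) action of `H^*` on an object of the relative center, read off from the half
braiding with the regular representation. -/
def centerMap : DualCop k H →ₗ[k] Module.End k Q.V.V :=
  sliceMap (Q.γLin (RepCat.regular k H))

/-- The half braiding is determined by the action of `H^*`, by naturality with respect to the maps
`H → Y`, `h ↦ h y`. -/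
lemma γLin_eq (Y : RepCat k H) : Q.γLin Y = braid (canonTensor Q.centerMap) Y.ρ :=
  eq_braid_sliceMap Y.ρ _ _ fun y z =>
    LinearMap.congr_fun (congrArg RepCat.toLin (Q.naturality (RepCat.orbit Y y))) z

lemma centerMap_one : Q.centerMap 1 = 1 := by
  refine LinearMap.ext fun v => ?_
  have h1 : Q.γLin (𝟙_ (RepCat k H)) (v ⊗ₜ (1 : k)) =
      TensorProduct.map (LinearMap.id : k →ₗ[k] k) (LinearMap.id : Q.V.V →ₗ[k] Q.V.V)
        ((TensorProduct.lid k Q.V.V).symm (TensorProduct.rid k Q.V.V (v ⊗ₜ (1 : k)))) :=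
    LinearMap.congr_fun (congrArg RepCat.toLin Q.unit) (v ⊗ₜ (1 : k))
  rw [TensorProduct.map_id, ← tmul_eq_lid_symm_rid, γLin_eq] at h1
  have h2 := (braid_unitAct Q.centerMap v 1).symm.trans h1
  simpa using congrArg (TensorProduct.lid k Q.V.V) h2

/-- The hexagon at `H ⊗ H` makes the action of `H^*` antimultiplicative. -/
lemma centerMap_mul (φ ψ : DualCop k H) :
    Q.centerMap (φ * ψ) = Q.centerMap ψ * Q.centerMap φ := by
  refine antimul_of_braid (fun v => ?_) φ ψ
  have h : Q.γLin (RepCat.regular k H ⊗ RepCat.regular k H) (v ⊗ₜ ((1 : H) ⊗ₜ[k] (1 : H))) =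
      TensorProduct.map (LinearMap.id : H ⊗[k] H →ₗ[k] H ⊗[k] H) (LinearMap.id : Q.V.V →ₗ[k] Q.V.V)
        ((TensorProduct.assoc k H H Q.V.V).symm
          (TensorProduct.map (LinearMap.id : H →ₗ[k] H) (Q.γLin (RepCat.regular k H))
            (TensorProduct.assoc k H Q.V.V H
              (TensorProduct.map (Q.γLin (RepCat.regular k H)) (LinearMap.id : H →ₗ[k] H)
                ((v ⊗ₜ (1 : H)) ⊗ₜ (1 : H)))))) :=
    LinearMap.congr_fun (congrArg RepCat.toLin
      (Q.tensor (RepCat.regular k H) (RepCat.regular k H))) (v ⊗ₜ ((1 : H) ⊗ₜ[k] (1 : H)))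
  rw [γLin_eq, γLin_eq, TensorProduct.map_id] at h
  exact h

variable [Module.Finite k U]

/-- The commutation rule is the `U`-linearity of the half braiding with the regular representation. -/
lemma crossed_centerMap : (skewPairing (dualCopMap f)).Crossed
    (ofAntiMap Q.centerMap Q.centerMap_one Q.centerMap_mul) Q.V.ρ := by
  rw [crossed_iff_canonTensor]
  intro u
  rw [antiMap_ofAntiMap]
  refine commutation_of_braid_equivariant f Q.V.ρ _ u ?_
  have h : Q.γLin (RepCat.regular k H) ∘ₗ
      tensorAct Q.V.ρ ((Algebra.lmul k H).comp (f : U →ₐ[k] H)) u =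
      tensorAct ((Algebra.lmul k H).comp (f : U →ₐ[k] H)) Q.V.ρ u ∘ₗ Q.γLin (RepCat.regular k H) :=
    RepCat.toLin_comm (Q.γ (RepCat.regular k H)) u
  rw [γLin_eq] at h
  exact h

/-- The representation of the double attached to an object of the relative center. -/
def toRep : RepCat k (GeneralizedDouble (dualCopMap f)) where
  V := Q.V.V
  ρ := (skewPairing (dualCopMap f)).lift Q.crossed_centerMap

lemma antiMap_dualAction_toRep : antiMap (dualAction f Q.toRep) = Q.centerMap := by
  have h : dualAction f Q.toRep = ofAntiMap Q.centerMap Q.centerMap_one Q.centerMap_mul :=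
    AlgHom.ext fun φ => (skewPairing (dualCopMap f)).lift_inl Q.crossed_centerMap φ
  rw [h]
  exact antiMap_ofAntiMap _ _ _

/-- An object of the relative center is isomorphic to the one attached to its representation of the
double. -/
def ofRepToRep : ofRep f Q.toRep ≅ Q :=
  isoMk (RepCat.isoMk (LinearEquiv.refl k Q.V.V) fun u =>
    (skewPairing (dualCopMap f)).lift_inr Q.crossed_centerMap u) fun Y =>
      RepCat.toLin_injective (TensorProduct.ext' fun v y => by
        have h : Q.γLin Y (v ⊗ₜ y) = TensorProduct.map (LinearMap.id : Y.V →ₗ[k] Y.V)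
            (LinearMap.id : Q.V.V →ₗ[k] Q.V.V)
            (braid (canonTensor (antiMap (dualAction f Q.toRep))) Y.ρ (v ⊗ₜ y)) := by
          rw [TensorProduct.map_id, antiMap_dualAction_toRep, γLin_eq]
          rfl
        exact h)

end RelativeCenter

variable [Module.Finite k U]

/-- Every object of the relative center comes from the representation of the double given by its action
of `U` and the action of `H^*`. -/
instance : (RelativeCenter.repFunctor f).EssSurj where
  mem_essImage Q := ⟨Q.toRep, ⟨Q.ofRepToRep⟩⟩

instance : (RelativeCenter.repFunctor f).IsEquivalence where

/-- The equivalence between the representations of the generalized double and the relative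
center. -/
def doubleEquivalence :
    RepCat k (GeneralizedDouble (dualCopMap f)) ≌ RelativeCenter (RepCat.res (k := k) f) :=
  (RelativeCenter.repFunctor f).asEquivalence

instance : (doubleEquivalence f).functor.Monoidal :=
  (inferInstance : (RelativeCenter.repFunctor f).Monoidal)

instance : (doubleEquivalence f).functor.Additive :=
  (inferInstance : (RelativeCenter.repFunctor f).Additive)

instance : (doubleEquivalence f).functor.Linear k :=
  (inferInstance : (RelativeCenter.repFunctor f).Linear k)

end EssSurj
end GenDouble

end
open CategoryTheory GenDouble

theorem proposition5p9 {k : Type u} [Field k] [IsAlgClosed k] [CharZero k]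
    {U : Type u} [Ring U] [HopfAlgebra k U] [Module.Finite k U] [IsSemisimpleRing U]
    {H : Type u} [Ring H] [HopfAlgebra k H] [Module.Finite k H] [IsSemisimpleRing H]
    (f : U →ₐc[k] H) :
    IsFusionCategory k (RepCat k (GeneralizedDouble (dualCopMap f))) ∧
    IsFusionCategory k (RelativeCenter (RepCat.res (k := k) f)) ∧
    ∃ e : RepCat k (GeneralizedDouble (dualCopMap f)) ≌ RelativeCenter (RepCat.res (k := k) f),
      Nonempty e.functor.Monoidal ∧ e.functor.Additive ∧ e.functor.Linear k := by
  have := isSemisimpleRing_generalizedDouble f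
  have hD := RepCat.isFusionCategory k (GeneralizedDouble (dualCopMap f))
  exact ⟨hD, hD.of_equivalence (doubleEquivalence f), doubleEquivalence f, ⟨inferInstance⟩,
    inferInstance, inferInstance⟩
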